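/- **Notation.** Let $J=\begin{bmatrix}0&I_2\\-I_2&0\end{bmatrix}$, let $\mathrm{GSp}(4,\mathbb R)=\{g\in \mathrm{GL}(4,\mathbb R): {}^tgJg=\mu_2(g)J\}$ with multiplier $\mu_2(g)\in\mathbb R^\times$, let $K=\mathrm{GSp}(4,\mathbb R)\cap \mathrm O(4)$ and $K^1=\mathrm{Sp}(4,\mathbb R)\cap\mathrm O(4)$. For a real Lie algebra element $X\in\mathfrak{sp}(4,\mathbb R)$ and smooth $B:\mathrm{GSp}(4,\mathbb R)\to\mathbb C$ put $(X.B)(g)=\frac{d}{dt}\big|_0B(g\exp(tX))$, extended complex-linearly to $X\in\mathfrak{sp}(4,\mathbb C)$. Consider the following elements of $\mathfrak{sp}(4,\mathbb C)$: $$Z=-i\begin{bmatrix}0&0&1&0\\0&0&0&0\\-1&0&0&0\\0&0&0&0\end{bmatrix},\quad Z'=-i\begin{bmatrix}0&0&0&0\\0&0&0&1\\0&0&0&0\\0&-1&0&0\end{bmatrix},\quad N_+=\tfrac12\begin{bmatrix}0&1&0&-i\\-1&0&-i&0\\0&i&0&1\\i&0&-1&0\end{bmatrix},$$ $$X_-=\tfrac12\begin{bmatrix}1&0&-i&0\\0&0&0&0\\-i&0&-1&0\\0&0&0&0\end{bmatrix},\quad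 P_{1-}=\tfrac12\begin{bmatrix}0&1&0&-i\\1&0&-i&0\\0&-i&0&-1\\-i&0&-1&0\end{bmatrix},\quad P_{0-}=\tfrac12\begin{bmatrix}0&0&0&0\\0&1&0&-i\\0&0&0&0\\0&-i&0&-1\end{bmatrix}.$$ Let $U(\mathbb R)$ be the group of the $\begin{bmatrix}1&X\\&1\end{bmatrix}$ with ${}^tX=X\in M_2(\mathbb R)$, and $\theta\big(\begin{bmatrix}1&X\\&1\end{bmatrix}\big)=e^{2\pi i\,\mathrm{tr}(X)}$ (the non-split case $S=I_2$). Let $T(\mathbb R)=\{g\in\mathrm{GL}(2,\mathbb R):{}^tgg=\det(g)I_2\}=\{\begin{bmatrix}x&y\\-y&x\end{bmatrix}: x^2+y^2>0\}\cong\mathbb C^\times$, embedded in $\mathrm{GSp}(4,\mathbb R)$ by $g\mapsto\begin{bmatrix}g&\\&\det(g)\,{}^tg^{-1}\end{bmatrix}$. For $(s,m)\in\mathbb C\times\mathbb Z$ let $\Lambda$ be the character of $T(\mathbb R)$ with $\Lambda\big(\gamma\begin{bmatrix}\cos\delta&\sin\delta\\-\sin\delta&\cos\delta\end{bmatrix}\big)=\gamma^se^{im\delta}$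 for $\gamma>0$, $\delta\in\mathbb R$. For integers $l,l'$ let $\mathcal S(\Lambda,\theta,l,l')$ be the complex vector space of functions $B:\mathrm{GSp}(4,\mathbb R)\to\mathbb C$ such that 1. $B$ is smooth and right $K$-finite; 2. $B(tug)=\Lambda(t)\theta(u)B(g)$ for all $t\in T(\mathbb R)$, $u\in U(\mathbb R)$, $g\in\mathrm{GSp}(4,\mathbb R)$; 3. $B$ is slowly increasing: there are $\alpha,\beta>0$ with $|B(g)|\le\alpha\|g\|^\beta$ for all $g$, where $\|g\|=\big(\mu_2(g)^{-2}+\sum_{i,j}g_{ij}^2\big)^{1/2}$; 4. $Z.B=lB$ and $Z'.B=l'B$; 5. $N_+.B=X_-.B=P_{1-}.B=P_{0-}.B=0$. For $\lambda,\zeta\in\mathbb R^\times$ and $\varphi_1,\varphi_2\in\mathbb R$ let $h(\lambda,\zeta,\varphi_1,\varphi_2)=\mathrm{diag}(\lambda\zeta,\lambda\zeta^{-1},\zeta^{-1},\zeta)\,r_1(\varphi_1)\,r_2(\varphi_2)$, where $$r_1(\varphi)=\begin{bmatrix}\cos\varphi&\sin\varphi&&\\-\sin\varphi&\cos\varphi&&\\&&\cos\varphi&\sin\varphi\\&&-\sin\varphi&\cos\varphi\end{bmatrix},\qquad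 r_2(\varphi)=\begin{bmatrix}\cos\varphi&&&\sin\varphi\\&\cos\varphi&\sin\varphi&\\&-\sin\varphi&\cos\varphi&\\-\sin\varphi&&&\cos\varphi\end{bmatrix}.$$ Put $u=\cos\varphi_1\cos\varphi_2+i\sin\varphi_1\sin\varphi_2$, $v=\cos\varphi_1\sin\varphi_2+i\sin\varphi_1\cos\varphi_2$, $w=(\zeta^2-\zeta^{-2})(\cos2\varphi_1+i\sin2\varphi_1\sin2\varphi_2)+(\zeta^2+\zeta^{-2})\cos2\varphi_2$, and $$c_1(\zeta,\varphi_1,\varphi_2)=\begin{cases}(\zeta u+\zeta^{-1}v)^m\,w^{(l-l'-m)/2}&\text{if }m\ge0,\\ 2^{-m}(\zeta u-\zeta^{-1}v)^{-m}\,w^{(l-l'+m)/2}&\text{if }m<0\end{cases}$$ (the two expressions agree wherever all factors are non-zero). **Theorem.** Let $l\ge l'>0$ be integers and let $\Lambda$ be the character of $T(\mathbb R)$ given by $(s,m)\in\mathbb C\times\mathbb Z$. If $l+l'+m$ is odd, then $\mathcal S(\Lambda,\theta,l,l')=0$. If $l+l'+m$ is even, then $$\dim_{\mathbb C}\mathcal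 S(\Lambda,\theta,l,l')=\begin{cases}1&\text{if }|m|\le l-l',\\0&\text{if }|m|>l-l'.\end{cases}$$ Assume that $l+l'+m$ is even and $|m|\le l-l'$, and let $B_0$ be a non-zero element of $\mathcal S(\Lambda,\theta,l,l')$. Then there is a constant $c\in\mathbb C^\times$ such that for all $\lambda\in\mathbb R^\times$, $\zeta>0$ and $\varphi_1,\varphi_2\in\mathbb R$ $$B_0(h(\lambda,\zeta,\varphi_1,\varphi_2))=\begin{cases}c\;c_1(\zeta,\varphi_1,\varphi_2)\,\lambda^{\frac{l+l'+s}2}e^{-2\pi\lambda(\zeta^2+\zeta^{-2})}&\text{if }\lambda>0,\\0&\text{if }\lambda<0.\end{cases}$$ Moreover, there exist real-analytic functions $A_j:K^1\to\mathbb C$, for $j\in\{-(l-l'),\dots,l-l'\}$, which are zero for $j\not\equiv l-l'$ mod $2$, such that $$B_0(h(\lambda,\zeta,0,0)k)=\Big(\sum_{j=-(l-l')}^{l-l'}A_j(k)\zeta^j\Big)\lambda^{\frac{l+l'+s}2}e^{-2\pi\lambda(\zeta^2+\zeta^{-2})}$$ for all $\lambda,\zeta>0$ and $k\in K^1$. 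-/

import Mathlib

open Matrix
open scoped ContDiff Matrix.Norms.Operator

noncomputable section

namespace Bessel

/-! ### The group GSp(4,ℝ) -/

/-- Real `4 × 4` matrices. -/
abbrev M4 : Type := Matrix (Fin 4) (Fin 4) ℝ

/-- The standard symplectic form. -/
def J4 (R : Type*) [CommRing R] : Matrix (Fin 4) (Fin 4) R :=
  !![0, 0, 1, 0; 0, 0, 0, 1; -1, 0, 0, 0; 0, -1, 0, 0]

theorem J4_mul_J4 (R : Type*) [CommRing R] : J4 R * J4 R = -1 := by
  ext i j
  fin_cases i <;> fin_cases j <;> simp [J4, Matrix.mul_apply, Fin.sum_univ_four]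

/-- `GSp(4,ℝ) = {g ∈ GL(4,ℝ) : ᵗg J g = μ J for some scalar μ}`. -/
def GSp4 : Subgroup (GL (Fin 4) ℝ) where
  carrier := {g | ∃ μ : ℝ, (g : M4)ᵀ * J4 ℝ * (g : M4) = μ • J4 ℝ}
  one_mem' := ⟨1, by simp⟩
  mul_mem' := by
    rintro a b ⟨x, hx⟩ ⟨y, hy⟩
    refine ⟨x * y, ?_⟩
    calc ((a * b : GL (Fin 4) ℝ) : M4)ᵀ * J4 ℝ * ((a * b : GL (Fin 4) ℝ) : M4)
        = (b : M4)ᵀ * ((a : M4)ᵀ * J4 ℝ * (a : M4)) * (b : M4) := by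
          simp [Matrix.mul_assoc]
      _ = (x * y) • J4 ℝ := by
          rw [hx, Matrix.mul_smul, Matrix.smul_mul, hy, smul_smul]
  inv_mem' := by
    rintro a ⟨x, hx⟩
    have h1 : (a : M4) * ((a⁻¹ : GL (Fin 4) ℝ) : M4) = 1 := by
      rw [← Units.val_mul, mul_inv_cancel, Units.val_one]
    have h2 : ((a⁻¹ : GL (Fin 4) ℝ) : M4)ᵀ * (a : M4)ᵀ = 1 := by
      rw [← Matrix.transpose_mul, h1, Matrix.transpose_one]
    have key : J4 ℝ
        = x • (((a⁻¹ : GL (Fin 4) ℝ) : M4)ᵀ * J4 ℝ * ((a⁻¹ : GL (Fin 4) ℝ) : M4)) := by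
      calc J4 ℝ = (((a⁻¹ : GL (Fin 4) ℝ) : M4)ᵀ * (a : M4)ᵀ) * J4 ℝ *
              ((a : M4) * ((a⁻¹ : GL (Fin 4) ℝ) : M4)) := by rw [h1, h2]; simp
        _ = ((a⁻¹ : GL (Fin 4) ℝ) : M4)ᵀ * ((a : M4)ᵀ * J4 ℝ * (a : M4)) *
              ((a⁻¹ : GL (Fin 4) ℝ) : M4) := by simp only [Matrix.mul_assoc]
        _ = _ := by rw [hx, Matrix.mul_smul, Matrix.smul_mul]
    have hx0 : x ≠ 0 := by
      rintro rfl
      have h02 := congrFun (congrFun key 0) 2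
      simp [J4] at h02
    refine ⟨x⁻¹, ?_⟩
    conv_rhs => rw [key]
    rw [smul_smul, inv_mul_cancel₀ hx0, one_smul]

/-- The underlying real matrix of an element of `GSp(4,ℝ)`. -/
abbrev mat (g : GSp4) : M4 := ((g : GL (Fin 4) ℝ) : M4)

/-- The multiplier `μ₂(g)`, read off from an entry of `ᵗg J g = μ₂(g) J`; see `mat_mem`. -/
def mu2 (g : GSp4) : ℝ := ((mat g)ᵀ * J4 ℝ * mat g) 0 2

theorem mat_mem (g : GSp4) : (mat g)ᵀ * J4 ℝ * mat g = mu2 g • J4 ℝ := by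
  obtain ⟨μ, hμ⟩ := g.2
  have : mu2 g = μ := by
    rw [mu2, hμ]; simp [J4]
  rw [this]; exact hμ

/-- A matrix `M` with `ᵗM J M = μ J`, `μ ≠ 0`, as an element of `GSp(4,ℝ)`. -/
def mkGSp (M : M4) (μ : ℝ) (hμ : μ ≠ 0) (h : Mᵀ * J4 ℝ * M = μ • J4 ℝ) : GSp4 :=
  have hl : (-μ⁻¹ • (J4 ℝ * Mᵀ * J4 ℝ)) * M = 1 := by
    rw [Matrix.smul_mul, Matrix.mul_assoc, Matrix.mul_assoc, ← Matrix.mul_assoc Mᵀ, h,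
      Matrix.mul_smul, J4_mul_J4, smul_smul]
    simp [hμ]
  ⟨⟨M, -μ⁻¹ • (J4 ℝ * Mᵀ * J4 ℝ), mul_eq_one_comm.mp hl, hl⟩, μ, h⟩

@[simp]
theorem mat_mkGSp (M : M4) (μ : ℝ) (hμ : μ ≠ 0) (h : Mᵀ * J4 ℝ * M = μ • J4 ℝ) :
    mat (mkGSp M μ hμ h) = M := rfl

/-- The standard maximal compact subgroup `K = GSp(4,ℝ) ∩ O(4)`. -/
def K : Subgroup GSp4 where
  carrier := {g | (mat g)ᵀ * mat g = 1}
  one_mem' := by simp [mat]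
  mul_mem' := by
    intro a b ha hb
    simp only [Set.mem_ofPred_eq, mat, Subgroup.coe_mul, Units.val_mul,
      Matrix.transpose_mul] at *
    rw [Matrix.mul_assoc, ← Matrix.mul_assoc _ _ (((b : GL (Fin 4) ℝ)) : M4), ha,
      Matrix.one_mul, hb]
  inv_mem' := by
    intro a ha
    have h1 : mat a * mat a⁻¹ = 1 := by
      simp [mat]
    have h3 : mat a⁻¹ = (mat a)ᵀ := by
      calc mat a⁻¹ = ((mat a)ᵀ * mat a) * mat a⁻¹ := by
            rw [show (mat a)ᵀ * mat a = 1 from ha, Matrix.one_mul]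
        _ = _ := by rw [Matrix.mul_assoc, h1, Matrix.mul_one]
    change (mat a⁻¹)ᵀ * mat a⁻¹ = 1
    rw [h3, Matrix.transpose_transpose, ← h3, h1]

/-- `Sp(4,ℝ)`, as a subgroup of `GSp(4,ℝ)`. -/
def Sp4 : Subgroup GSp4 where
  carrier := {g | (mat g)ᵀ * J4 ℝ * mat g = J4 ℝ}
  one_mem' := by simp [mat]
  mul_mem' := by
    intro a b ha hb
    simp only [Set.mem_ofPred_eq, mat, Subgroup.coe_mul, Units.val_mul,
      Matrix.transpose_mul] at *
    conv_rhs => rw [← hb, ← ha]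
    simp only [Matrix.mul_assoc]
  inv_mem' := by
    intro a ha
    have h1 : mat a * mat a⁻¹ = 1 := by
      simp [mat]
    have h2 : (mat a⁻¹)ᵀ * (mat a)ᵀ = 1 := by
      rw [← Matrix.transpose_mul, h1, Matrix.transpose_one]
    change (mat a⁻¹)ᵀ * J4 ℝ * mat a⁻¹ = J4 ℝ
    have ha' : (mat a)ᵀ * J4 ℝ * mat a = J4 ℝ := ha
    calc (mat a⁻¹)ᵀ * J4 ℝ * mat a⁻¹
        = ((mat a⁻¹)ᵀ * (mat a)ᵀ) * J4 ℝ * (mat a * mat a⁻¹) := by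
          conv_lhs => rw [← ha']
          simp only [Matrix.mul_assoc]
      _ = J4 ℝ := by rw [h1, h2]; simp

/-- The standard maximal compact subgroup `K¹ = Sp(4,ℝ) ∩ O(4)` of `Sp(4,ℝ)`. -/
def K1 : Subgroup GSp4 := K ⊓ Sp4

/-! ### Smooth and analytic functions

The groups `GSp(4,ℝ)` and `K¹` are (real-analytic) embedded submanifolds of the space of
`4 × 4` matrices, so that a function on them is smooth or analytic exactly if it is locally the
restriction of a smooth or analytic function on an open set of matrices. -/

/-- `f` is of class `C^n` on the submanifold of `M4` given by the embedding `ι`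
(`n = ∞`: smooth; `n = ω`: real-analytic). -/
def IsCn (n : WithTop ℕ∞) {X : Type*} (ι : X → M4) (f : X → ℂ) : Prop :=
  ∀ x : X, ∃ (U : Set M4) (F : M4 → ℂ), IsOpen U ∧ ι x ∈ U ∧ ContDiffOn ℝ n F U ∧
    ∀ y : X, ι y ∈ U → f y = F (ι y)

/-- Smooth functions on `GSp(4,ℝ)`. -/
def IsSmooth (B : GSp4 → ℂ) : Prop := IsCn ∞ mat B

/-- Real-analytic functions on `K¹`. -/
def IsAnalyticK1 (A : K1 → ℂ) : Prop := IsCn ω (fun k : K1 => mat (k : GSp4)) A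

/-! ### The Lie algebra and its action by right translation -/

/-- The Lie algebra `𝔰𝔭(4,R)`: the matrices `X` with `ᵗX J = - J X`.  For `R = ℝ` this is
`𝔤¹`, for `R = ℂ` its complexification. -/
abbrev sp4 (R : Type*) [CommRing R] : Submodule R (Matrix (Fin 4) (Fin 4) R) :=
  skewAdjointMatricesSubmodule (J4 R)

theorem mem_sp4 {R : Type*} [CommRing R] {X : Matrix (Fin 4) (Fin 4) R} :
    X ∈ sp4 R ↔ Xᵀ * J4 R = J4 R * (-X) := by
  simp [sp4, Matrix.IsSkewAdjoint, Matrix.IsAdjointPair]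

/-- The exponential map `𝔰𝔭(4,ℝ) → GSp(4,ℝ)`. -/
def expSp (X : sp4 ℝ) : GSp4 :=
  mkGSp (NormedSpace.exp (X : M4)) 1 one_ne_zero (by
    have hX : (X : M4)ᵀ * J4 ℝ = J4 ℝ * (-(X : M4)) := mem_sp4.mp X.2
    let u : M4ˣ := ⟨J4 ℝ, -J4 ℝ, by simp [J4_mul_J4], by simp [J4_mul_J4]⟩
    have hu : (X : M4)ᵀ = (u : M4) * (-(X : M4)) * ((u⁻¹ : M4ˣ) : M4) := by
      change (X : M4)ᵀ = J4 ℝ * (-(X : M4)) * (-J4 ℝ)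
      rw [← hX, Matrix.mul_assoc, Matrix.mul_neg, J4_mul_J4]; simp
    have hinv : ((u⁻¹ : M4ˣ) : M4) * J4 ℝ = 1 := by
      change (-J4 ℝ) * J4 ℝ = 1
      rw [Matrix.neg_mul, J4_mul_J4]; simp
    rw [← Matrix.exp_transpose, hu, Matrix.exp_units_conj, Matrix.mul_assoc _ _ (J4 ℝ), hinv,
      Matrix.mul_one, Matrix.mul_assoc, ← Matrix.exp_add_of_commute _ _ (by simp)]
    simp [u])

/-- `(X.B)(g) = d/dt|₀ B(g exp(tX))` for `X ∈ 𝔰𝔭(4,ℝ)`. -/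
def lieDeriv (X : sp4 ℝ) (B : GSp4 → ℂ) : GSp4 → ℂ :=
  fun g => deriv (fun t : ℝ => B (g * expSp (t • X))) 0

/-- The entrywise real part of an element of the complexified Lie algebra. -/
def rePart (X : sp4 ℂ) : sp4 ℝ :=
  ⟨(X : Matrix (Fin 4) (Fin 4) ℂ).map Complex.re, by
    have h := mem_sp4.mp X.2
    rw [mem_sp4]
    ext i j
    have hij := congrArg Complex.re (congrFun (congrFun h i) j)
    fin_cases i <;> fin_cases j <;>
      simp [J4, Matrix.mul_apply, Fin.sum_univ_four] at hij ⊢ <;> exact hij⟩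

/-- The entrywise imaginary part of an element of the complexified Lie algebra. -/
def imPart (X : sp4 ℂ) : sp4 ℝ :=
  ⟨(X : Matrix (Fin 4) (Fin 4) ℂ).map Complex.im, by
    have h := mem_sp4.mp X.2
    rw [mem_sp4]
    ext i j
    have hij := congrArg Complex.im (congrFun (congrFun h i) j)
    fin_cases i <;> fin_cases j <;>
      simp [J4, Matrix.mul_apply, Fin.sum_univ_four] at hij ⊢ <;> exact hij⟩

/-- The complex-linear extension of `lieDeriv` to the complexified Lie algebra. -/
def lieAct (X : sp4 ℂ) (B : GSp4 → ℂ) : GSp4 → ℂ :=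
  fun g => lieDeriv (rePart X) B g + Complex.I * lieDeriv (imPart X) B g

open Complex (I)

/-- The element `Z`. -/
def Z : sp4 ℂ := ⟨(-I) • !![0, 0, 1, 0; 0, 0, 0, 0; -1, 0, 0, 0; 0, 0, 0, 0], by
  rw [mem_sp4]; ext i j
  fin_cases i <;> fin_cases j <;> simp [J4, Matrix.mul_apply, Fin.sum_univ_four]⟩

/-- The element `Z'`. -/
def Z' : sp4 ℂ := ⟨(-I) • !![0, 0, 0, 0; 0, 0, 0, 1; 0, 0, 0, 0; 0, -1, 0, 0], by
  rw [mem_sp4]; ext i j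
  fin_cases i <;> fin_cases j <;> simp [J4, Matrix.mul_apply, Fin.sum_univ_four]⟩

/-- The element `N₊`. -/
def Nplus : sp4 ℂ :=
  ⟨(1 / 2 : ℂ) • !![0, 1, 0, -I; -1, 0, -I, 0; 0, I, 0, 1; I, 0, -1, 0], by
  rw [mem_sp4]; ext i j
  fin_cases i <;> fin_cases j <;> simp [J4, Matrix.mul_apply, Fin.sum_univ_four]⟩

/-- The element `X₋`. -/
def Xminus : sp4 ℂ :=
  ⟨(1 / 2 : ℂ) • !![1, 0, -I, 0; 0, 0, 0, 0; -I, 0, -1, 0; 0, 0, 0, 0], by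
  rw [mem_sp4]; ext i j
  fin_cases i <;> fin_cases j <;> simp [J4, Matrix.mul_apply, Fin.sum_univ_four]⟩

/-- The element `P₁₋`. -/
def P1minus : sp4 ℂ :=
  ⟨(1 / 2 : ℂ) • !![0, 1, 0, -I; 1, 0, -I, 0; 0, -I, 0, -1; -I, 0, -1, 0], by
  rw [mem_sp4]; ext i j
  fin_cases i <;> fin_cases j <;> simp [J4, Matrix.mul_apply, Fin.sum_univ_four]⟩

/-- The element `P₀₋`. -/
def P0minus : sp4 ℂ :=
  ⟨(1 / 2 : ℂ) • !![0, 0, 0, 0; 0, 1, 0, -I; 0, 0, 0, 0; 0, -I, 0, -1], by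
  rw [mem_sp4]; ext i j
  fin_cases i <;> fin_cases j <;> simp [J4, Matrix.mul_apply, Fin.sum_univ_four]⟩

/-! ### The Bessel subgroup and its characters (`S = 1`) -/

/-- The block matrix with blocks `A, B, C, D`. -/
def blk (A B C D : Matrix (Fin 2) (Fin 2) ℝ) : M4 :=
  !![A 0 0, A 0 1, B 0 0, B 0 1;
     A 1 0, A 1 1, B 1 0, B 1 1;
     C 0 0, C 0 1, D 0 0, D 0 1;
     C 1 0, C 1 1, D 1 0, D 1 1]

/-- The embedding of `GL(2,ℝ)` in the Siegel Levi subgroup, with blocks `g` and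
`det(g) ᵗg⁻¹`. -/
def levi (g : GL (Fin 2) ℝ) : GSp4 :=
  mkGSp (blk g 0 0 ((g : Matrix (Fin 2) (Fin 2) ℝ).det • ((g : Matrix (Fin 2) (Fin 2) ℝ)⁻¹)ᵀ))
    (g : Matrix (Fin 2) (Fin 2) ℝ).det (Matrix.GeneralLinearGroup.det_ne_zero g) (by
      have hd := Matrix.GeneralLinearGroup.det_ne_zero g
      rw [Matrix.inv_def, Ring.inverse_eq_inv', Matrix.transpose_smul, smul_smul,
        mul_inv_cancel₀ hd, one_smul, Matrix.adjugate_fin_two, Matrix.det_fin_two]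
      ext i j
      fin_cases i <;> fin_cases j <;>
        simp [blk, J4, Matrix.mul_apply, Fin.sum_univ_four] <;> ring)

/-- The unipotent element with blocks `1, X, 0, 1`, for symmetric `X`. -/
def unip (X : Matrix (Fin 2) (Fin 2) ℝ) (hX : X.IsSymm) : GSp4 :=
  mkGSp (blk 1 X 0 1) 1 one_ne_zero (by
    have h01 : X 1 0 = X 0 1 := hX.apply 0 1
    ext i j
    fin_cases i <;> fin_cases j <;>
      simp [blk, J4, Matrix.mul_apply, Fin.sum_univ_four, h01])

/-- The symmetric matrix `S` of the non-split case. -/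
def S : Matrix (Fin 2) (Fin 2) ℝ := 1

/-- `T(ℝ) = {g ∈ GL(2,ℝ) : ᵗg S g = det(g) S}`. -/
def T : Subgroup (GL (Fin 2) ℝ) where
  carrier := {g | (g : Matrix (Fin 2) (Fin 2) ℝ)ᵀ * S * (g : Matrix (Fin 2) (Fin 2) ℝ)
    = (g : Matrix (Fin 2) (Fin 2) ℝ).det • S}
  one_mem' := by simp
  mul_mem' := by
    intro a b ha hb
    simp only [Set.mem_ofPred_eq, S, Matrix.mul_one, Units.val_mul, Matrix.transpose_mul,
      Matrix.det_mul] at *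
    rw [Matrix.mul_assoc, ← Matrix.mul_assoc _ _ (b : Matrix (Fin 2) (Fin 2) ℝ), ha,
      Matrix.smul_mul, Matrix.one_mul, Matrix.mul_smul, hb, smul_smul]
  inv_mem' := by
    intro a ha
    have hd := Matrix.GeneralLinearGroup.det_ne_zero a
    simp only [Set.mem_ofPred_eq, S, Matrix.mul_one] at *
    have h1 : (a : Matrix (Fin 2) (Fin 2) ℝ) * ((a⁻¹ : GL (Fin 2) ℝ) :
        Matrix (Fin 2) (Fin 2) ℝ) = 1 := by
      rw [← Units.val_mul, mul_inv_cancel, Units.val_one]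
    have h2 : ((a⁻¹ : GL (Fin 2) ℝ) : Matrix (Fin 2) (Fin 2) ℝ)ᵀ *
        (a : Matrix (Fin 2) (Fin 2) ℝ)ᵀ = 1 := by
      rw [← Matrix.transpose_mul, h1, Matrix.transpose_one]
    have h4 : (a : Matrix (Fin 2) (Fin 2) ℝ).det *
        ((a⁻¹ : GL (Fin 2) ℝ) : Matrix (Fin 2) (Fin 2) ℝ).det = 1 := by
      rw [← Matrix.det_mul, h1, Matrix.det_one]
    have h5 : (a : Matrix (Fin 2) (Fin 2) ℝ).det •
        (((a⁻¹ : GL (Fin 2) ℝ) : Matrix (Fin 2) (Fin 2) ℝ)ᵀ *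
          ((a⁻¹ : GL (Fin 2) ℝ) : Matrix (Fin 2) (Fin 2) ℝ)) = 1 := by
      calc _ = ((a⁻¹ : GL (Fin 2) ℝ) : Matrix (Fin 2) (Fin 2) ℝ)ᵀ *
            ((a : Matrix (Fin 2) (Fin 2) ℝ)ᵀ * (a : Matrix (Fin 2) (Fin 2) ℝ)) *
            ((a⁻¹ : GL (Fin 2) ℝ) : Matrix (Fin 2) (Fin 2) ℝ) := by
              rw [ha, Matrix.mul_smul, Matrix.smul_mul, Matrix.mul_one]
        _ = (((a⁻¹ : GL (Fin 2) ℝ) : Matrix (Fin 2) (Fin 2) ℝ)ᵀ *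
            (a : Matrix (Fin 2) (Fin 2) ℝ)ᵀ) * ((a : Matrix (Fin 2) (Fin 2) ℝ) *
            ((a⁻¹ : GL (Fin 2) ℝ) : Matrix (Fin 2) (Fin 2) ℝ)) := by
              simp only [Matrix.mul_assoc]
        _ = 1 := by rw [h1, h2, Matrix.one_mul]
    rw [← h5, smul_smul, mul_comm, h4, one_smul]

/-- The isomorphism of `T(ℝ)` with `ℂˣ`: the matrix with rows `(x, y)` and `(-y, x)` goes to
`x + iy`. -/
def toC (t : GL (Fin 2) ℝ) : ℂ := (t 0 0 : ℂ) + (t 0 1 : ℂ) * I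

/-- The character `Λ` of `T(ℝ) ≅ ℂˣ` given by `s` and `m`: `Λ(z) = |z|^s (z / |z|)^m`, that is
`Λ(γ e^{iδ}) = γ^s e^{imδ}`; see `Lam_apply`. -/
def Lam (s : ℂ) (m : ℤ) (t : GL (Fin 2) ℝ) : ℂ :=
  ((‖toC t‖ : ℝ) : ℂ) ^ s * (toC t / (‖toC t‖ : ℝ)) ^ m

theorem Lam_apply (s : ℂ) (m : ℤ) (t : GL (Fin 2) ℝ) (γ δ : ℝ) (hγ : 0 < γ)
    (ht : (t : Matrix (Fin 2) (Fin 2) ℝ) =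
      γ • !![Real.cos δ, Real.sin δ; -Real.sin δ, Real.cos δ]) :
    Lam s m t = (γ : ℂ) ^ s * Complex.exp (I * m * δ) := by
  have h : toC t = γ * Complex.exp (δ * I) := by
    have h0 : t 0 0 = γ * Real.cos δ := by
      have := congrFun (congrFun ht 0) 0
      simpa using this
    have h1 : t 0 1 = γ * Real.sin δ := by
      have := congrFun (congrFun ht 0) 1
      simpa using this
    rw [toC, h0, h1, Complex.exp_mul_I]
    push_cast
    ring
  have hn : ‖toC t‖ = γ := by
    rw [h, norm_mul, Complex.norm_exp_ofReal_mul_I, mul_one, Complex.norm_real,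
      Real.norm_of_nonneg hγ.le]
  have hγ' : (γ : ℂ) ≠ 0 := by exact_mod_cast hγ.ne'
  rw [Lam, hn, h, mul_div_cancel_left₀ _ hγ', ← Complex.exp_int_mul]
  congr 2
  ring

/-- The character `θ` of the unipotent radical: `θ(X) = e^{2πi tr(SX)}`. -/
def theta (X : Matrix (Fin 2) (Fin 2) ℝ) : ℂ :=
  Complex.exp (2 * Real.pi * I * ((S * X).trace : ℝ))

/-! ### Growth and `K`-finiteness -/

/-- The norm function `‖g‖ = (μ₂(g)⁻² + ∑ gᵢⱼ²)^{1/2}`. -/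
def gnorm (g : GSp4) : ℝ :=
  Real.sqrt ((mu2 g ^ 2)⁻¹ + ∑ i, ∑ j, (mat g i j) ^ 2)

/-- Slowly increasing functions. -/
def SlowlyIncreasing (B : GSp4 → ℂ) : Prop :=
  ∃ α β : ℝ, 0 < α ∧ 0 < β ∧ ∀ g, ‖B g‖ ≤ α * gnorm g ^ β

/-- The right translates of `B` under `K` span a finite-dimensional space. -/
def KFinite (B : GSp4 → ℂ) : Prop :=
  FiniteDimensional ℂ
    (Submodule.span ℂ (Set.range fun k : K => fun g : GSp4 => B (g * (k : GSp4))))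

/-! ### The space `𝒮(Λ,θ,l,l')` -/

/-- The defining conditions of `𝒮(Λ,θ,l,l')`, where `Λ` is given by `(s, m)`. -/
structure InBesselSpace (s : ℂ) (m l l' : ℤ) (B : GSp4 → ℂ) : Prop where
  smooth : IsSmooth B
  kfinite : KFinite B
  equivariant : ∀ t ∈ T, ∀ (X : Matrix (Fin 2) (Fin 2) ℝ) (hX : X.IsSymm) (g : GSp4),
    B (levi t * unip X hX * g) = Lam s m t * theta X * B g
  growth : SlowlyIncreasing B
  weight : lieAct Z B = (l : ℂ) • B
  weight' : lieAct Z' B = (l' : ℂ) • B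
  Nplus_eq : lieAct Nplus B = 0
  Xminus_eq : lieAct Xminus B = 0
  P1minus_eq : lieAct P1minus B = 0
  P0minus_eq : lieAct P0minus B = 0

/-! The remaining facts show that these conditions define a complex vector space. -/

theorem IsCn.add {n : WithTop ℕ∞} {X : Type*} {ι : X → M4} {f g : X → ℂ}
    (hf : IsCn n ι f) (hg : IsCn n ι g) : IsCn n ι (f + g) := by
  intro x
  obtain ⟨U, F, hU, hxU, hF, hfF⟩ := hf x
  obtain ⟨V, G, hV, hxV, hG, hgG⟩ := hg x
  refine ⟨U ∩ V, F + G, hU.inter hV, ⟨hxU, hxV⟩,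
    (hF.mono Set.inter_subset_left).add (hG.mono Set.inter_subset_right), ?_⟩
  rintro y ⟨hyU, hyV⟩
  simp [hfF y hyU, hgG y hyV]

theorem IsCn.smul {n : WithTop ℕ∞} {X : Type*} {ι : X → M4} {f : X → ℂ} (c : ℂ)
    (hf : IsCn n ι f) : IsCn n ι (c • f) := by
  intro x
  obtain ⟨U, F, hU, hxU, hF, hfF⟩ := hf x
  refine ⟨U, fun z => c • F z, hU, hxU, hF.const_smul c, ?_⟩
  intro y hyU
  simp [hfF y hyU]

theorem IsCn.zero {n : WithTop ℕ∞} {X : Type*} {ι : X → M4} :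
    IsCn n ι (0 : X → ℂ) := fun _ =>
  ⟨Set.univ, 0, isOpen_univ, trivial, contDiffOn_const, fun _ _ => rfl⟩

theorem IsSmooth.differentiableAt {B : GSp4 → ℂ} (hB : IsSmooth B) (g : GSp4) (X : sp4 ℝ) :
    DifferentiableAt ℝ (fun t : ℝ => B (g * expSp (t • X))) 0 := by
  obtain ⟨U, F, hU, hgU, hF, hBF⟩ := hB g
  have hc : DifferentiableAt ℝ (fun t : ℝ => mat g * NormedSpace.exp (t • (X : M4))) 0 :=
    ((hasDerivAt_exp_smul_const (𝕂 := ℝ) (X : M4) (0 : ℝ)).differentiableAt).const_mul (mat g)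
  have h0 : mat g * NormedSpace.exp ((0 : ℝ) • (X : M4)) = mat g := by
    rw [zero_smul, NormedSpace.exp_zero, mul_one]
  have hFd : DifferentiableAt ℝ F (mat g * NormedSpace.exp ((0 : ℝ) • (X : M4))) := by
    rw [h0]
    exact (hF.contDiffAt (hU.mem_nhds hgU)).differentiableAt (by simp)
  have hcomp := hFd.comp (0 : ℝ) hc
  refine hcomp.congr_of_eventuallyEq ?_
  have hev := hc.continuousAt.preimage_mem_nhds (by rw [h0]; exact hU.mem_nhds hgU)
  filter_upwards [hev] with t ht
  exact hBF (g * expSp (t • X)) ht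

theorem lieAct_add (X : sp4 ℂ) {B C : GSp4 → ℂ} (hB : IsSmooth B) (hC : IsSmooth C) :
    lieAct X (B + C) = lieAct X B + lieAct X C := by
  have key : ∀ (Y : sp4 ℝ) (g : GSp4), lieDeriv Y (B + C) g
      = lieDeriv Y B g + lieDeriv Y C g := fun Y g =>
    deriv_add (hB.differentiableAt g Y) (hC.differentiableAt g Y)
  ext g
  simp only [lieAct, key, Pi.add_apply]
  ring

theorem lieAct_smul (X : sp4 ℂ) (c : ℂ) {B : GSp4 → ℂ} (hB : IsSmooth B) :
    lieAct X (c • B) = c • lieAct X B := by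
  have key : ∀ (Y : sp4 ℝ) (g : GSp4), lieDeriv Y (c • B) g = c * lieDeriv Y B g :=
    fun Y g => deriv_const_mul c (hB.differentiableAt g Y)
  ext g
  simp only [lieAct, key, Pi.smul_apply, smul_eq_mul]
  ring

theorem lieAct_zero (X : sp4 ℂ) : lieAct X (0 : GSp4 → ℂ) = 0 := by
  ext g
  simp [lieAct, lieDeriv]

theorem one_le_gnorm (g : GSp4) : 1 ≤ gnorm g := by
  rw [gnorm, Real.one_le_sqrt]
  by_cases h1 : mu2 g ^ 2 ≤ 1
  · have hm : mu2 g ≠ 0 := by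
      intro h0
      have h := congrArg Matrix.det (mat_mem g)
      have hd := Matrix.GeneralLinearGroup.det_ne_zero (g : GL (Fin 4) ℝ)
      have hJ : (J4 ℝ).det ≠ 0 := by
        have hJ2 := congrArg Matrix.det (J4_mul_J4 ℝ)
        intro hz
        rw [Matrix.det_mul, hz] at hJ2
        norm_num [Matrix.det_neg] at hJ2
      rw [h0, zero_smul, Matrix.det_mul, Matrix.det_mul, Matrix.det_transpose] at h
      simp [hd, hJ] at h
    have : 1 ≤ (mu2 g ^ 2)⁻¹ := (one_le_inv₀ (by positivity)).2 h1
    have h2 : 0 ≤ ∑ i, ∑ j, (mat g i j) ^ 2 := by positivity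
    linarith
  · have h2 : 0 ≤ (mu2 g ^ 2)⁻¹ := by positivity
    have h3 : mu2 g = mat g 0 0 * mat g 2 2 + mat g 1 0 * mat g 3 2
        - mat g 2 0 * mat g 0 2 - mat g 3 0 * mat g 1 2 := by
      simp [mu2, J4, Matrix.mul_apply, Fin.sum_univ_four]
      ring
    have h4 : 2 * |mu2 g| ≤ ∑ i, ∑ j, (mat g i j) ^ 2 := by
      simp only [Fin.sum_univ_four]
      rw [h3]
      rcases abs_cases (mat g 0 0 * mat g 2 2 + mat g 1 0 * mat g 3 2
        - mat g 2 0 * mat g 0 2 - mat g 3 0 * mat g 1 2) with ⟨h, -⟩ | ⟨h, -⟩ <;> rw [h]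
      · linarith [sq_nonneg (mat g 0 0 - mat g 2 2), sq_nonneg (mat g 1 0 - mat g 3 2),
          sq_nonneg (mat g 2 0 + mat g 0 2), sq_nonneg (mat g 3 0 + mat g 1 2),
          sq_nonneg (mat g 0 1), sq_nonneg (mat g 0 3), sq_nonneg (mat g 1 1),
          sq_nonneg (mat g 1 3), sq_nonneg (mat g 2 1), sq_nonneg (mat g 2 3),
          sq_nonneg (mat g 3 1), sq_nonneg (mat g 3 3)]
      · linarith [sq_nonneg (mat g 0 0 + mat g 2 2), sq_nonneg (mat g 1 0 + mat g 3 2),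
          sq_nonneg (mat g 2 0 - mat g 0 2), sq_nonneg (mat g 3 0 - mat g 1 2),
          sq_nonneg (mat g 0 1), sq_nonneg (mat g 0 3), sq_nonneg (mat g 1 1),
          sq_nonneg (mat g 1 3), sq_nonneg (mat g 2 1), sq_nonneg (mat g 2 3),
          sq_nonneg (mat g 3 1), sq_nonneg (mat g 3 3)]
    have h5 : 1 < |mu2 g| := by
      by_contra hc
      exact h1 ((sq_le_one_iff_abs_le_one _).2 (not_lt.1 hc))
    linarith

theorem SlowlyIncreasing.add {B C : GSp4 → ℂ} (hB : SlowlyIncreasing B)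
    (hC : SlowlyIncreasing C) : SlowlyIncreasing (B + C) := by
  obtain ⟨a, b, ha, hb, h⟩ := hB
  obtain ⟨c, d, hc, hd, h'⟩ := hC
  refine ⟨a + c, max b d, by positivity, lt_max_of_lt_left hb, fun g => ?_⟩
  have h1 := one_le_gnorm g
  calc ‖(B + C) g‖ ≤ ‖B g‖ + ‖C g‖ := norm_add_le _ _
    _ ≤ a * gnorm g ^ b + c * gnorm g ^ d := add_le_add (h g) (h' g)
    _ ≤ a * gnorm g ^ max b d + c * gnorm g ^ max b d := by
        gcongr
        · exact le_max_left _ _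
        · exact le_max_right _ _
    _ = (a + c) * gnorm g ^ max b d := by ring

theorem SlowlyIncreasing.smul {B : GSp4 → ℂ} (c : ℂ) (hB : SlowlyIncreasing B) :
    SlowlyIncreasing (c • B) := by
  obtain ⟨a, b, ha, hb, h⟩ := hB
  refine ⟨(‖c‖ + 1) * a, b, by positivity, hb, fun g => ?_⟩
  have h1 := one_le_gnorm g
  have h2 := h g
  calc ‖(c • B) g‖ = ‖c‖ * ‖B g‖ := by simp
    _ ≤ (‖c‖ + 1) * (a * gnorm g ^ b) := by
        gcongr
        linarith
    _ = _ := by ring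

theorem KFinite.add {B C : GSp4 → ℂ} (hB : KFinite B) (hC : KFinite C) : KFinite (B + C) := by
  unfold KFinite at *
  refine Submodule.finiteDimensional_of_le (S₂ :=
    Submodule.span ℂ (Set.range fun k : K => fun g : GSp4 => B (g * (k : GSp4))) ⊔
    Submodule.span ℂ (Set.range fun k : K => fun g : GSp4 => C (g * (k : GSp4)))) ?_
  rw [Submodule.span_le]
  rintro _ ⟨k, rfl⟩
  exact Submodule.add_mem_sup (Submodule.subset_span ⟨k, rfl⟩) (Submodule.subset_span ⟨k, rfl⟩)

theorem KFinite.smul {B : GSp4 → ℂ} (c : ℂ) (hB : KFinite B) : KFinite (c • B) := by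
  unfold KFinite at *
  refine Submodule.finiteDimensional_of_le (S₂ :=
    Submodule.span ℂ (Set.range fun k : K => fun g : GSp4 => B (g * (k : GSp4)))) ?_
  rw [Submodule.span_le]
  rintro _ ⟨k, rfl⟩
  exact Submodule.smul_mem _ c (Submodule.subset_span ⟨k, rfl⟩)

theorem KFinite.zero : KFinite (0 : GSp4 → ℂ) := by
  have h : Submodule.span ℂ
      (Set.range fun k : K => fun g : GSp4 => (0 : GSp4 → ℂ) (g * (k : GSp4))) = ⊥ := by
    rw [Submodule.span_eq_bot]
    rintro _ ⟨k, rfl⟩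
    rfl
  unfold KFinite
  rw [h]
  infer_instance

/-- The complex vector space `𝒮(Λ,θ,l,l')`, where `Λ` is given by `(s, m)`. -/
def besselSpace (s : ℂ) (m l l' : ℤ) : Submodule ℂ (GSp4 → ℂ) where
  carrier := {B | InBesselSpace s m l l' B}
  zero_mem' :=
    { smooth := IsCn.zero
      kfinite := KFinite.zero
      equivariant := by simp
      growth := ⟨1, 1, one_pos, one_pos, fun g => by
        simpa using zero_le_one.trans (one_le_gnorm g)⟩
      weight := by simp [lieAct_zero]
      weight' := by simp [lieAct_zero]
      Nplus_eq := lieAct_zero _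
      Xminus_eq := lieAct_zero _
      P1minus_eq := lieAct_zero _
      P0minus_eq := lieAct_zero _ }
  add_mem' := by
    intro B C hB hC
    exact
    { smooth := IsCn.add hB.smooth hC.smooth
      kfinite := hB.kfinite.add hC.kfinite
      equivariant := fun t ht X hX g => by
        simp only [Pi.add_apply, hB.equivariant t ht X hX g, hC.equivariant t ht X hX g]
        ring
      growth := hB.growth.add hC.growth
      weight := by rw [lieAct_add _ hB.smooth hC.smooth, hB.weight, hC.weight, smul_add]
      weight' := by rw [lieAct_add _ hB.smooth hC.smooth, hB.weight', hC.weight', smul_add]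
      Nplus_eq := by rw [lieAct_add _ hB.smooth hC.smooth, hB.Nplus_eq, hC.Nplus_eq, add_zero]
      Xminus_eq := by
        rw [lieAct_add _ hB.smooth hC.smooth, hB.Xminus_eq, hC.Xminus_eq, add_zero]
      P1minus_eq := by
        rw [lieAct_add _ hB.smooth hC.smooth, hB.P1minus_eq, hC.P1minus_eq, add_zero]
      P0minus_eq := by
        rw [lieAct_add _ hB.smooth hC.smooth, hB.P0minus_eq, hC.P0minus_eq, add_zero] }
  smul_mem' := by
    intro c B hB
    exact
    { smooth := IsCn.smul c hB.smooth
      kfinite := hB.kfinite.smul c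
      equivariant := fun t ht X hX g => by
        simp only [Pi.smul_apply, hB.equivariant t ht X hX g, smul_eq_mul]
        ring
      growth := hB.growth.smul c
      weight := by rw [lieAct_smul _ _ hB.smooth, hB.weight, smul_comm]
      weight' := by rw [lieAct_smul _ _ hB.smooth, hB.weight', smul_comm]
      Nplus_eq := by rw [lieAct_smul _ _ hB.smooth, hB.Nplus_eq, smul_zero]
      Xminus_eq := by rw [lieAct_smul _ _ hB.smooth, hB.Xminus_eq, smul_zero]
      P1minus_eq := by rw [lieAct_smul _ _ hB.smooth, hB.P1minus_eq, smul_zero]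
      P0minus_eq := by rw [lieAct_smul _ _ hB.smooth, hB.P0minus_eq, smul_zero] }

/-! ### The elements `h(λ,ζ,φ₁,φ₂)` and the function `c₁` -/

/-- The element `r₁(φ)` of `K¹`. -/
def r1 (φ : ℝ) : GSp4 :=
  mkGSp !![Real.cos φ, Real.sin φ, 0, 0;
           -Real.sin φ, Real.cos φ, 0, 0;
           0, 0, Real.cos φ, Real.sin φ;
           0, 0, -Real.sin φ, Real.cos φ] 1 one_ne_zero (by
    have h := Real.sin_sq_add_cos_sq φ
    ext i j
    fin_cases i <;> fin_cases j <;>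
      simp [J4, Matrix.mul_apply, Fin.sum_univ_four] <;> linarith)

/-- The element `r₂(φ)` of `K¹`. -/
def r2 (φ : ℝ) : GSp4 :=
  mkGSp !![Real.cos φ, 0, 0, Real.sin φ;
           0, Real.cos φ, Real.sin φ, 0;
           0, -Real.sin φ, Real.cos φ, 0;
           -Real.sin φ, 0, 0, Real.cos φ] 1 one_ne_zero (by
    have h := Real.sin_sq_add_cos_sq φ
    ext i j
    fin_cases i <;> fin_cases j <;>
      simp [J4, Matrix.mul_apply, Fin.sum_univ_four] <;> linarith)

/-- The diagonal element `diag(λζ, λζ⁻¹, ζ⁻¹, ζ)`. -/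
def diagElt (lam zeta : ℝˣ) : GSp4 :=
  mkGSp !![(lam * zeta : ℝ), 0, 0, 0;
           0, lam * (zeta : ℝ)⁻¹, 0, 0;
           0, 0, (zeta : ℝ)⁻¹, 0;
           0, 0, 0, zeta] lam lam.ne_zero (by
    have h := zeta.ne_zero
    ext i j
    fin_cases i <;> fin_cases j <;>
      simp [J4, Matrix.mul_apply, Fin.sum_univ_four] <;> field_simp)

/-- The element `h(λ,ζ,φ₁,φ₂)`. -/
def hElt (lam zeta : ℝˣ) (φ₁ φ₂ : ℝ) : GSp4 := diagElt lam zeta * r1 φ₁ * r2 φ₂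

/-- `cos φ₁ cos φ₂ + i sin φ₁ sin φ₂`. -/
def uFun (φ₁ φ₂ : ℝ) : ℂ :=
  Real.cos φ₁ * Real.cos φ₂ + I * Real.sin φ₁ * Real.sin φ₂

/-- `cos φ₁ sin φ₂ + i sin φ₁ cos φ₂`. -/
def vFun (φ₁ φ₂ : ℝ) : ℂ :=
  Real.cos φ₁ * Real.sin φ₂ + I * Real.sin φ₁ * Real.cos φ₂

/-- `(ζ² - ζ⁻²)(cos 2φ₁ + i sin 2φ₁ sin 2φ₂) + (ζ² + ζ⁻²) cos 2φ₂`. -/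
def wFun (zeta φ₁ φ₂ : ℝ) : ℂ :=
  ((zeta ^ 2 - (zeta ^ 2)⁻¹ : ℝ) : ℂ) *
      (Real.cos (2 * φ₁) + I * Real.sin (2 * φ₁) * Real.sin (2 * φ₂)) +
    ((zeta ^ 2 + (zeta ^ 2)⁻¹ : ℝ) : ℂ) * Real.cos (2 * φ₂)

/-- The function `c₁(ζ,φ₁,φ₂)`.  It has two alternative expressions, which agree where all
factors are non-zero; for `l + l' + m` even and `|m| ≤ l - l'` all exponents of the one chosen
here are non-negative integers, so that it is defined everywhere. -/
def c1 (l l' m : ℤ) (zeta φ₁ φ₂ : ℝ) : ℂ :=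
  if 0 ≤ m then
    (zeta * uFun φ₁ φ₂ + (zeta : ℂ)⁻¹ * vFun φ₁ φ₂) ^ m *
      wFun zeta φ₁ φ₂ ^ ((l - l' - m) / 2)
  else
    (2 : ℂ) ^ (-m) * (zeta * uFun φ₁ φ₂ - (zeta : ℂ)⁻¹ * vFun φ₁ φ₂) ^ (-m) *
      wFun zeta φ₁ φ₂ ^ ((l - l' + m) / 2)

/-- The factor `λ^{(l+l'+s)/2} e^{-2πλ(ζ²+ζ⁻²)}`, for `λ > 0`. -/
def radial (s : ℂ) (l l' : ℤ) (lam zeta : ℝ) : ℂ :=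
  (lam : ℂ) ^ (((l : ℂ) + (l' : ℂ) + s) / 2) *
    (Real.exp (-2 * Real.pi * lam * (zeta ^ 2 + (zeta ^ 2)⁻¹)) : ℂ)

end Bessel

end

noncomputable section

namespace Bessel

open Complex (I normSq)
open scoped ComplexConjugate

/-! Write `N = Ai + B` and `J = Ci + D` for an element with blocks `A, B, C, D`, and `τ = N J⁻¹`.
The elements `X₋, P₁₋, P₀₋` span `𝔭⁻`, the annihilator of `V = (i, 1)ᵗ` in `𝔰𝔭(4,ℂ)`. A function
killed by `𝔭⁻` is therefore holomorphic in `τ`. Its derivative along a curve depends only on the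
velocity of `Q = g V` and on the multiplier (`InBesselSpace.hasDerivAt_curve`). In that formula `l,
l', s, θ` fix every term except one, an unknown operator multiplied by a single matrix entry `M 0
1`.

Uniqueness. Modulo `T`, `U` and a torus of `K`, every element is diagonal times an element of
`SU(2)` up to scaling (`exists_decomposition`). Along suitable curves in the diagonal torus the
unknown operator drops out, and a scalar linear equation reduces everything to `K`
(`InBesselSpace.apply_sec`). On `SU(2)` the function is a section of `O(l - l')` on the projective
line, holomorphic because `N₊` kills it. Rotations in `T` act on an affine coordinate by `z ↦
e^{2iδ} z`, so the section is a multiple of `z^p` with `2p = l - l' + m` (`entire_of_rotation`).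
Boundedness on `K` limits the degree: `0 ≤ p ≤ l - l'`. This is the parity condition together with
`|m| ≤ l - l'`. On the component with negative multiplier `e^{2πi tr τ}` grows exponentially, so
slow growth forces zero. Hence a function in the space is determined by its value at `1`
(`InBesselSpace.eq_zero`).

Existence. With `p + q = l - l'` and `p - q = m`, the function `μ^κ det(J)^{-l} (J₁₁ + iJ₀₁)^p (J₁₁
- iJ₀₁)^q e^{2πi tr τ}`, extended by zero to negative multiplier, satisfies all conditions
(`explicit_mem`). Its growth is controlled by `Im tr τ ≥ 2μ/|det J|`, so that the exponential
absorbs `det(J)^{-l}`. The formulas on `h(λ,ζ,φ₁,φ₂)` are evaluations of this function: `w` is twice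
the product of the two linear forms, and the expansion in `ζ` is the binomial theorem. -/

/-! ### Differentiation along curves -/

/-- Complex `4 × 4` matrices. -/
abbrev M4C : Type := Matrix (Fin 4) (Fin 4) ℂ

/-- The complexification of a real matrix. -/
abbrev cx (M : M4) : M4C := M.map Complex.ofRealHom

theorem hasDerivAt_matrix {f : ℝ → M4} {f' : M4} {t : ℝ}
    (h : ∀ i j, HasDerivAt (fun s => f s i j) (f' i j) t) : HasDerivAt f f' t := by
  have h1 : f = fun s => ∑ i, ∑ j, f s i j • (Matrix.single i j (1 : ℝ) : M4) := by
    funext s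
    conv_lhs => rw [Matrix.matrix_eq_sum_single (f s)]
    simp
  have h2 : f' = ∑ i, ∑ j, f' i j • (Matrix.single i j (1 : ℝ) : M4) := by
    conv_lhs => rw [Matrix.matrix_eq_sum_single f']
    simp
  rw [h1, h2]
  exact HasDerivAt.fun_sum fun i _ => HasDerivAt.fun_sum fun j _ => (h i j).smul_const _

/-- The matrix entry as a continuous linear map. -/
def entry (i j : Fin 4) : M4 →L[ℝ] ℝ :=
  LinearMap.toContinuousLinearMap
    { toFun := fun M => M i j, map_add' := fun _ _ => rfl, map_smul' := fun _ _ => rfl }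

theorem HasDerivAt.entry {f : ℝ → M4} {f' : M4} {t : ℝ} (h : HasDerivAt f f' t) (i j : Fin 4) :
    HasDerivAt (fun s => f s i j) (f' i j) t :=
  (Bessel.entry i j).hasFDerivAt.comp_hasDerivAt t h

/-- Since `B` is locally the restriction of a smooth function of matrices, one linear functional
computes the derivative along all curves through `g`. A velocity can then be cut into summands that
are evaluated separately. -/
theorem exists_differential {B : GSp4 → ℂ} (hB : IsSmooth B) (g : GSp4) :
    ∃ L : M4 →L[ℝ] ℂ, ∀ (γ : ℝ → GSp4) (t : ℝ) (Y : M4), γ t = g →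
      HasDerivAt (fun s => mat (γ s)) Y t → HasDerivAt (fun s => B (γ s)) (L Y) t := by
  obtain ⟨U, F, hU, hgU, hF, hBF⟩ := hB g
  refine ⟨fderiv ℝ F (mat g), ?_⟩
  rintro γ t Y rfl hγ
  have hFd : HasFDerivAt F (fderiv ℝ F (mat (γ t))) (mat (γ t)) :=
    ((hF.contDiffAt (hU.mem_nhds hgU)).differentiableAt (by simp)).hasFDerivAt
  refine (hFd.comp_hasDerivAt t hγ).congr_of_eventuallyEq ?_
  filter_upwards [hγ.continuousAt.preimage_mem_nhds (hU.mem_nhds hgU)] with s hs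
  exact hBF (γ s) hs

/-- The complex-linear extension of a real-linear functional. -/
def cplxL (L : M4 →L[ℝ] ℂ) : M4C →ₗ[ℂ] ℂ where
  toFun Y := L (Y.map Complex.re) + I * L (Y.map Complex.im)
  map_add' Y W := by
    have h1 : (Y + W).map Complex.re = Y.map Complex.re + W.map Complex.re := by ext; simp
    have h2 : (Y + W).map Complex.im = Y.map Complex.im + W.map Complex.im := by ext; simp
    rw [h1, h2, map_add, map_add]; ring
  map_smul' c Y := by
    have h1 : (c • Y).map Complex.re = c.re • Y.map Complex.re - c.im • Y.map Complex.im := by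
      ext; simp
    have h2 : (c • Y).map Complex.im = c.re • Y.map Complex.im + c.im • Y.map Complex.re := by
      ext; simp
    rw [h1, h2, map_add, map_sub, map_smul, map_smul, map_smul, map_smul]
    simp only [Complex.real_smul, smul_eq_mul, RingHom.id_apply]
    conv_rhs => rw [← Complex.re_add_im c]
    linear_combination (-(c.im : ℂ) * L (Y.map Complex.im)) * Complex.I_sq

@[simp] theorem cplxL_cx (L : M4 →L[ℝ] ℂ) (Y : M4) : cplxL L (cx Y) = L Y := by
  have h1 : (cx Y).map Complex.re = Y := by ext; simp
  have h2 : (cx Y).map Complex.im = 0 := by ext; simp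
  simp [cplxL, h1, h2]

theorem hasDerivAt_mul_expSp (g : GSp4) (X : sp4 ℝ) :
    HasDerivAt (fun t : ℝ => mat (g * expSp (t • X))) (mat g * (X : M4)) 0 := by
  have h := (hasDerivAt_exp_smul_const (𝕂 := ℝ) (X : M4) (0 : ℝ)).const_mul (mat g)
  simp only [zero_smul, NormedSpace.exp_zero, one_mul] at h
  exact h

/-- Turns all conditions on Lie algebra elements into values of one complex-linear functional, so
that they can be combined linearly. -/
theorem lieAct_eq_cplxL {B : GSp4 → ℂ} {g : GSp4} {L : M4 →L[ℝ] ℂ}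
    (hL : ∀ (γ : ℝ → GSp4) (t : ℝ) (Y : M4), γ t = g →
      HasDerivAt (fun s => mat (γ s)) Y t → HasDerivAt (fun s => B (γ s)) (L Y) t)
    (X : sp4 ℂ) : lieAct X B g = cplxL L (cx (mat g) * (X : M4C)) := by
  have key : ∀ Y : sp4 ℝ, lieDeriv Y B g = L (mat g * (Y : M4)) := fun Y =>
    (hL _ 0 _ (by ext; simp [expSp, mkGSp]) (hasDerivAt_mul_expSp g Y)).deriv
  rw [lieAct, key, key]
  have h1 : (cx (mat g) * (X : M4C)).map Complex.re = mat g * (rePart X : M4) := by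
    ext i j; simp [rePart, Matrix.mul_apply]
  have h2 : (cx (mat g) * (X : M4C)).map Complex.im = mat g * (imPart X : M4) := by
    ext i j; simp [imPart, Matrix.mul_apply]
  simp [cplxL, h1, h2]

/-! ### The fundamental derivative formula -/

/-- The `4 × 2` matrix with blocks `i` and `1`. -/
def V : Matrix (Fin 4) (Fin 2) ℂ := !![I, 0; 0, I; 1, 0; 0, 1]

/-- For `M` with blocks `A, B, C, D`, the matrix with blocks `Ai + B` and `Ci + D`. -/
def Q (M : M4) : Matrix (Fin 4) (Fin 2) ℂ := cx M * V

/-- The upper block `Ai + B`. -/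
def Nm (M : M4) : Matrix (Fin 2) (Fin 2) ℂ := !![Q M 0 0, Q M 0 1; Q M 1 0, Q M 1 1]

/-- The automorphy factor `Ci + D`. -/
def Jm (M : M4) : Matrix (Fin 2) (Fin 2) ℂ := !![Q M 2 0, Q M 2 1; Q M 3 0, Q M 3 1]

/-- The `4 × 2` matrix with upper block `W` and lower block `0`. -/
def up (W : Matrix (Fin 2) (Fin 2) ℂ) : Matrix (Fin 4) (Fin 2) ℂ :=
  !![W 0 0, W 0 1; W 1 0, W 1 1; 0, 0; 0, 0]

/-- The `4 × 4` matrix with upper right block `W` and other blocks `0`. -/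
def upN {R : Type*} [CommRing R] (W : Matrix (Fin 2) (Fin 2) R) : Matrix (Fin 4) (Fin 4) R :=
  !![0, 0, W 0 0, W 0 1; 0, 0, W 1 0, W 1 1; 0, 0, 0, 0; 0, 0, 0, 0]

theorem upN_mul (W : Matrix (Fin 2) (Fin 2) ℂ) (M : M4) : upN W * Q M = up (W * Jm M) := by
  ext i j
  fin_cases i <;> fin_cases j <;>
    simp [upN, up, Jm, Matrix.mul_apply, Fin.sum_univ_four, Fin.sum_univ_two]

/-- The complexification of the embedding of `𝔲(2)`, the Lie algebra of `K`, in `𝔰𝔭(4)`. -/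
def iota (M : Matrix (Fin 2) (Fin 2) ℂ) : sp4 ℂ :=
  ⟨(1 / 2 : ℂ) • !![0, M 0 1 - M 1 0, 2 * I * M 0 0, I * (M 0 1 + M 1 0);
      M 1 0 - M 0 1, 0, I * (M 0 1 + M 1 0), 2 * I * M 1 1;
      -(2 * I * M 0 0), -(I * (M 0 1 + M 1 0)), 0, M 0 1 - M 1 0;
      -(I * (M 0 1 + M 1 0)), -(2 * I * M 1 1), M 1 0 - M 0 1, 0], by
  rw [mem_sp4]; ext i j
  fin_cases i <;> fin_cases j <;> simp [J4, Matrix.mul_apply, Fin.sum_univ_four] <;> ring⟩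

/-- The columns of `V` span an eigenspace of the symplectic matrix, which the Lie algebra of `K`
preserves. The normalisation of `iota` is the one for which the induced action is `M` itself. -/
theorem iota_mul_V (M : Matrix (Fin 2) (Fin 2) ℂ) : (iota M : M4C) * V = V * M := by
  ext i j
  fin_cases i <;> fin_cases j <;>
    simp [iota, V, Matrix.mul_apply, Fin.sum_univ_four, Fin.sum_univ_two] <;>
    ring_nf <;> simp [Complex.I_sq] <;> ring

/-- The two weights and `N₊` account for three entries of `M`. The entry `M 0 1` belongs to the
opposite root vector, about which the defining conditions say nothing. -/
theorem iota_eq (M : Matrix (Fin 2) (Fin 2) ℂ) :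
    iota M = (-M 0 0) • Z + (-M 1 1) • Z' + (-M 1 0) • Nplus +
      M 0 1 • iota (Matrix.single 0 1 1) := by
  ext i j
  fin_cases i <;> fin_cases j <;>
    simp [iota, Z, Z', Nplus, Matrix.single] <;> ring

/-- The annihilator of `V` is `𝔭⁻`. Its three basis vectors have the entry `1/2` at different places
of the upper left block, which is where the coefficients are read off. -/
theorem eq_of_mul_V_eq_zero (X : sp4 ℂ) (h : (X : M4C) * V = 0) :
    X = (2 * (X : M4C) 0 0) • Xminus + (2 * (X : M4C) 0 1) • P1minus +
      (2 * (X : M4C) 1 1) • P0minus := by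
  have hX := mem_sp4.mp X.2
  have e : ∀ i j, (X : M4C) i 0 * V 0 j + (X : M4C) i 1 * V 1 j + (X : M4C) i 2 * V 2 j +
      (X : M4C) i 3 * V 3 j = 0 := fun i j => by
    simpa [Matrix.mul_apply, Fin.sum_univ_four] using congrFun (congrFun h i) j
  have f : ∀ i j, ((X : M4C)ᵀ * J4 ℂ) i j = (J4 ℂ * (-(X : M4C))) i j :=
    fun i j => congrFun (congrFun hX i) j
  have e00 := e 0 0
  have e01 := e 0 1
  have e10 := e 1 0
  have e11 := e 1 1
  have e20 := e 2 0
  have e21 := e 2 1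
  have e30 := e 3 0
  have e31 := e 3 1
  have f02 := f 0 2
  have f03 := f 0 3
  have f12 := f 1 2
  have f13 := f 1 3
  have f01 := f 0 1
  have f23 := f 2 3
  simp [V] at e00 e01 e10 e11 e20 e21 e30 e31
  simp [J4, Matrix.mul_apply, Fin.sum_univ_four] at f02 f03 f12 f13 f01 f23
  have hI := Complex.I_sq
  ext i j
  fin_cases i <;> fin_cases j <;> simp [Xminus, P1minus, P0minus]
  all_goals grind

theorem mu2_ne_zero (g : GSp4) : mu2 g ≠ 0 := by
  intro h0
  have h := mat_mem g
  rw [h0, zero_smul] at h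
  have hd := Matrix.GeneralLinearGroup.det_ne_zero (g : GL (Fin 4) ℝ)
  have hJ : (J4 ℝ).det ≠ 0 := by
    have hJ2 := congrArg Matrix.det (J4_mul_J4 ℝ)
    intro hz
    rw [Matrix.det_mul, hz] at hJ2
    norm_num [Matrix.det_neg] at hJ2
  have h' := congrArg Matrix.det h
  rw [Matrix.det_mul, Matrix.det_mul, Matrix.det_transpose] at h'
  simp [hd, hJ] at h'

theorem J4_map : (J4 ℝ).map Complex.ofRealHom = J4 ℂ := by
  ext i j; fin_cases i <;> fin_cases j <;> simp [J4]

theorem mat_mul_inv (g : GSp4) : mat g * mat g⁻¹ = 1 := by simp [mat]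

theorem mat_inv_mul (g : GSp4) : mat g⁻¹ * mat g = 1 := by simp [mat]

theorem mat_mul (g h : GSp4) : mat (g * h) = mat g * mat h := rfl

theorem cx_mul (M N : M4) : cx (M * N) = cx M * cx N := Matrix.map_mul

theorem cx_mul_inv (g : GSp4) : cx (mat g) * cx (mat g⁻¹) = 1 := by
  rw [← cx_mul, mat_mul_inv]; simp [cx]

theorem cx_inv_mul (g : GSp4) : cx (mat g⁻¹) * cx (mat g) = 1 := by
  rw [← cx_mul, mat_inv_mul]; simp [cx]

theorem ext_mat {g h : GSp4} (e : mat g = mat h) : g = h :=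
  Subtype.ext (Units.ext e)

theorem mu2_mkGSp (M : M4) (μ : ℝ) (hμ : μ ≠ 0) (h : Mᵀ * J4 ℝ * M = μ • J4 ℝ) :
    mu2 (mkGSp M μ hμ h) = μ := by
  rw [mu2, mat_mkGSp, h]; simp [J4]

theorem mu2_mul (g h : GSp4) : mu2 (g * h) = mu2 g * mu2 h := by
  have e : (mat (g * h))ᵀ * J4 ℝ * mat (g * h) = (mu2 g * mu2 h) • J4 ℝ := by
    calc _ = (mat h)ᵀ * ((mat g)ᵀ * J4 ℝ * mat g) * mat h := by
          rw [mat_mul, Matrix.transpose_mul]; simp only [Matrix.mul_assoc]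
      _ = _ := by rw [mat_mem, Matrix.mul_smul, Matrix.smul_mul, mat_mem, smul_smul]
  rw [mu2, e]; simp [J4]

/-- Conjugation by elements of the group preserves the Lie algebra. -/
theorem conj_mem_sp4 (g : GSp4) {X : M4C} (hX : X ∈ sp4 ℂ) :
    cx (mat g⁻¹) * X * cx (mat g) ∈ sp4 ℂ := by
  rw [mem_sp4] at hX ⊢
  have h1 : (cx (mat g))ᵀ * J4 ℂ * cx (mat g) = (mu2 g : ℂ) • J4 ℂ := by
    have := congrArg (fun M : M4 => M.map Complex.ofRealHom) (mat_mem g)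
    simp only [Matrix.map_mul, J4_map] at this
    rw [show (cx (mat g))ᵀ = (mat g)ᵀ.map Complex.ofRealHom from rfl, this]
    ext i j
    fin_cases i <;> fin_cases j <;> simp [J4]
  have hμ : (mu2 g : ℂ) ≠ 0 := by exact_mod_cast mu2_ne_zero g
  have h2 : (mu2 g : ℂ) • (J4 ℂ * cx (mat g⁻¹)) = (cx (mat g))ᵀ * J4 ℂ := by
    rw [← Matrix.smul_mul, ← h1, Matrix.mul_assoc, cx_mul_inv, Matrix.mul_one]
  have h3 : (mu2 g : ℂ) • ((cx (mat g⁻¹))ᵀ * J4 ℂ) = J4 ℂ * cx (mat g) := by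
    rw [← Matrix.mul_smul, ← h1, ← Matrix.mul_assoc, ← Matrix.mul_assoc, ← Matrix.transpose_mul,
      cx_mul_inv]
    simp
  have h4 := smul_right_injective M4C hμ
  apply h4
  simp only [Matrix.transpose_mul]
  calc (mu2 g : ℂ) • ((cx (mat g))ᵀ * (Xᵀ * (cx (mat g⁻¹))ᵀ) * J4 ℂ)
      = (cx (mat g))ᵀ * Xᵀ * ((mu2 g : ℂ) • ((cx (mat g⁻¹))ᵀ * J4 ℂ)) := by
        rw [Matrix.mul_smul]; simp only [Matrix.mul_assoc]
    _ = (cx (mat g))ᵀ * (Xᵀ * J4 ℂ) * cx (mat g) := by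
        rw [h3]; simp only [Matrix.mul_assoc]
    _ = -(((cx (mat g))ᵀ * J4 ℂ) * X * cx (mat g)) := by
        rw [hX]; simp [Matrix.mul_assoc]
    _ = (mu2 g : ℂ) • (J4 ℂ * -(cx (mat g⁻¹) * X * cx (mat g))) := by
        rw [← h2]; simp [Matrix.mul_assoc]

theorem upN_mem_sp4 {R : Type*} [CommRing R] {W : Matrix (Fin 2) (Fin 2) R} (hW : W.IsSymm) :
    upN W ∈ sp4 R := by
  have h01 : W 1 0 = W 0 1 := hW.apply 0 1
  rw [mem_sp4]; ext i j
  fin_cases i <;> fin_cases j <;> simp [J4, Matrix.mul_apply, Fin.sum_univ_four, upN, h01]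

theorem cx_mem_sp4 {X : M4} (hX : X ∈ sp4 ℝ) : cx X ∈ sp4 ℂ := by
  rw [mem_sp4] at hX ⊢
  have := congrArg (fun M : M4 => M.map Complex.ofRealHom) hX
  simp only [Matrix.map_mul, J4_map] at this
  rw [show (cx X)ᵀ = Xᵀ.map Complex.ofRealHom from rfl, this]
  congr 1
  ext i j; simp

/-! #### The action of the centre and of the unipotent radical -/

/-- The scalar matrix `γ` in `GL(2,ℝ)`. -/
def scal (γ : ℝˣ) : GL (Fin 2) ℝ := Units.map (Matrix.scalar (Fin 2)).toMonoidHom γ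

theorem coe_scal (γ : ℝˣ) : ((scal γ : GL (Fin 2) ℝ) : Matrix (Fin 2) (Fin 2) ℝ) = (γ : ℝ) • 1 := by
  ext i j
  fin_cases i <;> fin_cases j <;> simp [scal]

theorem scal_mem (γ : ℝˣ) : scal γ ∈ T := by
  change _ = _
  rw [coe_scal]
  simp [S, smul_smul, sq]

theorem levi_scal (γ : ℝˣ) : mat (levi (scal γ)) = (γ : ℝ) • 1 := by
  have h : (γ : ℝ) ≠ 0 := γ.ne_zero
  rw [levi, mat_mkGSp, coe_scal]
  have : ((γ : ℝ) • (1 : Matrix (Fin 2) (Fin 2) ℝ))⁻¹ = (γ : ℝ)⁻¹ • 1 := by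
    apply Matrix.inv_eq_right_inv
    simp [smul_smul, h]
  rw [this]
  ext i j
  fin_cases i <;> fin_cases j <;> simp [blk, sq, h]

theorem unip_zero (h : (0 : Matrix (Fin 2) (Fin 2) ℝ).IsSymm) : unip 0 h = 1 := by
  apply ext_mat
  rw [unip, mat_mkGSp]
  ext i j
  fin_cases i <;> fin_cases j <;> simp [blk, mat]

theorem levi_one : levi 1 = 1 := by
  apply ext_mat
  rw [levi, mat_mkGSp]
  ext i j
  fin_cases i <;> fin_cases j <;> simp [blk, mat]

theorem theta_zero : theta 0 = 1 := by simp [theta]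

theorem Lam_one (s : ℂ) (m : ℤ) : Lam s m 1 = 1 := by simp [Lam, toC]

section
variable {s : ℂ} {m l l' : ℤ} {B : GSp4 → ℂ}

theorem InBesselSpace.apply_levi (hB : InBesselSpace s m l l' B) (t : GL (Fin 2) ℝ) (ht : t ∈ T)
    (g : GSp4) : B (levi t * g) = Lam s m t * B g := by
  have := hB.equivariant t ht 0 (by simp) g
  rwa [unip_zero, mul_one, theta_zero, mul_one] at this

theorem InBesselSpace.apply_unip (hB : InBesselSpace s m l l' B) (X : Matrix (Fin 2) (Fin 2) ℝ)
    (hX : X.IsSymm) (g : GSp4) : B (unip X hX * g) = theta X * B g := by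
  have := hB.equivariant 1 T.one_mem X hX g
  rwa [levi_one, one_mul, Lam_one, one_mul] at this

theorem InBesselSpace.apply_scal (hB : InBesselSpace s m l l' B) (γ : ℝˣ) (hγ : 0 < (γ : ℝ))
    (g : GSp4) : B (levi (scal γ) * g) = ((γ : ℝ) : ℂ) ^ s * B g := by
  rw [hB.apply_levi _ (scal_mem γ), Lam_apply s m _ γ 0 hγ]
  · simp
  · rw [coe_scal]; ext i j; fin_cases i <;> fin_cases j <;> simp

end

/-! ### Tangent vectors of the group and the derivative of a Bessel function along a curve. -/

theorem HasDerivAt.matrix_mul {f h : ℝ → M4} {f' h' : M4} {t : ℝ} (hf : HasDerivAt f f' t)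
    (hh : HasDerivAt h h' t) : HasDerivAt (fun s => f s * h s) (f' * h t + f t * h') t :=
  HasDerivAt.mul hf hh

theorem HasDerivAt.matrix_transpose {f : ℝ → M4} {f' : M4} {t : ℝ} (hf : HasDerivAt f f' t) :
    HasDerivAt (fun s => (f s)ᵀ) f'ᵀ t :=
  hasDerivAt_matrix fun i j => HasDerivAt.entry hf j i

/-- The velocity of a curve in the group lies in the Lie algebra of the group. -/
theorem exists_velocity {γ : ℝ → GSp4} {t : ℝ} {Y : M4} {μ' : ℝ}
    (hγ : HasDerivAt (fun s => mat (γ s)) Y t) (hμ : HasDerivAt (fun s => mu2 (γ s)) μ' t) :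
    ∃ X : sp4 ℝ, Y = mat (γ t) * ((X : M4) + (μ' / (2 * mu2 (γ t))) • (1 : M4)) := by
  set g := γ t with hg
  -- The multiplier is quadratic in the matrix, so the scalar part of the velocity is half its
  -- logarithmic derivative. What remains is infinitesimally symplectic.
  set c := μ' / (2 * mu2 g) with hc
  have h0 := mu2_ne_zero g
  have h1 : Yᵀ * J4 ℝ * mat g + (mat g)ᵀ * J4 ℝ * Y = μ' • J4 ℝ := by
    have ha := HasDerivAt.matrix_mul (HasDerivAt.matrix_mul
      (HasDerivAt.matrix_transpose hγ) (hasDerivAt_const t (J4 ℝ))) hγ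
    have hb : HasDerivAt (fun s => mu2 (γ s) • J4 ℝ) (μ' • J4 ℝ) t := hμ.smul_const _
    have hab : (fun s => (mat (γ s))ᵀ * J4 ℝ * mat (γ s)) = fun s => mu2 (γ s) • J4 ℝ :=
      funext fun s => mat_mem (γ s)
    rw [hab] at ha
    have := ha.unique hb
    simpa using this
  set X : M4 := mat g⁻¹ * Y - c • (1 : M4) with hX
  have hYX : Y = mat g * (X + c • (1 : M4)) := by
    rw [hX, sub_add_cancel, ← Matrix.mul_assoc, mat_mul_inv, Matrix.one_mul]
  have h2 : mu2 g • (Xᵀ * J4 ℝ + J4 ℝ * X) = 0 := by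
    have e1 : Yᵀ * J4 ℝ * mat g = mu2 g • (Xᵀ * J4 ℝ) + (c * mu2 g) • J4 ℝ := by
      rw [hYX, Matrix.transpose_mul, Matrix.mul_assoc, Matrix.mul_assoc, ← Matrix.mul_assoc _ _
        (mat g), mat_mem]
      simp [Matrix.add_mul, smul_smul]
      rw [mul_comm (mu2 g) c]
    have e2 : (mat g)ᵀ * J4 ℝ * Y = mu2 g • (J4 ℝ * X) + (c * mu2 g) • J4 ℝ := by
      rw [hYX, ← Matrix.mul_assoc, mat_mem]
      simp [Matrix.mul_add, smul_smul, mul_comm]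
    rw [e1, e2] at h1
    have e3 : c * mu2 g + c * mu2 g = μ' := by rw [hc]; field_simp; ring
    have e4 : mu2 g • (Xᵀ * J4 ℝ + J4 ℝ * X) + μ' • J4 ℝ = 0 + μ' • J4 ℝ := by
      rw [zero_add]
      conv_rhs => rw [← h1]
      rw [← e3, add_smul, smul_add]
      abel
    exact add_right_cancel e4
  have hX' : X ∈ sp4 ℝ := by
    rw [mem_sp4, Matrix.mul_neg]
    exact eq_neg_of_add_eq_zero_left ((smul_eq_zero.1 h2).resolve_left h0)
  exact ⟨⟨X, hX'⟩, hYX⟩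

theorem hasDerivAt_matrix_lin {A C : M4} : HasDerivAt (fun t : ℝ => A + t • C) C 0 := by
  refine hasDerivAt_matrix fun i j => ?_
  simpa using ((hasDerivAt_id (0 : ℝ)).mul_const (C i j)).const_add (A i j)

section
variable {s : ℂ} {m l l' : ℤ} {B : GSp4 → ℂ} {g : GSp4} {L : M4 →L[ℝ] ℂ}

/-- The infinitesimal central character: `mat g` is the velocity of multiplication by the scalars
`e^t`, on which `Λ` is `e^{st}`. -/
theorem differential_self (hB : InBesselSpace s m l l' B)
    (hL : ∀ (γ : ℝ → GSp4) (t : ℝ) (Y : M4), γ t = g →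
      HasDerivAt (fun s => mat (γ s)) Y t → HasDerivAt (fun s => B (γ s)) (L Y) t) :
    L (mat g) = s * B g := by
  let u : ℝ → ℝˣ := fun t => Units.mk0 (Real.exp t) (Real.exp_pos t).ne'
  have hmat : ∀ t, mat (levi (scal (u t)) * g) = Real.exp t • mat g := fun t => by
    rw [mat_mul, levi_scal]; simp [u]
  have h1 : HasDerivAt (fun t => mat (levi (scal (u t)) * g)) (mat g) 0 := by
    simp only [hmat]
    refine hasDerivAt_matrix fun i j => ?_
    simpa using (Real.hasDerivAt_exp 0).mul_const (mat g i j)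
  have h2 := hL _ 0 _ (by apply ext_mat; rw [hmat]; simp) h1
  have h3 : ∀ t : ℝ, B (levi (scal (u t)) * g) = Complex.exp (s * t) * B g := fun t => by
    rw [hB.apply_scal _ (Real.exp_pos t)]
    congr 1
    simp only [u, Units.val_mk0]
    rw [Complex.cpow_def_of_ne_zero (by exact_mod_cast (Real.exp_pos t).ne'),
      ← Complex.ofReal_log (Real.exp_pos t).le, Real.log_exp, mul_comm]
  simp only [h3] at h2
  have h4 : HasDerivAt (fun t : ℝ => Complex.exp (s * t) * B g) (s * B g) 0 := by
    have h5 : HasDerivAt (fun t : ℝ => s * (t : ℂ)) s 0 := by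
      simpa using (Complex.ofRealCLM.hasDerivAt (x := (0 : ℝ))).const_mul s
    simpa using h5.cexp.mul_const (B g)
  exact h2.unique h4

theorem differential_upN_real (hB : InBesselSpace s m l l' B)
    (hL : ∀ (γ : ℝ → GSp4) (t : ℝ) (Y : M4), γ t = g →
      HasDerivAt (fun s => mat (γ s)) Y t → HasDerivAt (fun s => B (γ s)) (L Y) t)
    {W : Matrix (Fin 2) (Fin 2) ℝ} (hW : W.IsSymm) :
    L (upN W * mat g) = 2 * Real.pi * I * (W.trace : ℝ) * B g := by
  have hs : ∀ t : ℝ, (t • W).IsSymm := fun t => hW.smul t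
  have hmat : ∀ t, mat (unip (t • W) (hs t) * g) = mat g + t • (upN W * mat g) := fun t => by
    have : mat (unip (t • W) (hs t)) = 1 + t • upN W := by
      rw [unip, mat_mkGSp]
      ext i j
      fin_cases i <;> fin_cases j <;> simp [blk, upN]
    rw [mat_mul, this, Matrix.add_mul, Matrix.one_mul, Matrix.smul_mul]
  have h1 : HasDerivAt (fun t => mat (unip (t • W) (hs t) * g)) (upN W * mat g) 0 := by
    simp only [hmat]
    exact hasDerivAt_matrix_lin
  have h2 := hL _ 0 _ (by apply ext_mat; rw [hmat]; simp) h1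
  have h3 : ∀ t : ℝ, B (unip (t • W) (hs t) * g) =
      Complex.exp (2 * Real.pi * I * (W.trace : ℝ) * t) * B g := fun t => by
    rw [hB.apply_unip, theta]
    congr 2
    simp [S]
    ring
  simp only [h3] at h2
  have h4 : HasDerivAt (fun t : ℝ => Complex.exp (2 * Real.pi * I * (W.trace : ℝ) * t) * B g)
      (2 * Real.pi * I * (W.trace : ℝ) * B g) 0 := by
    have h5 : HasDerivAt (fun t : ℝ => 2 * Real.pi * I * (W.trace : ℝ) * (t : ℂ))
        (2 * Real.pi * I * (W.trace : ℝ)) 0 := by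
      simpa using (Complex.ofRealCLM.hasDerivAt (x := (0 : ℝ))).const_mul
        (2 * Real.pi * I * (W.trace : ℝ))
    simpa using h5.cexp.mul_const (B g)
  exact h2.unique h4

/-- Both sides are linear in `W`, so the real case extends. Complex `W` is needed because the
variation of `τ` is a complex symmetric matrix. -/
theorem differential_upN (hB : InBesselSpace s m l l' B)
    (hL : ∀ (γ : ℝ → GSp4) (t : ℝ) (Y : M4), γ t = g →
      HasDerivAt (fun s => mat (γ s)) Y t → HasDerivAt (fun s => B (γ s)) (L Y) t)
    {W : Matrix (Fin 2) (Fin 2) ℂ} (hW : W.IsSymm) :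
    cplxL L (upN W * cx (mat g)) = 2 * Real.pi * I * W.trace * B g := by
  have h1 : (upN W * cx (mat g)).map Complex.re = upN (W.map Complex.re) * mat g := by
    ext i j
    simp only [Matrix.map_apply, Matrix.mul_apply, Fin.sum_univ_four]
    fin_cases i <;> simp [upN]
  have h2 : (upN W * cx (mat g)).map Complex.im = upN (W.map Complex.im) * mat g := by
    ext i j
    simp only [Matrix.map_apply, Matrix.mul_apply, Fin.sum_univ_four]
    fin_cases i <;> simp [upN]
  have hre : (W.map Complex.re).IsSymm := hW.map _
  have him : (W.map Complex.im).IsSymm := hW.map _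
  simp only [cplxL, LinearMap.coe_mk, AddHom.coe_mk, h1, h2, differential_upN_real hB hL hre,
    differential_upN_real hB hL him]
  have : W.trace = ((W.map Complex.re).trace : ℝ) + ((W.map Complex.im).trace : ℝ) * I := by
    simp only [Matrix.trace_fin_two, Matrix.map_apply]
    conv_lhs => rw [← Complex.re_add_im (W 0 0), ← Complex.re_add_im (W 1 1)]
    push_cast
    ring
  rw [this]
  ring

/-- The derivative of an element of `𝒮(Λ,θ,l,l')` along a curve `γ`, in terms of the derivative
of the matrix with blocks `Ai + B` and `Ci + D`. -/
theorem InBesselSpace.hasDerivAt_curve (hB : InBesselSpace s m l l' B) {γ : ℝ → GSp4} {t : ℝ}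
    {Y : M4} {μ' : ℝ} (hγ : HasDerivAt (fun s => mat (γ s)) Y t)
    (hμ : HasDerivAt (fun s => mu2 (γ s)) μ' t) {M X : Matrix (Fin 2) (Fin 2) ℂ}
    (hX : X.IsSymm) (hQ : Q Y = Q (mat (γ t)) * M + up (X * Jm (mat (γ t)))) :
    HasDerivAt (fun s => B (γ s))
      ((-l * M 0 0 - l' * M 1 1 + 2 * Real.pi * I * X.trace +
        (s + l + l') * (μ' / (2 * mu2 (γ t)) : ℝ)) * B (γ t) +
        M 0 1 * lieAct (iota (Matrix.single 0 1 1)) B (γ t)) t := by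
  obtain ⟨L, hL⟩ := exists_differential hB.smooth (γ t)
  obtain ⟨W, hW⟩ := exists_velocity hγ hμ
  set g := γ t with hg
  set c : ℝ := μ' / (2 * mu2 g) with hc
  convert hL γ t Y rfl hγ using 1
  have hL0 : ∀ X : sp4 ℂ, cplxL L (cx (mat g) * (X : M4C)) = lieAct X B g :=
    fun X => (lieAct_eq_cplxL hL X).symm
  -- the part annihilated by `𝔭⁻`
  let P : sp4 ℂ := ⟨cx (W : M4), cx_mem_sp4 W.2⟩ + iota ((c : ℂ) • 1 - M) -
    ⟨_, conj_mem_sp4 g (upN_mem_sp4 hX)⟩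
  have hP : (P : M4C) * V = 0 := by
    -- After multiplication by the invertible matrix `cx (mat g)`, the vanishing becomes the
    -- hypothesis `hQ`.
    have e1 : cx (mat g) * ((P : M4C) * V) = 0 := by
      have e2 : cx (mat g) * (P : M4C) = cx (mat g) * (cx (W : M4) + (c : ℂ) • 1) +
          cx (mat g) * (iota ((c : ℂ) • 1 - M) : M4C) - (c : ℂ) • cx (mat g)
          - upN X * cx (mat g) := by
        have : cx (mat g) * (cx (mat g⁻¹) * upN X * cx (mat g)) = upN X * cx (mat g) := by
          rw [← Matrix.mul_assoc, ← Matrix.mul_assoc, cx_mul_inv, Matrix.one_mul]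
        simp only [P, AddSubgroupClass.coe_sub, Submodule.coe_add, Matrix.mul_add,
          Matrix.mul_sub, this, Matrix.mul_smul, Matrix.mul_one]
        abel
      have e3 : cx (mat g) * (cx (W : M4) + (c : ℂ) • 1) = cx Y := by
        rw [hW, cx_mul]
        congr 1
        ext i j
        by_cases hij : i = j <;> simp [hij]
      rw [← Matrix.mul_assoc, e2, e3, Matrix.sub_mul, Matrix.sub_mul, Matrix.add_mul,
        Matrix.mul_assoc _ _ V, iota_mul_V, ← Matrix.mul_assoc, Matrix.mul_assoc (upN X),
        Matrix.smul_mul]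
      change Q Y + Q (mat g) * _ - (c : ℂ) • Q (mat g) - upN X * Q (mat g) = 0
      rw [upN_mul, hQ, Matrix.mul_sub, Matrix.mul_smul, Matrix.mul_one]
      abel
    calc (P : M4C) * V = cx (mat g⁻¹) * (cx (mat g) * ((P : M4C) * V)) := by
          rw [← Matrix.mul_assoc, cx_inv_mul, Matrix.one_mul]
      _ = 0 := by rw [e1, Matrix.mul_zero]
  have hLP : cplxL L (cx (mat g) * (P : M4C)) = 0 := by
    rw [eq_of_mul_V_eq_zero P hP]
    simp only [Submodule.coe_add, Submodule.coe_smul, Matrix.mul_add, Matrix.mul_smul, map_add,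
      map_smul, hL0, hB.Xminus_eq, hB.P1minus_eq, hB.P0minus_eq]
    simp
  have hY : cx Y = cx (mat g) * (P : M4C) - cx (mat g) * (iota ((c : ℂ) • 1 - M) : M4C) +
      upN X * cx (mat g) + (c : ℂ) • cx (mat g) := by
    have : cx (mat g) * (cx (mat g⁻¹) * upN X * cx (mat g)) = upN X * cx (mat g) := by
      rw [← Matrix.mul_assoc, ← Matrix.mul_assoc, cx_mul_inv, Matrix.one_mul]
    have e3 : cx Y = cx (mat g) * (cx (W : M4) + (c : ℂ) • 1) := by
      rw [hW, cx_mul]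
      congr 1
      ext i j
      by_cases hij : i = j <;> simp [hij]
    rw [e3]
    simp only [P, AddSubgroupClass.coe_sub, Submodule.coe_add, Matrix.mul_add,
      Matrix.mul_sub, this, Matrix.mul_smul, Matrix.mul_one]
    abel
  have hi : cplxL L (cx (mat g) * (iota ((c : ℂ) • 1 - M) : M4C)) =
      -(c - M 0 0) * l * B g - (c - M 1 1) * l' * B g -
        M 0 1 * lieAct (iota (Matrix.single 0 1 1)) B g := by
    rw [iota_eq]
    simp only [Submodule.coe_add, Submodule.coe_smul, Matrix.mul_add, Matrix.mul_smul, map_add,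
      map_smul, hL0, hB.weight, hB.weight', hB.Nplus_eq]
    simp
    ring
  rw [← cplxL_cx L Y, hY, map_add, map_add, map_sub, hLP, map_smul, cplxL_cx, hi,
    differential_self hB hL, differential_upN hB hL hX, smul_eq_mul]
  ring

end

/-! ### Linear differential equations and curves with diagonal `τ`. -/

theorem differentiableAt_matrix {E : Type*} [NormedAddCommGroup E] [NormedSpace ℝ E] {f : E → M4}
    {z : E} (h : ∀ i j, DifferentiableAt ℝ (fun s => f s i j) z) : DifferentiableAt ℝ f z := by
  have h1 : f = fun s => ∑ i, ∑ j, f s i j • (Matrix.single i j (1 : ℝ) : M4) := by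
    funext s
    conv_lhs => rw [Matrix.matrix_eq_sum_single (f s)]
    simp
  rw [h1]
  exact DifferentiableAt.fun_sum fun i _ => DifferentiableAt.fun_sum fun j _ =>
    (h i j).smul_const _

/-- The solution of a first order linear scalar differential equation. -/
theorem eq_exp_mul_of_hasDerivAt {f c C : ℝ → ℂ} (hf : ∀ t, HasDerivAt f (c t * f t) t)
    (hC : ∀ t, HasDerivAt C (c t) t) (t : ℝ) : f t = Complex.exp (C t - C 0) * f 0 := by
  have h1 : ∀ t, HasDerivAt (fun t => Complex.exp (-C t) * f t) 0 t := fun t => by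
    exact (((hC t).fun_neg.cexp).fun_mul (hf t)).congr_deriv (by ring)
  have h2 := is_const_of_deriv_eq_zero (fun t => (h1 t).differentiableAt)
    (fun t => (h1 t).deriv) t 0
  rw [sub_eq_add_neg, Complex.exp_add, mul_assoc, ← h2, ← mul_assoc, ← Complex.exp_add]
  simp

theorem Q_entry (M : M4) (i : Fin 4) :
    Q M i 0 = M i 2 + I * M i 0 ∧ Q M i 1 = M i 3 + I * M i 1 := by
  constructor <;> simp [Q, V, Matrix.mul_apply, Fin.sum_univ_four] <;> ring

theorem HasDerivAt.Q_entry {f : ℝ → M4} {f' : M4} {t : ℝ} (h : HasDerivAt f f' t) (i : Fin 4)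
    (j : Fin 2) : HasDerivAt (fun s => Q (f s) i j) (Q f' i j) t := by
  have e : ∀ k, HasDerivAt (fun s => ((f s i k : ℝ) : ℂ)) ((f' i k : ℝ) : ℂ) t :=
    fun k => (HasDerivAt.entry h i k).ofReal_comp
  fin_cases j
  · simp only [Fin.zero_eta, (Bessel.Q_entry _ i).1]
    exact (e 2).add ((e 0).const_mul I)
  · simp only [Fin.mk_one, (Bessel.Q_entry _ i).2]
    exact (e 3).add ((e 1).const_mul I)

section
variable {s : ℂ} {m l l' : ℤ} {B : GSp4 → ℂ}

/-- When `τ` stays diagonal along the curve, the condition on `Q` is the product rule for `N = τ J`.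
Only `J⁻¹ J'` and the derivatives of the diagonal entries of `τ` have to be supplied. -/
theorem InBesselSpace.hasDerivAt_diag (hB : InBesselSpace s m l l' B) {γ : ℝ → GSp4} {t : ℝ}
    {μ' : ℝ} (hγ : DifferentiableAt ℝ (fun s => mat (γ s)) t)
    (hμ : HasDerivAt (fun s => mu2 (γ s)) μ' t) {z₁ z₂ : ℝ → ℂ} {z₁' z₂' : ℂ}
    (hz : ∀ s, Nm (mat (γ s)) = !![z₁ s, 0; 0, z₂ s] * Jm (mat (γ s)))
    (hz₁ : HasDerivAt z₁ z₁' t) (hz₂ : HasDerivAt z₂ z₂' t) {M J' : Matrix (Fin 2) (Fin 2) ℂ}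
    (hJ : ∀ i j, HasDerivAt (fun s => Jm (mat (γ s)) i j) (J' i j) t)
    (hM : Jm (mat (γ t)) * M = J') :
    HasDerivAt (fun s => B (γ s))
      ((-l * M 0 0 - l' * M 1 1 + 2 * Real.pi * I * (z₁' + z₂') +
        (s + l + l') * (μ' / (2 * mu2 (γ t)) : ℝ)) * B (γ t) +
        M 0 1 * lieAct (iota (Matrix.single 0 1 1)) B (γ t)) t := by
  have hX : (!![z₁', 0; 0, z₂'] : Matrix (Fin 2) (Fin 2) ℂ).IsSymm := by
    ext i j; fin_cases i <;> fin_cases j <;> simp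
  have h := hB.hasDerivAt_curve hγ.hasDerivAt hμ (M := M) hX ?_
  · simpa [Matrix.trace_fin_two] using h
  have hQ := HasDerivAt.Q_entry hγ.hasDerivAt
  have n : ∀ s i j, Nm (mat (γ s)) i j = (!![z₁ s, 0; 0, z₂ s] * Jm (mat (γ s))) i j :=
    fun s i j => by rw [hz]
  have k : ∀ i j, (Jm (mat (γ t)) * M) i j = J' i j := fun i j => by rw [hM]
  have n00 := fun s => n s 0 0
  have n01 := fun s => n s 0 1
  have n10 := fun s => n s 1 0
  have n11 := fun s => n s 1 1
  have k00 := k 0 0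
  have k01 := k 0 1
  have k10 := k 1 0
  have k11 := k 1 1
  have j00 := hJ 0 0
  have j01 := hJ 0 1
  have j10 := hJ 1 0
  have j11 := hJ 1 1
  simp [Nm, Jm, Matrix.mul_apply, Fin.sum_univ_two] at n00 n01 n10 n11 k00 k01 k10 k11
  simp [Jm] at j00 j01 j10 j11
  have q00 := hQ 0 0
  have q01 := hQ 0 1
  have q10 := hQ 1 0
  have q11 := hQ 1 1
  simp only [n00, n01, n10, n11] at q00 q01 q10 q11
  ext i j
  fin_cases i <;> fin_cases j <;>
    simp [up, Matrix.mul_apply, Fin.sum_univ_two, Jm]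
  · rw [q00.unique (hz₁.mul j00), n00, n01, ← k00]; ring
  · rw [q01.unique (hz₁.mul j01), n00, n01, ← k01]; ring
  · rw [q10.unique (hz₂.mul j10), n10, n11, ← k10]; ring
  · rw [q11.unique (hz₂.mul j11), n10, n11, ← k11]; ring
  · rw [(hQ 2 0).unique j00, k00]
  · rw [(hQ 2 1).unique j01, k01]
  · rw [(hQ 3 0).unique j10, k10]
  · rw [(hQ 3 1).unique j11, k11]

end

/-! ### The torus of `K` -/

/-- The element of the torus of `K¹` with automorphy factor `diag(e^{-iφ₁}, e^{-iφ₂})`. -/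
def kz (φ₁ φ₂ : ℝ) : GSp4 :=
  mkGSp !![Real.cos φ₁, 0, Real.sin φ₁, 0; 0, Real.cos φ₂, 0, Real.sin φ₂;
    -Real.sin φ₁, 0, Real.cos φ₁, 0; 0, -Real.sin φ₂, 0, Real.cos φ₂] 1 one_ne_zero (by
    have h₁ := Real.sin_sq_add_cos_sq φ₁
    have h₂ := Real.sin_sq_add_cos_sq φ₂
    ext i j
    fin_cases i <;> fin_cases j <;>
      simp [J4, Matrix.mul_apply, Fin.sum_univ_four] <;> linarith)

/-- The weights are integrated along `t ↦ kz (tφ₁) (tφ₂)`. There `M` is diagonal, so neither `N₊`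
nor the unknown operator enters. -/
theorem InBesselSpace.apply_mul_kz {s : ℂ} {m l l' : ℤ} {B : GSp4 → ℂ}
    (hB : InBesselSpace s m l l' B) (g : GSp4) (φ₁ φ₂ : ℝ) :
    B (g * kz φ₁ φ₂) = Complex.exp (I * (l * φ₁ + l' * φ₂)) * B g := by
  have hd : ∀ t : ℝ, HasDerivAt (fun t : ℝ => B (g * kz (t * φ₁) (t * φ₂)))
      ((I * (l * φ₁ + l' * φ₂)) * B (g * kz (t * φ₁) (t * φ₂))) t := fun t => by
    have hs : ∀ φ : ℝ, HasDerivAt (fun t => Real.sin (t * φ)) (Real.cos (t * φ) * φ) t :=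
      fun φ => by simpa using ((hasDerivAt_id t).mul_const φ).sin
    have hc : ∀ φ : ℝ, HasDerivAt (fun t => Real.cos (t * φ)) (-Real.sin (t * φ) * φ) t :=
      fun φ => by simpa using ((hasDerivAt_id t).mul_const φ).cos
    set W : M4 := !![-Real.sin (t * φ₁) * φ₁, 0, Real.cos (t * φ₁) * φ₁, 0;
      0, -Real.sin (t * φ₂) * φ₂, 0, Real.cos (t * φ₂) * φ₂;
      -(Real.cos (t * φ₁) * φ₁), 0, -Real.sin (t * φ₁) * φ₁, 0;
      0, -(Real.cos (t * φ₂) * φ₂), 0, -Real.sin (t * φ₂) * φ₂] with hW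
    have h1 : HasDerivAt (fun t => mat (kz (t * φ₁) (t * φ₂))) W t := by
      refine hasDerivAt_matrix fun i j => ?_
      simp only [kz, mat_mkGSp, hW]
      fin_cases i <;> fin_cases j <;> simp only [Matrix.of_apply, Matrix.cons_val', Matrix.cons_val,
        Fin.zero_eta, Fin.mk_one, Fin.reduceFinMk] <;>
        first | exact hasDerivAt_const _ _ | exact hs _ | exact hc _ | exact (hs _).neg
    have h2 : HasDerivAt (fun t => mat (g * kz (t * φ₁) (t * φ₂))) (mat g * W) t := by
      have := HasDerivAt.matrix_mul (hasDerivAt_const t (mat g)) h1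
      rw [Matrix.zero_mul, zero_add] at this
      exact this
    have h3 : HasDerivAt (fun t => mu2 (g * kz (t * φ₁) (t * φ₂))) 0 t := by
      simp only [mu2_mul, kz, mu2_mkGSp]
      exact hasDerivAt_const _ _
    have h4 := hB.hasDerivAt_curve h2 h3 (M := !![-I * φ₁, 0; 0, -I * φ₂]) (X := 0) (by simp) (by
      have : cx W * V = cx (mat (kz (t * φ₁) (t * φ₂))) * V * !![-I * φ₁, 0; 0, -I * φ₂] := by
        ext i j
        fin_cases i <;> fin_cases j <;>
          simp [hW, V, kz, Matrix.mul_apply, Fin.sum_univ_four, Fin.sum_univ_two] <;>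
          ring_nf <;> simp [Complex.I_sq] <;> ring
      rw [Q, cx_mul, Matrix.mul_assoc, this, Q, mat_mul, cx_mul]
      simp only [Matrix.mul_assoc]
      ext i j
      fin_cases i <;> fin_cases j <;> simp [up])
    convert h4 using 1
    simp
    exact Or.inl (by ring)
  have hC : ∀ t : ℝ, HasDerivAt (fun t : ℝ => (I * (l * φ₁ + l' * φ₂)) * (t : ℂ))
      (I * (l * φ₁ + l' * φ₂)) t := fun t => by
    simpa using (Complex.ofRealCLM.hasDerivAt (x := t)).const_mul (I * (l * φ₁ + l' * φ₂))
  have := eq_exp_mul_of_hasDerivAt hd hC 1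
  have h1 : kz 0 0 = 1 := by
    apply ext_mat
    ext i j
    fin_cases i <;> fin_cases j <;> simp [kz, mat]
  simpa [h1] using this

/-! ### A section of the quotient by the Bessel subgroup -/

/-- The matrix `diag(ε e^a, ε e^b, e^{-a}, e^{-b}) k`, where `k` is the multiple of an element of
`K¹` with automorphy factor the matrix with rows `(ȳ, x)` and `(-x̄, y)`. -/
def secMat (ε a b : ℝ) (x y : ℂ) : M4 :=
  !![ε * Real.exp a * y.re, ε * Real.exp a * x.re, ε * Real.exp a * y.im, -(ε * Real.exp a * x.im);
    -(ε * Real.exp b * x.re), ε * Real.exp b * y.re, -(ε * Real.exp b * x.im),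
      -(ε * Real.exp b * y.im);
    -(Real.exp (-a) * y.im), Real.exp (-a) * x.im, Real.exp (-a) * y.re, Real.exp (-a) * x.re;
    Real.exp (-b) * x.im, Real.exp (-b) * y.im, -(Real.exp (-b) * x.re), Real.exp (-b) * y.re]

open Classical in
/-- The element of the group with matrix `secMat`. -/
def sec (ε : ℝˣ) (a b : ℝ) (x y : ℂ) : GSp4 :=
  if h : normSq x + normSq y ≠ 0 then
    mkGSp (secMat ε a b x y) (ε * (normSq x + normSq y)) (mul_ne_zero ε.ne_zero h) (by
      have ha : Real.exp a * Real.exp (-a) = 1 := by rw [← Real.exp_add]; simp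
      have hb : Real.exp b * Real.exp (-b) = 1 := by rw [← Real.exp_add]; simp
      simp only [Complex.normSq_apply, secMat]
      generalize Real.exp a = A at *
      generalize Real.exp (-a) = A' at *
      generalize Real.exp b = C at *
      generalize Real.exp (-b) = C' at *
      ext i j
      fin_cases i <;> fin_cases j <;>
        simp [J4, Matrix.mul_apply, Fin.sum_univ_four] <;> grind)
  -- A default value: for `x = y = 0` the matrix is singular.
  else 1

section
variable {ε : ℝˣ} {a b : ℝ} {x y : ℂ}

theorem mat_sec (h : normSq x + normSq y ≠ 0) : mat (sec ε a b x y) = secMat ε a b x y := by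
  rw [sec, dif_pos h, mat_mkGSp]

theorem mu2_sec (h : normSq x + normSq y ≠ 0) :
    mu2 (sec ε a b x y) = ε * (normSq x + normSq y) := by
  rw [sec, dif_pos h, mu2_mkGSp]

theorem Jm_secMat (ε a b : ℝ) (x y : ℂ) : Jm (secMat ε a b x y) =
    !![(Real.exp (-a) : ℂ) * conj y, (Real.exp (-a) : ℂ) * x;
      -((Real.exp (-b) : ℂ) * conj x), (Real.exp (-b) : ℂ) * y] := by
  ext i j
  fin_cases i <;> fin_cases j <;> simp [Jm, Q_entry, secMat] <;>
    apply Complex.ext <;> simp [-Complex.ofReal_exp, ← Complex.ofReal_neg]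

theorem Nm_secMat (ε a b : ℝ) (x y : ℂ) : Nm (secMat ε a b x y) =
    !![I * ε * (Real.exp (2 * a) : ℂ), 0; 0, I * ε * (Real.exp (2 * b) : ℂ)] *
      Jm (secMat ε a b x y) := by
  have e : ∀ c : ℝ, Real.exp (2 * c) * Real.exp (-c) = Real.exp c := fun c => by
    rw [← Real.exp_add]; congr 1; ring
  have ea := e a
  have eb := e b
  rw [Jm_secMat]
  ext i j
  fin_cases i <;> fin_cases j <;>
    simp only [Nm, Q_entry, secMat, Matrix.mul_apply, Fin.sum_univ_two, Matrix.of_apply,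
      Matrix.cons_val', Matrix.cons_val, Fin.zero_eta, Fin.mk_one] <;>
    first | rw [← ea] | rw [← eb]
  all_goals
    apply Complex.ext <;> simp [-Complex.ofReal_exp] <;> ring

theorem one_eq_sec : sec 1 0 0 0 1 = 1 := by
  apply ext_mat
  rw [mat_sec (by simp)]
  ext i j
  fin_cases i <;> fin_cases j <;> simp [secMat, mat]

/-- Transport along the diagonal torus. -/
theorem InBesselSpace.apply_sec {s : ℂ} {m l l' : ℤ} {B : GSp4 → ℂ}
    (hB : InBesselSpace s m l l' B) (ε : ℝˣ) (a b : ℝ) {x y : ℂ} (h : normSq x + normSq y ≠ 0) :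
    B (sec ε a b (Real.exp a * x) (Real.exp b * y)) =
      Complex.exp (-l * (Real.log (Real.exp (b - a) * normSq y + Real.exp (a - b) * normSq x) -
          Real.log (normSq y + normSq x))
        - 2 * Real.pi * ε * (Real.exp (2 * a) + Real.exp (2 * b) - 2) +
        (s + l + l') / 2 * (Real.log (Real.exp (2 * a) * normSq x + Real.exp (2 * b) * normSq y) -
          Real.log (normSq x + normSq y))) * B (sec ε 0 0 x y) := by
  have hx0 := Complex.normSq_nonneg x
  have hy0 := Complex.normSq_nonneg y
  have hpos : ∀ A C : ℝ, 0 < A → 0 < C → 0 < A * normSq x + C * normSq y := fun A C hA hC => by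
    rcases hx0.lt_or_eq with hx | hx
    · positivity
    · have : 0 < normSq y := lt_of_le_of_ne hy0 fun hy => h (by rw [← hx, ← hy, add_zero])
      positivity
  have hne : ∀ t, normSq ((Real.exp (t * a) : ℂ) * x) + normSq ((Real.exp (t * b) : ℂ) * y) ≠ 0 :=
    fun t => by
      have := hpos (Real.exp (t * a) * Real.exp (t * a)) (Real.exp (t * b) * Real.exp (t * b))
        (by positivity) (by positivity)
      rw [Complex.normSq_mul, Complex.normSq_mul, Complex.normSq_ofReal, Complex.normSq_ofReal]
      exact this.ne'
  have hex : ∀ c t : ℝ, HasDerivAt (fun t => Real.exp (t * c)) (c * Real.exp (t * c)) t :=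
    fun c t => by simpa [mul_comm] using ((hasDerivAt_id t).mul_const c).exp
  have hexC : ∀ c t : ℝ, HasDerivAt (fun t => ((Real.exp (t * c) : ℝ) : ℂ))
      (c * Real.exp (t * c)) t := fun c t => by exact_mod_cast (hex c t).ofReal_comp
  -- Scaling `x` and `y` by `e^{ta}` and `e^{tb}` keeps the second column of the automorphy factor
  -- equal to `(x, y)`. The second column of `M` therefore vanishes, the unknown operator drops out,
  -- and a scalar linear equation for `f` remains.
  let f : ℝ → ℂ := fun t =>
    B (sec ε (t * a) (t * b) ((Real.exp (t * a) : ℂ) * x) ((Real.exp (t * b) : ℂ) * y))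
  -- `D` is the determinant of the automorphy factor along the curve, and `W` below is the
  -- multiplier divided by `ε`.
  let D : ℝ → ℝ := fun t => Real.exp (t * (b - a)) * normSq y + Real.exp (t * (a - b)) * normSq x
  let D' : ℝ → ℝ := fun t => (b - a) * Real.exp (t * (b - a)) * normSq y +
    (a - b) * Real.exp (t * (a - b)) * normSq x
  let W : ℝ → ℝ := fun t => Real.exp (t * (2 * a)) * normSq x + Real.exp (t * (2 * b)) * normSq y
  let W' : ℝ → ℝ := fun t => 2 * a * Real.exp (t * (2 * a)) * normSq x +
    2 * b * Real.exp (t * (2 * b)) * normSq y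
  have hD : ∀ t, HasDerivAt D (D' t) t := fun t =>
    ((hex _ t).mul_const _).add ((hex _ t).mul_const _)
  have hW : ∀ t, HasDerivAt W (W' t) t := fun t =>
    ((hex _ t).mul_const _).add ((hex _ t).mul_const _)
  have hD0 : ∀ t, 0 < D t := fun t => by
    have := hpos (Real.exp (t * (a - b))) (Real.exp (t * (b - a))) (by positivity) (by positivity)
    simp only [D]; linarith
  have hW0 : ∀ t, 0 < W t := fun t =>
    hpos (Real.exp (t * (2 * a))) (Real.exp (t * (2 * b))) (by positivity) (by positivity)
  have hμW : ∀ t, mu2 (sec ε (t * a) (t * b) ((Real.exp (t * a) : ℂ) * x)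
      ((Real.exp (t * b) : ℂ) * y)) = ε * W t := fun t => by
    rw [mu2_sec (hne t), Complex.normSq_mul, Complex.normSq_mul, Complex.normSq_ofReal,
      Complex.normSq_ofReal, ← Real.exp_add, ← Real.exp_add]
    simp only [W]; ring_nf
  let c : ℝ → ℂ := fun t => -l * (D' t / D t : ℝ) -
    2 * Real.pi * ε * (2 * a * Real.exp (t * (2 * a)) + 2 * b * Real.exp (t * (2 * b))) +
    (s + l + l') / 2 * (W' t / W t : ℝ)
  let C : ℝ → ℂ := fun t => -l * (Real.log (D t) : ℝ) -
    2 * Real.pi * ε * (Real.exp (t * (2 * a)) + Real.exp (t * (2 * b))) +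
    (s + l + l') / 2 * (Real.log (W t) : ℝ)
  have hC : ∀ t, HasDerivAt C (c t) t := fun t => by
    refine ((((hD t).log (hD0 t).ne').ofReal_comp.const_mul _).sub
      (((hexC _ t).add (hexC _ t)).const_mul _ |>.congr_deriv ?_)).add
      (((hW t).log (hW0 t).ne').ofReal_comp.const_mul _)
    push_cast; ring
  have hf : ∀ t, HasDerivAt f (c t * f t) t := fun t => by
    have hJ : ∀ t, Jm (mat (sec ε (t * a) (t * b) ((Real.exp (t * a) : ℂ) * x)
        ((Real.exp (t * b) : ℂ) * y))) = !![(Real.exp (t * (b - a)) : ℂ) * conj y, x;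
          -((Real.exp (t * (a - b)) : ℂ) * conj x), y] := fun t => by
      have e1 : ∀ c : ℝ, (Real.exp (-(t * c)) : ℂ) * (Real.exp (t * c) : ℂ) = 1 := fun c => by
        rw [← Complex.ofReal_mul, ← Real.exp_add]; simp
      have e2 : (Real.exp (-(t * a)) : ℂ) * (Real.exp (t * b) : ℂ) = Real.exp (t * (b - a)) := by
        rw [← Complex.ofReal_mul, ← Real.exp_add]; ring_nf
      have e3 : (Real.exp (-(t * b)) : ℂ) * (Real.exp (t * a) : ℂ) = Real.exp (t * (a - b)) := by
        rw [← Complex.ofReal_mul, ← Real.exp_add]; ring_nf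
      rw [mat_sec (hne t), Jm_secMat, map_mul, map_mul, Complex.conj_ofReal, Complex.conj_ofReal,
        ← mul_assoc, ← mul_assoc, ← mul_assoc, ← mul_assoc, e1, e1, e2, e3, one_mul, one_mul]
    have hd : DifferentiableAt ℝ (fun t => mat (sec ε (t * a) (t * b) ((Real.exp (t * a) : ℂ) * x)
        ((Real.exp (t * b) : ℂ) * y))) t := by
      simp only [fun t => mat_sec (ε := ε) (a := t * a) (b := t * b) (hne t)]
      refine differentiableAt_matrix fun i j => ?_
      fin_cases i <;> fin_cases j <;>
        simp [secMat, -Complex.ofReal_exp] <;> fun_prop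
    have hμ : HasDerivAt (fun t => mu2 (sec ε (t * a) (t * b) ((Real.exp (t * a) : ℂ) * x)
        ((Real.exp (t * b) : ℂ) * y))) (ε * W' t) t := by
      simp only [hμW]
      exact (hW t).const_mul _
    have hDC : (Real.exp (t * (b - a)) : ℂ) * conj y * y +
        (Real.exp (t * (a - b)) : ℂ) * conj x * x = D t := by
      have h1 : conj y * y = (normSq y : ℂ) := by rw [mul_comm, Complex.mul_conj]
      have h2 : conj x * x = (normSq x : ℂ) := by rw [mul_comm, Complex.mul_conj]
      rw [mul_assoc, mul_assoc, h1, h2]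
      simp only [D]; push_cast; ring
    have hD'C : (b - a) * (Real.exp (t * (b - a)) : ℂ) * conj y * y +
        (a - b) * (Real.exp (t * (a - b)) : ℂ) * conj x * x = D' t := by
      have h1 : conj y * y = (normSq y : ℂ) := by rw [mul_comm, Complex.mul_conj]
      have h2 : conj x * x = (normSq x : ℂ) := by rw [mul_comm, Complex.mul_conj]
      rw [mul_assoc _ _ y, mul_assoc _ _ x, h1, h2]
      simp only [D']; push_cast; ring
    have hDn : (D t : ℂ) ≠ 0 := by exact_mod_cast (hD0 t).ne'
    have key := hB.hasDerivAt_diag hd hμ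
      (z₁ := fun t => I * ε * (Real.exp (t * (2 * a)) : ℂ))
      (z₂ := fun t => I * ε * (Real.exp (t * (2 * b)) : ℂ))
      (J' := !![(b - a) * (Real.exp (t * (b - a)) : ℂ) * conj y, 0;
          -((a - b) * (Real.exp (t * (a - b)) : ℂ) * conj x), 0])
      (M := !![(D' t / D t : ℂ), 0; ((Real.exp (t * (a - b)) : ℂ) * (Real.exp (t * (b - a)) : ℂ) *
        conj x * conj y * (2 * (b - a)) / D t), 0])
      (fun r => by
        rw [mat_sec (hne r), Nm_secMat]
        congr 4 <;> ring_nf)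
      ((hexC _ t).const_mul _) ((hexC _ t).const_mul _)
      (fun i j => by
        simp only [hJ]
        fin_cases i <;> fin_cases j <;> simp only [Matrix.of_apply, Matrix.cons_val',
          Matrix.cons_val, Fin.zero_eta, Fin.mk_one]
        · exact_mod_cast (hexC (b - a) t).mul_const (conj y)
        · exact hasDerivAt_const _ _
        · exact_mod_cast ((hexC (a - b) t).mul_const (conj x)).neg
        · exact hasDerivAt_const _ _)
      (by
        rw [hJ]
        ext i j
        fin_cases i <;> fin_cases j <;>
          simp only [Matrix.mul_apply, Fin.sum_univ_two, Matrix.of_apply, Matrix.cons_val',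
            Matrix.cons_val, Fin.zero_eta, Fin.mk_one, mul_zero, add_zero, ← hD'C] <;>
          field_simp <;> rw [← hDC] <;> ring)
    refine key.congr_deriv ?_
    rw [hμW, show B _ = f t from rfl]
    have hε : (ε : ℝ) ≠ 0 := ε.ne_zero
    have hWn := (hW0 t).ne'
    have e1 : (ε : ℝ) * W' t / (2 * (ε * W t)) = W' t / W t / 2 := by field_simp
    rw [e1]
    simp only [c, Matrix.of_apply, Matrix.cons_val', Matrix.cons_val]
    push_cast
    linear_combination (2 * Real.pi * ε * (2 * a * Complex.exp (t * (2 * a)) +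
      2 * b * Complex.exp (t * (2 * b))) * f t) * Complex.I_sq
  have := eq_exp_mul_of_hasDerivAt hf hC 1
  simp only [f, C, D, W, one_mul, zero_mul, Real.exp_zero, Complex.ofReal_one] at this
  rw [this]
  congr 2
  ring

end

/-! ### Entire functions with a rotational symmetry -/

/-- The Cauchy–Riemann equations in directional form: the real differential is complex-linear as
soon as the derivative in each direction `ζ` is `c * ζ`. -/
theorem hasDerivAt_complex_of_lines {f : ℂ → ℂ} {z c : ℂ} (hf : DifferentiableAt ℝ f z)
    (h : ∀ ζ : ℂ, HasDerivAt (fun r : ℝ => f (z + r * ζ)) (c * ζ) 0) : HasDerivAt f c z := by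
  have h1 : ∀ ζ, fderiv ℝ f z ζ = c * ζ := fun ζ => by
    have hl : HasDerivAt (fun r : ℝ => z + r * ζ) ζ 0 := by
      simpa using ((Complex.ofRealCLM.hasDerivAt (x := (0 : ℝ))).mul_const ζ).const_add z
    have hz : z + ((0 : ℝ) : ℂ) * ζ = z := by simp
    have h2 : HasDerivAt (fun r : ℝ => f (z + r * ζ)) (fderiv ℝ f z ζ) 0 := by
      have h3 : HasFDerivAt f (fderiv ℝ f z) (z + ((0 : ℝ) : ℂ) * ζ) := by
        rw [hz]; exact hf.hasFDerivAt
      exact h3.comp_hasDerivAt (0 : ℝ) hl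
    exact h2.unique (h ζ)
  have h2 := hasFDerivAt_of_restrictScalars ℝ hf.hasFDerivAt
    (f' := ContinuousLinearMap.toSpanSingleton ℂ c) (by
    apply ContinuousLinearMap.ext
    intro ζ
    simp [h1, mul_comm])
  simpa using h2.hasDerivAt

/-- For `k = 2p`, differentiating the symmetry at `δ = 0` gives Euler's equation `z h' = p h`, so `h
z^{-p}` is constant on the connected punctured plane. A negative `p` is excluded by continuity at
`0`, and for odd `k` the choice `δ = π` gives `h = -h`. -/
theorem entire_of_rotation {h : ℂ → ℂ} (hd : Differentiable ℂ h) {k : ℤ}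
    (hrot : ∀ (δ : ℝ) (z : ℂ), h (Complex.exp (2 * I * δ) * z) = Complex.exp (I * k * δ) * h z) :
    (h 1 = 0 → ∀ z, h z = 0) ∧
      (h 1 ≠ 0 → ∃ p : ℕ, k = 2 * p ∧ ∀ z, z ≠ 0 → h z = h 1 * z ^ p) := by
  have hc : Continuous h := hd.continuous
  have hcl : ∀ {f : ℂ → ℂ}, Continuous f → (∀ z, z ≠ 0 → f z = 0) → ∀ z, f z = 0 := by
    intro f hf h0 z
    have h1 : Set.EqOn f 0 {0}ᶜ := fun z hz => h0 z hz
    have h2 := Set.EqOn.of_subset_closure h1 hf.continuousOn continuousOn_const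
      (Set.subset_univ _) (by rw [(dense_compl_singleton (0 : ℂ)).closure_eq])
    exact h2 (Set.mem_univ z)
  rcases Int.even_or_odd' k with ⟨p, hp | hp⟩
  · have hder : ∀ z, z * deriv h z = p * h z := fun z => by
      have e1 : HasDerivAt (fun δ : ℝ => Complex.exp (2 * I * δ) * z) (2 * I * z) 0 := by
        have := ((Complex.ofRealCLM.hasDerivAt (x := (0 : ℝ))).const_mul (2 * I)).cexp.mul_const z
        simpa using this
      have e2 : HasDerivAt (fun δ : ℝ => Complex.exp (I * k * δ) * h z) (I * k * h z) 0 := by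
        have := ((Complex.ofRealCLM.hasDerivAt (x := (0 : ℝ))).const_mul
          (I * k)).cexp.mul_const (h z)
        simpa using this
      have e3 : HasDerivAt h (deriv h z) (Complex.exp (2 * I * (0 : ℝ)) * z) := by
        simpa using (hd z).hasDerivAt
      have e4 := e3.comp (0 : ℝ) e1
      have e5 := e4.unique (e2.congr_of_eventuallyEq (Filter.Eventually.of_forall
        fun δ => hrot δ z))
      rw [hp] at e5
      push_cast at e5
      have hI : (2 * I : ℂ) ≠ 0 := by simp
      apply mul_left_cancel₀ hI
      linear_combination e5
    have hconst : ∀ z, z ≠ 0 → h z * z ^ (-p) = h 1 := fun z hz => by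
      have h1 : ∀ w ∈ ({0}ᶜ : Set ℂ), HasDerivAt (fun w => h w * w ^ (-p)) 0 w := fun w hw => by
        have hw0 : w ≠ 0 := hw
        refine ((hd w).hasDerivAt.mul (hasDerivAt_zpow (-p) w (Or.inl hw0))).congr_deriv ?_
        rw [zpow_sub_one₀ hw0]
        have := hder w
        field_simp
        push_cast
        linear_combination w ^ (-p) * this
      have := (isOpen_compl_singleton (x := (0 : ℂ))).is_const_of_deriv_eq_zero
        (isConnected_compl_singleton_of_one_lt_rank (by simp) _).isPreconnected
        (fun w hw => (h1 w hw).differentiableAt.differentiableWithinAt)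
        (fun w hw => (h1 w hw).deriv) (show z ∈ ({0}ᶜ : Set ℂ) from hz)
        (show (1 : ℂ) ∈ ({0}ᶜ : Set ℂ) from one_ne_zero)
      simpa using this
    have hz : ∀ z, z ≠ 0 → h z = h 1 * z ^ p := fun z hz => by
      rw [← hconst z hz, mul_assoc, ← zpow_add₀ hz]; simp
    refine ⟨fun h1 => hcl hc fun z hz0 => by rw [hz z hz0, h1, zero_mul], fun h1 => ?_⟩
    have hp0 : 0 ≤ p := by
      by_contra hneg
      push Not at hneg
      obtain ⟨q, hq⟩ := Int.eq_ofNat_of_zero_le (show 0 ≤ -p by omega)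
      -- For `p = -q < 0` the function `h z^q` is constantly `h 1` off the origin, hence also at the
      -- origin, where it vanishes.
      have := hcl (f := fun z => h z * z ^ q - h 1) (by fun_prop) (fun z hz0 => by
        have := hconst z hz0
        rw [hq, zpow_natCast] at this
        rw [this, sub_self]) 0
      have hq0 : q ≠ 0 := by omega
      simp [hq0] at this
      exact h1 this
    obtain ⟨q, rfl⟩ := Int.eq_ofNat_of_zero_le hp0
    exact ⟨q, hp, fun z hz0 => by rw [hz z hz0, zpow_natCast]⟩
  · have h0 : ∀ z, h z = 0 := fun z => by
      have := hrot Real.pi z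
      have e1 : Complex.exp (2 * I * Real.pi) = 1 := by
        rw [show (2 * I * Real.pi : ℂ) = 2 * Real.pi * I by ring, Complex.exp_two_pi_mul_I]
      have e2 : Complex.exp (I * k * Real.pi) = -1 := by
        rw [hp, show (I * ((2 * p + 1 : ℤ) : ℂ) * Real.pi : ℂ) = p * (2 * Real.pi * I) +
          Real.pi * I by push_cast; ring, Complex.exp_add, Complex.exp_int_mul_two_pi_mul_I,
          Complex.exp_pi_mul_I, one_mul]
      rw [e1, e2, one_mul] at this
      have h2 : 2 * h z = 0 := by linear_combination this
      simpa using h2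
    exact ⟨fun _ => h0, fun h1 => absurd (h0 1) h1⟩

theorem degree_le_of_growth {K : ℝ} {c : ℂ} (hc : c ≠ 0) {p : ℕ} {n : ℝ}
    (h : ∀ r : ℝ, 1 ≤ r → ‖c‖ * r ^ p ≤ K * r ^ n) : (p : ℝ) ≤ n := by
  by_contra hlt
  push Not at hlt
  have h1 : Filter.Tendsto (fun r : ℝ => K * r ^ (n - p)) Filter.atTop (nhds (K * 0)) := by
    have := (tendsto_rpow_neg_atTop (show 0 < (p : ℝ) - n by linarith)).const_mul K
    simpa using this
  rw [mul_zero] at h1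
  have h2 : ‖c‖ ≤ 0 := ge_of_tendsto h1 (by
    filter_upwards [Filter.eventually_ge_atTop (1 : ℝ)] with r hr
    have hr0 : 0 < r := by linarith
    rw [Real.rpow_sub hr0, Real.rpow_natCast, ← mul_div_assoc, le_div_iff₀ (by positivity)]
    exact h r hr)
  exact hc (norm_le_zero_iff.1 h2)

/-! ### The restriction to `K` -/

theorem IsSmooth.differentiableAt_comp {B : GSp4 → ℂ} (hB : IsSmooth B) {E : Type*}
    [NormedAddCommGroup E] [NormedSpace ℝ E] {G : E → GSp4} {z : E}
    (hG : DifferentiableAt ℝ (fun z => mat (G z)) z) : DifferentiableAt ℝ (fun z => B (G z)) z := by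
  obtain ⟨U, F, hU, hgU, hF, hBF⟩ := hB (G z)
  have hFd : DifferentiableAt ℝ F (mat (G z)) :=
    (hF.contDiffAt (hU.mem_nhds hgU)).differentiableAt (by simp)
  refine (hFd.comp z hG).congr_of_eventuallyEq ?_
  filter_upwards [hG.continuousAt.preimage_mem_nhds (hU.mem_nhds hgU)] with w hw
  exact hBF (G w) hw

/-- The rotation with angle `δ`, as an element of `GL(2,ℝ)`. -/
def rot (δ : ℝ) : GL (Fin 2) ℝ :=
  Matrix.GeneralLinearGroup.mkOfDetNeZero !![Real.cos δ, Real.sin δ; -Real.sin δ, Real.cos δ] (by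
    have := Real.sin_sq_add_cos_sq δ
    rw [Matrix.det_fin_two_of]
    nlinarith)

theorem coe_rot (δ : ℝ) : (rot δ : Matrix (Fin 2) (Fin 2) ℝ) =
    !![Real.cos δ, Real.sin δ; -Real.sin δ, Real.cos δ] := rfl

theorem det_rot (δ : ℝ) : (rot δ : Matrix (Fin 2) (Fin 2) ℝ).det = 1 := by
  have := Real.sin_sq_add_cos_sq δ
  rw [coe_rot, Matrix.det_fin_two_of]
  linarith

theorem rot_mem (δ : ℝ) : rot δ ∈ T := by
  have := Real.sin_sq_add_cos_sq δ
  change _ = _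
  rw [det_rot, coe_rot]
  ext i j
  fin_cases i <;> fin_cases j <;> simp [S, Matrix.mul_apply] <;> linarith

theorem Lam_rot (s : ℂ) (m : ℤ) (δ : ℝ) : Lam s m (rot δ) = Complex.exp (I * m * δ) := by
  rw [Lam_apply s m _ 1 δ one_pos (by rw [coe_rot, one_smul])]
  simp

theorem mat_levi_rot (δ : ℝ) : mat (levi (rot δ)) =
    blk !![Real.cos δ, Real.sin δ; -Real.sin δ, Real.cos δ] 0 0
      !![Real.cos δ, Real.sin δ; -Real.sin δ, Real.cos δ] := by
  rw [levi, mat_mkGSp, det_rot, one_smul, Matrix.inv_def, det_rot, Ring.inverse_one, one_smul,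
    coe_rot, Matrix.adjugate_fin_two_of]
  congr 1
  ext i j
  fin_cases i <;> fin_cases j <;> simp

section
variable {ε : ℝˣ} {a b : ℝ} {x y : ℂ}

/-- With `a = b = 0` the rotation commutes with the diagonal factor and acts on the unitary part
alone, linearly in `(x, y)`. -/
theorem levi_rot_mul_sec (h : normSq x + normSq y ≠ 0) (δ : ℝ) :
    levi (rot δ) * sec ε 0 0 x y =
      sec ε 0 0 (Real.cos δ * x + Real.sin δ * y) (-Real.sin δ * x + Real.cos δ * y) := by
  have hsc := Real.sin_sq_add_cos_sq δ
  have h' : normSq ((Real.cos δ : ℂ) * x + Real.sin δ * y) +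
      normSq (-(Real.sin δ : ℂ) * x + Real.cos δ * y) = normSq x + normSq y := by
    simp only [Complex.normSq_apply]
    simp [-Complex.ofReal_sin, -Complex.ofReal_cos]
    linear_combination (x.re * x.re + x.im * x.im + (y.re * y.re + y.im * y.im)) * hsc
  apply ext_mat
  rw [mat_mul, mat_sec h, mat_sec (by rw [h']; exact h), mat_levi_rot]
  ext i j
  fin_cases i <;> fin_cases j <;>
    simp [-Complex.ofReal_sin, -Complex.ofReal_cos, secMat, blk, Matrix.mul_apply,
      Fin.sum_univ_four] <;> ring

/-- The automorphy factor of `kz φ (-φ)` has determinant one. Combined with `apply_mul_kz` this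
makes a Bessel function homogeneous of degree `l - l'` under phases of `(x, y)`. -/
theorem sec_mul_kz (h : normSq x + normSq y ≠ 0) (φ : ℝ) :
    sec ε a b x y * kz φ (-φ) =
      sec ε a b (Complex.exp (I * φ) * x) (Complex.exp (I * φ) * y) := by
  have he : Complex.exp (I * φ) = (Real.cos φ : ℂ) + (Real.sin φ : ℂ) * I := by
    rw [mul_comm, Complex.exp_mul_I]; push_cast; ring
  have h' : normSq (Complex.exp (I * φ) * x) + normSq (Complex.exp (I * φ) * y) =
      normSq x + normSq y := by
    rw [Complex.normSq_mul, Complex.normSq_mul, Complex.normSq_eq_norm_sq (Complex.exp _), mul_comm I,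
      Complex.norm_exp_ofReal_mul_I]
    ring
  apply ext_mat
  rw [mat_mul, mat_sec h, mat_sec (by rw [h']; exact h), he]
  ext i j
  fin_cases i <;> fin_cases j <;>
    simp [-Complex.ofReal_sin, -Complex.ofReal_cos, secMat, kz, Matrix.mul_apply,
      Fin.sum_univ_four] <;> ring

theorem scal_mul_sec (h : normSq x + normSq y ≠ 0) (γ : ℝˣ) :
    levi (scal γ) * sec ε a b x y = sec ε a b ((γ : ℝ) * x) ((γ : ℝ) * y) := by
  have h' : normSq (((γ : ℝ) : ℂ) * x) + normSq (((γ : ℝ) : ℂ) * y) =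
      (γ : ℝ) * γ * (normSq x + normSq y) := by
    rw [Complex.normSq_mul, Complex.normSq_mul, Complex.normSq_ofReal]
    ring
  apply ext_mat
  rw [mat_mul, mat_sec h, mat_sec (by
    rw [h']; exact mul_ne_zero (mul_ne_zero γ.ne_zero γ.ne_zero) h), levi_scal, Matrix.smul_mul,
    Matrix.one_mul]
  ext i j
  fin_cases i <;> fin_cases j <;> simp [secMat] <;> ring

end

section
variable {s : ℂ} {m l l' : ℤ} {B : GSp4 → ℂ}

theorem mul_conj_eq (z : ℂ) : z * conj z = (normSq z : ℂ) := Complex.mul_conj z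

/-- The restriction of a Bessel function to `K`, in an affine coordinate of the projective line. -/
def affine (B : GSp4 → ℂ) (s : ℂ) (n : ℤ) (ε : ℝˣ) (z : ℂ) : ℂ :=
  -- The coordinate is `z = (y + ix)/(y - ix)`, normalised by `y - ix = 1`; the forms `y ± ix` are
  -- eigenvectors of the rotations in `T`. The exponential changes the degree of homogeneity under
  -- positive reals from `s` to `n`.
  B (sec ε 0 0 (-I / 2 * (z - 1)) ((z + 1) / 2)) *
    Complex.exp ((n - s) / 2 * (Real.log (normSq (-I / 2 * (z - 1)) + normSq ((z + 1) / 2)) : ℝ))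

theorem normSq_affine (z : ℂ) :
    normSq (-I / 2 * (z - 1)) + normSq ((z + 1) / 2) = (normSq z + 1) / 2 := by
  simp only [Complex.normSq_mul, Complex.normSq_div, Complex.normSq_neg, Complex.normSq_I,
    Complex.normSq_ofNat]
  simp only [Complex.normSq_apply]
  simp
  ring

theorem normSq_affine_pos (z : ℂ) :
    0 < normSq (-I / 2 * (z - 1)) + normSq ((z + 1) / 2) := by
  rw [normSq_affine]
  have := Complex.normSq_nonneg z
  linarith

/-- The entry `M 0 0` of `J⁻¹ J'` is antilinear in the direction and `M 1 1` is its conjugate. The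
degree `l - l'` is the one for which the multiplier and norm terms cancel `M 0 0` and leave `(l -
l') M 1 1`. The other antilinear entry `M 1 0` is killed by `N₊`, and `M 0 1` is complex-linear. -/
theorem InBesselSpace.differentiable_affine (hB : InBesselSpace s m l l' B) (ε : ℝˣ) :
    Differentiable ℂ (affine B s (l - l') ε) := by
  intro z
  set x₀ := -I / 2 * (z - 1) with hx₀
  set y₀ := (z + 1) / 2 with hy₀
  set W := normSq x₀ + normSq y₀ with hW
  have hWpos : 0 < W := normSq_affine_pos z
  have hWc : (W : ℂ) = x₀ * conj x₀ + y₀ * conj y₀ := by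
    rw [hW, mul_conj_eq, mul_conj_eq]; push_cast; rfl
  have hWn : (W : ℂ) ≠ 0 := by exact_mod_cast hWpos.ne'
  set g := sec ε 0 0 x₀ y₀ with hg
  -- `P` and `τ` are the entries `M 1 1` and `M 0 1` per unit of direction.
  set P := (conj x₀ * (-I / 2) + conj y₀ / 2) / W with hP
  set τ := (y₀ * (-I / 2) - x₀ / 2) / W with hτ
  set E := Complex.exp (((l - l' : ℤ) - s) / 2 * (Real.log W : ℝ)) with hE
  have key := hasDerivAt_complex_of_lines (f := affine B s (l - l') ε) (z := z)
    (c := E * ((l - l') * P * B g + τ * lieAct (iota (Matrix.single 0 1 1)) B g)) ?_ ?_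
  · exact key.differentiableAt
  · unfold affine
    refine DifferentiableAt.mul ?_ ?_
    · refine hB.smooth.differentiableAt_comp ?_
      simp only [fun z => mat_sec (ε := ε) (a := 0) (b := 0) (normSq_affine_pos z).ne']
      refine differentiableAt_matrix fun i j => ?_
      have re' : ∀ f : ℂ → ℂ, DifferentiableAt ℝ f z → DifferentiableAt ℝ (fun z => (f z).re) z :=
        fun f hf => Complex.reCLM.differentiableAt.comp z hf
      have im' : ∀ f : ℂ → ℂ, DifferentiableAt ℝ f z → DifferentiableAt ℝ (fun z => (f z).im) z :=
        fun f hf => Complex.imCLM.differentiableAt.comp z hf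
      have hr : ∀ c d : ℂ, DifferentiableAt ℝ (fun z : ℂ => (c * (z - d)).re) z := fun c d =>
        re' (fun z => c * (z - d)) (by fun_prop)
      have hi : ∀ c d : ℂ, DifferentiableAt ℝ (fun z : ℂ => (c * (z - d)).im) z := fun c d =>
        im' (fun z => c * (z - d)) (by fun_prop)
      have hr' : DifferentiableAt ℝ (fun z : ℂ => ((z + 1) / 2).re) z :=
        re' (fun z => (z + 1) / 2) (by fun_prop)
      have hi' : DifferentiableAt ℝ (fun z : ℂ => ((z + 1) / 2).im) z :=
        im' (fun z => (z + 1) / 2) (by fun_prop)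
      fin_cases i <;> fin_cases j <;> simp only [secMat, Matrix.of_apply, Matrix.cons_val',
        Matrix.cons_val, Fin.zero_eta, Fin.mk_one, Fin.reduceFinMk] <;>
        first
        | exact (hr _ _).const_mul _ | exact (hi _ _).const_mul _ | exact hr'.const_mul _
        | exact hi'.const_mul _ | exact ((hr _ _).const_mul _).neg
        | exact ((hi _ _).const_mul _).neg | exact (hr'.const_mul _).neg
        | exact (hi'.const_mul _).neg
    · have h1 : DifferentiableAt ℝ (fun z : ℂ => Real.log ((normSq z + 1) / 2)) z := by
        have h2 : DifferentiableAt ℝ (fun z : ℂ => normSq z) z := by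
          simp only [Complex.normSq_apply]
          have hr : DifferentiableAt ℝ (fun z : ℂ => z.re) z := Complex.reCLM.differentiableAt
          have hi : DifferentiableAt ℝ (fun z : ℂ => z.im) z := Complex.imCLM.differentiableAt
          fun_prop
        refine DifferentiableAt.log (by fun_prop) ?_
        have := Complex.normSq_nonneg z
        positivity
      have h3 : DifferentiableAt ℝ (fun z : ℂ => ((Real.log ((normSq z + 1) / 2) : ℝ) : ℂ)) z :=
        Complex.ofRealCLM.differentiableAt.comp z h1
      simp only [normSq_affine]
      exact (h3.const_mul _).cexp
  · intro ζ
    set x₁ := -I / 2 * ζ with hx₁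
    set y₁ := ζ / 2 with hy₁
    have hx : ∀ r : ℝ, -I / 2 * (z + r * ζ - 1) = x₀ + r * x₁ := fun r => by
      rw [hx₀, hx₁]; ring
    have hy : ∀ r : ℝ, (z + r * ζ + 1) / 2 = y₀ + r * y₁ := fun r => by
      rw [hy₀, hy₁]; ring
    have hne : ∀ r : ℝ, normSq (x₀ + r * x₁) + normSq (y₀ + r * y₁) ≠ 0 := fun r => by
      rw [← hx, ← hy]; exact (normSq_affine_pos _).ne'
    set ρ : ℝ := 2 * (x₀.re * x₁.re + x₀.im * x₁.im + y₀.re * y₁.re + y₀.im * y₁.im) with hρ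
    have hρc : (ρ : ℂ) = (conj x₀ * x₁ + conj y₀ * y₁) + (x₀ * conj x₁ + y₀ * conj y₁) := by
      apply Complex.ext
      · simp [hρ]; ring
      · simp; ring
    have hn : HasDerivAt (fun r : ℝ => normSq (x₀ + r * x₁) + normSq (y₀ + r * y₁)) ρ 0 := by
      have : ∀ u v : ℂ, HasDerivAt (fun r : ℝ => normSq (u + r * v))
          (2 * (u.re * v.re + u.im * v.im)) 0 := fun u v => by
        have h1 : HasDerivAt (fun r : ℝ => u.re + r * v.re) v.re 0 := by
          simpa using ((hasDerivAt_id (0 : ℝ)).mul_const v.re).const_add u.re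
        have h2 : HasDerivAt (fun r : ℝ => u.im + r * v.im) v.im 0 := by
          simpa using ((hasDerivAt_id (0 : ℝ)).mul_const v.im).const_add u.im
        simp only [Complex.normSq_apply, Complex.add_re, Complex.add_im, Complex.re_ofReal_mul,
          Complex.im_ofReal_mul]
        refine ((h1.mul h1).add (h2.mul h2)).congr_deriv ?_
        simp
        ring
      refine ((this x₀ x₁).add (this y₀ y₁)).congr_deriv ?_
      rw [hρ]; ring
    have hW0 : normSq (x₀ + ((0 : ℝ) : ℂ) * x₁) + normSq (y₀ + ((0 : ℝ) : ℂ) * y₁) = W := by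
      simp [hW]
    have hlin : ∀ u v : ℂ, HasDerivAt (fun r : ℝ => u + r * v) v 0 := fun u v => by
      simpa using ((Complex.ofRealCLM.hasDerivAt (x := (0 : ℝ))).mul_const v).const_add u
    have hconj : ∀ u v : ℂ, HasDerivAt (fun r : ℝ => conj (u + r * v)) (conj v) 0 := fun u v => by
      have := hlin (conj u) (conj v)
      simpa using this
    have hJ : ∀ r : ℝ, Jm (mat (sec ε 0 0 (x₀ + r * x₁) (y₀ + r * y₁))) =
        !![conj (y₀ + r * y₁), x₀ + r * x₁; -conj (x₀ + r * x₁), y₀ + r * y₁] := fun r => by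
      rw [mat_sec (hne r), Jm_secMat]; simp
    have hd : DifferentiableAt ℝ (fun r : ℝ => mat (sec ε 0 0 (x₀ + r * x₁) (y₀ + r * y₁))) 0 := by
      simp only [fun r => mat_sec (ε := ε) (a := 0) (b := 0) (hne r)]
      refine differentiableAt_matrix fun i j => ?_
      fin_cases i <;> fin_cases j <;> simp [secMat]
    have hμ : HasDerivAt (fun r : ℝ => mu2 (sec ε 0 0 (x₀ + r * x₁) (y₀ + r * y₁))) (ε * ρ) 0 := by
      simp only [fun r => mu2_sec (ε := ε) (a := 0) (b := 0) (hne r)]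
      exact hn.const_mul _
    have k1 := hB.hasDerivAt_diag hd hμ (z₁ := fun _ => I * ε) (z₂ := fun _ => I * ε)
      (J' := !![conj y₁, x₁; -conj x₁, y₁])
      (M := !![(y₀ * conj y₁ + x₀ * conj x₁) / W, (y₀ * x₁ - x₀ * y₁) / W;
        (conj x₀ * conj y₁ - conj y₀ * conj x₁) / W, (conj x₀ * x₁ + conj y₀ * y₁) / W])
      (fun r => by rw [mat_sec (hne r), Nm_secMat]; simp)
      (hasDerivAt_const _ _) (hasDerivAt_const _ _)
      (fun i j => by
        simp only [hJ]
        fin_cases i <;> fin_cases j <;> simp only [Matrix.of_apply, Matrix.cons_val',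
          Matrix.cons_val, Fin.zero_eta, Fin.mk_one]
        · exact hconj _ _
        · exact hlin _ _
        · exact (hconj _ _).neg
        · exact hlin _ _)
      (by
        rw [hJ]
        ext i j
        fin_cases i <;> fin_cases j <;>
          simp only [Matrix.mul_apply, Fin.sum_univ_two, Matrix.of_apply, Matrix.cons_val',
            Matrix.cons_val, Fin.zero_eta, Fin.mk_one, Complex.ofReal_zero, zero_mul, add_zero] <;>
          field_simp <;> rw [hWc] <;> ring)
    have k2 : HasDerivAt (fun r : ℝ => Complex.exp (((l - l' : ℤ) - s) / 2 *
        (Real.log (normSq (x₀ + r * x₁) + normSq (y₀ + r * y₁)) : ℝ)))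
        (E * (((l - l' : ℤ) - s) / 2 * (ρ / W : ℝ))) 0 := by
      have := ((hn.log (hne 0)).ofReal_comp.const_mul (((l - l' : ℤ) - s) / 2)).cexp
      rw [hW0] at this
      exact this
    have k3 := k1.mul k2
    have hz0 : sec ε 0 0 (x₀ + ((0 : ℝ) : ℂ) * x₁) (y₀ + ((0 : ℝ) : ℂ) * y₁) = g := by simp [hg]
    rw [hW0, hz0] at k3
    have hμg : mu2 g = ε * W := mu2_sec hWpos.ne'
    have hε : (ε : ℝ) ≠ 0 := ε.ne_zero
    have e1 : (ε : ℝ) * ρ / (2 * (ε * W)) = ρ / W / 2 := by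
      have := hWpos.ne'
      field_simp
    rw [hμg, e1] at k3
    unfold affine
    simp only [hx, hy]
    refine k3.congr_deriv ?_
    rw [← hE]
    simp only [Matrix.of_apply, Matrix.cons_val', Matrix.cons_val]
    push_cast
    rw [hρc, hP, hτ, hx₁, hy₁]
    field_simp
    ring

/-- The rotation multiplies `y ± ix` by `e^{±iδ}`, hence `z` by `e^{2iδ}`. Restoring `y - ix = 1`
costs the phase `e^{iδ}`, whose weight `l - l'` is added to `m`. -/
theorem InBesselSpace.affine_rotation (hB : InBesselSpace s m l l' B) (ε : ℝˣ) (δ : ℝ) (z : ℂ) :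
    affine B s (l - l') ε (Complex.exp (2 * I * δ) * z) =
      Complex.exp (I * (l - l' + m : ℤ) * δ) * affine B s (l - l') ε z := by
  have hz := (normSq_affine_pos z).ne'
  have he : Complex.exp (I * δ) = (Real.cos δ : ℂ) + (Real.sin δ : ℂ) * I := by
    rw [mul_comm, Complex.exp_mul_I]; push_cast; ring
  have he2 : Complex.exp (2 * I * δ) = Complex.exp (I * δ) * Complex.exp (I * δ) := by
    rw [← Complex.exp_add]; ring_nf
  have hsc : (Real.sin δ : ℂ) ^ 2 + (Real.cos δ : ℂ) ^ 2 = 1 := by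
    exact_mod_cast Real.sin_sq_add_cos_sq δ
  have hinv : Complex.exp (I * δ) * ((Real.cos δ : ℂ) - (Real.sin δ : ℂ) * I) = 1 := by
    rw [he]
    linear_combination hsc - (Real.sin δ : ℂ) ^ 2 * Complex.I_sq
  have h' : normSq ((Real.cos δ : ℂ) * (-I / 2 * (z - 1)) + Real.sin δ * ((z + 1) / 2)) +
      normSq (-(Real.sin δ : ℂ) * (-I / 2 * (z - 1)) + Real.cos δ * ((z + 1) / 2)) ≠ 0 := by
    have hsc := Real.sin_sq_add_cos_sq δ
    generalize -I / 2 * (z - 1) = x at *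
    generalize (z + 1) / 2 = y at *
    have : normSq ((Real.cos δ : ℂ) * x + Real.sin δ * y) +
        normSq (-(Real.sin δ : ℂ) * x + Real.cos δ * y) = normSq x + normSq y := by
      simp only [Complex.normSq_apply]
      simp [-Complex.ofReal_sin, -Complex.ofReal_cos]
      linear_combination (x.re * x.re + x.im * x.im + (y.re * y.re + y.im * y.im)) * hsc
    rw [this]; exact hz
  have e1 : -I / 2 * (Complex.exp (2 * I * δ) * z - 1) = Complex.exp (I * δ) *
      ((Real.cos δ : ℂ) * (-I / 2 * (z - 1)) + Real.sin δ * ((z + 1) / 2)) := by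
    rw [he2]
    have : (Real.cos δ : ℂ) * (-I / 2 * (z - 1)) + Real.sin δ * ((z + 1) / 2) =
        -I / 2 * (Complex.exp (I * δ) * z - ((Real.cos δ : ℂ) - (Real.sin δ : ℂ) * I)) := by
      rw [he]
      linear_combination (1 / 2 * (Real.sin δ : ℂ) * (z + 1)) * Complex.I_sq
    rw [this]
    linear_combination -I / 2 * hinv
  have e2 : (Complex.exp (2 * I * δ) * z + 1) / 2 = Complex.exp (I * δ) *
      (-(Real.sin δ : ℂ) * (-I / 2 * (z - 1)) + Real.cos δ * ((z + 1) / 2)) := by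
    rw [he2]
    have : -(Real.sin δ : ℂ) * (-I / 2 * (z - 1)) + Real.cos δ * ((z + 1) / 2) =
        (Complex.exp (I * δ) * z + ((Real.cos δ : ℂ) - (Real.sin δ : ℂ) * I)) / 2 := by
      rw [he]; ring
    rw [this]
    linear_combination -1 / 2 * hinv
  have hn : normSq (-I / 2 * (Complex.exp (2 * I * δ) * z - 1)) +
      normSq ((Complex.exp (2 * I * δ) * z + 1) / 2) =
      normSq (-I / 2 * (z - 1)) + normSq ((z + 1) / 2) := by
    rw [normSq_affine, normSq_affine, Complex.normSq_mul, he2, Complex.normSq_mul,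
      Complex.normSq_eq_norm_sq (Complex.exp _), mul_comm I, Complex.norm_exp_ofReal_mul_I]
    ring
  rw [affine, affine, hn, e1, e2, ← sec_mul_kz h', hB.apply_mul_kz, ← levi_rot_mul_sec hz,
    hB.apply_levi _ (rot_mem δ), Lam_rot, ← mul_assoc, ← mul_assoc, ← Complex.exp_add]
  congr 3
  push_cast
  ring

end

/-! ### Growth: the degree bound on `K` and vanishing for negative multiplier. -/

section
variable {s : ℂ} {m l l' : ℤ} {B : GSp4 → ℂ}

theorem normSq_add_pos {x y : ℂ} (h : normSq x + normSq y ≠ 0) : 0 < normSq x + normSq y :=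
  lt_of_le_of_ne (add_nonneg (Complex.normSq_nonneg _) (Complex.normSq_nonneg _)) h.symm

theorem InBesselSpace.apply_sec_smul (hB : InBesselSpace s m l l' B) {ε : ℝˣ} {a b : ℝ} {x y : ℂ}
    (h : normSq x + normSq y ≠ 0) {r : ℝ} (hr : 0 < r) :
    B (sec ε a b (r * x) (r * y)) = (r : ℂ) ^ s * B (sec ε a b x y) := by
  have := hB.apply_scal (Units.mk0 r hr.ne') hr (sec ε a b x y)
  rwa [scal_mul_sec h] at this

/-- On the unit sphere the matrices are orthogonal with multiplier `±1`, so `gnorm` is constantly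
`√5` there. Homogeneity of degree `s` extends the bound. -/
theorem InBesselSpace.norm_sec_le (hB : InBesselSpace s m l l' B) {ε : ℝˣ}
    (hε : (ε : ℝ) * ε = 1) : ∃ K : ℝ, ∀ x y : ℂ, normSq x + normSq y ≠ 0 →
      ‖B (sec ε 0 0 x y)‖ ≤ K * Real.exp (s.re / 2 * Real.log (normSq x + normSq y)) := by
  obtain ⟨α, β, hα, hβ, hg⟩ := hB.growth
  have hε4 : (ε : ℝ) ^ 4 = 1 := by
    linear_combination ((ε : ℝ) * ε + 1) * hε
  have h1 : ∀ x y : ℂ, normSq x + normSq y = 1 →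
      ‖B (sec ε 0 0 x y)‖ ≤ α * Real.sqrt 5 ^ β := fun x y h => by
    refine (hg _).trans_eq ?_
    congr 2
    rw [gnorm, mu2_sec (by rw [h]; simp), mat_sec (by rw [h]; simp), h]
    congr 1
    simp only [Complex.normSq_apply] at h
    have e2 : ((ε : ℝ) * 1) ^ 2 = 1 := by linear_combination hε
    rw [e2]
    simp [Fin.sum_univ_four, secMat]
    linear_combination (2 * (ε : ℝ) * ε + 2) * h + 2 * hε
  refine ⟨α * Real.sqrt 5 ^ β, fun x y h => ?_⟩
  set W := normSq x + normSq y with hW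
  have hpos : 0 < W := normSq_add_pos h
  have hr : 0 < Real.sqrt W := Real.sqrt_pos.2 hpos
  set r := Real.sqrt W with hrdef
  have hrr : r * r = W := Real.mul_self_sqrt hpos.le
  have hrc : (r : ℂ) ≠ 0 := by exact_mod_cast hr.ne'
  have hn : normSq (x / r) + normSq (y / r) = 1 := by
    rw [Complex.normSq_div, Complex.normSq_div, Complex.normSq_ofReal, hrr, ← add_div,
      div_self hpos.ne']
  have h2 := hB.apply_sec_smul (ε := ε) (a := 0) (b := 0) (x := x / r) (y := y / r)
    (by rw [hn]; simp) hr
  rw [mul_div_cancel₀ _ hrc, mul_div_cancel₀ _ hrc] at h2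
  rw [h2, norm_mul, Complex.norm_cpow_eq_rpow_re_of_pos hr, mul_comm]
  have h3 : Real.exp (s.re / 2 * Real.log W) = r ^ s.re := by
    rw [Real.rpow_def_of_pos hr, hrdef, Real.log_sqrt hpos.le]
    ring_nf
  rw [h3]
  exact mul_le_mul_of_nonneg_right (h1 _ _ hn) (by positivity)

theorem affine_one (B : GSp4 → ℂ) (s : ℂ) (n : ℤ) (ε : ℝˣ) :
    affine B s n ε 1 = B (sec ε 0 0 0 1) := by
  simp [affine]

/-- Up to phases and scaling the affine chart contains every pair with `y ≠ ix`. The remaining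
point, at infinity in the chart, is reached by continuity along `y + r`. -/
theorem InBesselSpace.sec_eq_zero (hB : InBesselSpace s m l l' B) {ε : ℝˣ}
    (h1 : B (sec ε 0 0 0 1) = 0) {x y : ℂ} (h : normSq x + normSq y ≠ 0) :
    B (sec ε 0 0 x y) = 0 := by
  have h0 := (entire_of_rotation (hB.differentiable_affine ε) (hB.affine_rotation ε)).1
    (by rw [affine_one, h1])
  have hsec : ∀ z, B (sec ε 0 0 (-I / 2 * (z - 1)) ((z + 1) / 2)) = 0 := fun z =>
    (mul_eq_zero.1 (h0 z)).resolve_right (Complex.exp_ne_zero _)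
  have hη : ∀ x y : ℂ, y - I * x ≠ 0 → B (sec ε 0 0 x y) = 0 := fun x y hη => by
    set η := y - I * x with hηdef
    set z := (y + I * x) / η with hz
    have ex : x = η * (-I / 2 * (z - 1)) := by
      rw [hz]; field_simp; rw [hηdef]; linear_combination 2 * x * Complex.I_sq
    have ey : y = η * ((z + 1) / 2) := by
      rw [hz]; field_simp; rw [hηdef]; ring
    have e1 := (normSq_affine_pos z).ne'
    have e2 : η = (‖η‖ : ℝ) * Complex.exp (I * (Complex.arg η : ℝ)) := by
      rw [mul_comm I]; exact (Complex.norm_mul_exp_arg_mul_I η).symm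
    have e3 : normSq (Complex.exp (I * (Complex.arg η : ℝ)) * (-I / 2 * (z - 1))) +
        normSq (Complex.exp (I * (Complex.arg η : ℝ)) * ((z + 1) / 2)) ≠ 0 := by
      rw [Complex.normSq_mul (Complex.exp _), Complex.normSq_mul (Complex.exp _), ← mul_add]
      refine mul_ne_zero ?_ e1
      simp
    rw [ex, ey, e2, mul_assoc, mul_assoc, hB.apply_sec_smul e3 (norm_pos_iff.2 hη),
      ← sec_mul_kz e1, hB.apply_mul_kz, hsec, mul_zero, mul_zero]
  by_cases hxy : y - I * x = 0
  · have hx : x ≠ 0 := by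
      rintro rfl
      simp at hxy
      simp [hxy] at h
    have hne : ∀ r : ℝ, normSq x + normSq (y + r) ≠ 0 := fun r => by
      have := Complex.normSq_pos.2 hx
      have := Complex.normSq_nonneg (y + r)
      positivity
    have hd : DifferentiableAt ℝ (fun r : ℝ => B (sec ε 0 0 x (y + r))) 0 := by
      refine hB.smooth.differentiableAt_comp ?_
      simp only [fun r => mat_sec (ε := ε) (a := 0) (b := 0) (hne r)]
      refine differentiableAt_matrix fun i j => ?_
      fin_cases i <;> fin_cases j <;> simp [secMat] <;> fun_prop
    have hc := hd.continuousAt.tendsto.mono_left (nhdsWithin_le_nhds (s := {0}ᶜ))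
    have h2 : Filter.Tendsto (fun r : ℝ => B (sec ε 0 0 x (y + r))) (nhdsWithin 0 {0}ᶜ)
        (nhds 0) := by
      refine tendsto_const_nhds.congr' ?_
      filter_upwards [self_mem_nhdsWithin] with r hr
      refine (hη x (y + r) ?_).symm
      rw [show y + (r : ℂ) - I * x = (y - I * x) + r by ring, hxy, zero_add]
      exact_mod_cast hr
    have h3 := tendsto_nhds_unique hc h2
    simpa using h3
  · exact hη x y hxy

/-- The restriction to `K` is `c z^p` with `2p = l - l' + m`, and the bound on `K` allows degree at
most `l - l'`. Integrality of `p` is the parity condition, and `0 ≤ p ≤ l - l'` is the bound on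
`|m|`. -/
theorem InBesselSpace.parity (hB : InBesselSpace s m l l' B) (hll' : l' ≤ l) {ε : ℝˣ}
    (hε : (ε : ℝ) * ε = 1) (h1 : B (sec ε 0 0 0 1) ≠ 0) :
    Even (l + l' + m) ∧ |m| ≤ l - l' := by
  have h1' : affine B s (l - l') ε 1 ≠ 0 := by rwa [affine_one]
  obtain ⟨p, hp, hz⟩ := (entire_of_rotation (hB.differentiable_affine ε)
    (hB.affine_rotation ε)).2 h1'
  obtain ⟨K, hK⟩ := hB.norm_sec_le hε
  have hbound : ∀ z, ‖affine B s (l - l') ε z‖ ≤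
      K * Real.exp ((l - l' : ℤ) / 2 * Real.log ((normSq z + 1) / 2)) := fun z => by
    rw [affine, norm_mul, Complex.norm_exp]
    have e1 := hK _ _ (normSq_affine_pos z).ne'
    rw [normSq_affine] at e1 ⊢
    have e2 : ((((l - l' : ℤ) : ℂ) - s) / 2 * (Real.log ((normSq z + 1) / 2) : ℝ)).re =
        ((l - l' : ℤ) - s.re) / 2 * Real.log ((normSq z + 1) / 2) := by
      rw [mul_comm, Complex.re_ofReal_mul, mul_comm]
      congr 1
      rw [show (2 : ℂ) = ((2 : ℝ) : ℂ) by simp, Complex.div_ofReal_re]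
      simp
    rw [e2]
    calc _ ≤ K * Real.exp (s.re / 2 * Real.log ((normSq z + 1) / 2)) *
          Real.exp (((l - l' : ℤ) - s.re) / 2 * Real.log ((normSq z + 1) / 2)) :=
          mul_le_mul_of_nonneg_right e1 (Real.exp_pos _).le
      _ = _ := by rw [mul_assoc, ← Real.exp_add]; ring_nf
  have hK0 : 0 ≤ K := by
    have := (norm_nonneg _).trans (hbound 1)
    exact nonneg_of_mul_nonneg_left this (Real.exp_pos _)
  have hn : (0 : ℝ) ≤ ((l - l' : ℤ) : ℝ) := by exact_mod_cast Int.sub_nonneg.2 hll'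
  have hpn : (p : ℝ) ≤ ((l - l' : ℤ) : ℝ) := by
    refine degree_le_of_growth (K := K) h1' fun r hr => ?_
    have hr0 : 0 < r := by linarith
    have e1 := hbound r
    rw [hz r (by exact_mod_cast hr0.ne'), norm_mul, norm_pow, Complex.norm_real,
      Real.norm_of_nonneg hr0.le, Complex.normSq_ofReal] at e1
    refine e1.trans ?_
    gcongr
    rw [Real.rpow_def_of_pos hr0, mul_comm (Real.log r)]
    apply Real.exp_le_exp.2
    have e2 : Real.log ((r * r + 1) / 2) ≤ 2 * Real.log r := by
      rw [two_mul, ← Real.log_mul hr0.ne' hr0.ne']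
      apply Real.log_le_log (by positivity)
      nlinarith
    calc _ ≤ ((l - l' : ℤ) : ℝ) / 2 * (2 * Real.log r) := by gcongr
      _ = _ := by ring
  have hpn' : (p : ℤ) ≤ l - l' := by exact_mod_cast hpn
  refine ⟨⟨p + l', by omega⟩, abs_le.2 ⟨by omega, by omega⟩⟩

/-- For negative multiplier the imaginary part of `τ` is negative. Along the scaling `a = b = t`,
with `u = e^{2t}`, the factor forced by `θ` is `e^{4π(u-1)}`, while `gnorm` is at most `3u`. -/
theorem InBesselSpace.neg_eq_zero (hB : InBesselSpace s m l l' B) :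
    B (sec (-1) 0 0 0 1) = 0 := by
  obtain ⟨α, β, hα, hβ, hg⟩ := hB.growth
  by_contra hne
  set σ : ℝ := ((s + l + l') / 2).re with hσ
  have h1 : ∀ u : ℝ, 1 ≤ u → Real.exp (4 * Real.pi * (u - 1)) * u ^ σ * ‖B (sec (-1) 0 0 0 1)‖ ≤
      α * (3 * u) ^ β := fun u hu => by
    have hu0 : 0 < u := by linarith
    set t := Real.log u / 2 with ht
    have ht2 : Real.exp (2 * t) = u := by
      rw [ht, mul_div_cancel₀ _ two_ne_zero, Real.exp_log hu0]
    have key := hB.apply_sec (-1) t t (x := 0) (y := 1) (by simp)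
    simp only [mul_zero, mul_one, map_zero, map_one, zero_add, add_zero, sub_self, Real.exp_zero,
      Real.log_one, Complex.ofReal_zero, sub_zero, ht2] at key
    have e1 : ‖B (sec (-1) t t 0 (Real.exp t))‖ =
        Real.exp (4 * Real.pi * (u - 1)) * u ^ σ * ‖B (sec (-1) 0 0 0 1)‖ := by
      rw [key, norm_mul, Complex.norm_exp, Real.rpow_def_of_pos hu0, ← Real.exp_add]
      congr 2
      rw [Complex.add_re, mul_comm ((s + l + l') / 2), Complex.re_ofReal_mul, ← hσ]
      congr 1
      have : (0 - 2 * (Real.pi : ℂ) * ((-1 : ℝˣ) : ℝ) * ((u : ℂ) + u - 2)) =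
          ((4 * Real.pi * (u - 1) : ℝ) : ℂ) := by
        simp
        ring
      rw [this, Complex.ofReal_re]
    rw [← e1]
    refine (hg _).trans ?_
    have hnn : normSq (0 : ℂ) + normSq ((Real.exp t : ℝ) : ℂ) ≠ 0 := by
      rw [Complex.normSq_ofReal]; simp
    have e2 : gnorm (sec (-1) t t 0 (Real.exp t)) ≤ 3 * u := by
      have h4 : Real.exp t * Real.exp t = u := by rw [← Real.exp_add, ← two_mul, ht2]
      have h5 : Real.exp (-t) * Real.exp t = 1 := by rw [← Real.exp_add]; simp
      rw [gnorm, mu2_sec hnn, mat_sec hnn, Complex.normSq_ofReal, h4]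
      apply Real.sqrt_le_iff.2 ⟨by positivity, ?_⟩
      simp [Fin.sum_univ_four, secMat, h4, h5, -Complex.ofReal_exp]
      have h6 : (u ^ 2)⁻¹ ≤ 1 := inv_le_one_of_one_le₀ (one_le_pow₀ hu)
      nlinarith
    have e3 := one_le_gnorm (sec (-1) t t 0 (Real.exp t))
    gcongr
  have h2 : ∀ u : ℝ, 1 ≤ u → ‖B (sec (-1) 0 0 0 1)‖ ≤
      α * 3 ^ β * Real.exp (4 * Real.pi) * (u ^ (β - σ) * Real.exp (-(4 * Real.pi) * u)) :=
    fun u hu => by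
      have hu0 : 0 < u := by linarith
      have e := h1 u hu
      have e1 : 0 < Real.exp (4 * Real.pi * (u - 1)) * u ^ σ := by positivity
      rw [← le_div_iff₀' e1] at e
      refine e.trans_eq ?_
      rw [Real.mul_rpow (by norm_num) hu0.le, Real.rpow_sub hu0,
        show 4 * Real.pi * (u - 1) = -(-(4 * Real.pi) * u) - 4 * Real.pi by ring, Real.exp_sub,
        Real.exp_neg]
      field_simp
  have h3 := (tendsto_rpow_mul_exp_neg_mul_atTop_nhds_zero (β - σ) (4 * Real.pi)
    (by positivity)).const_mul (α * 3 ^ β * Real.exp (4 * Real.pi))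
  rw [mul_zero] at h3
  have h4 : ‖B (sec (-1) 0 0 0 1)‖ ≤ 0 := ge_of_tendsto h3 (by
    filter_upwards [Filter.eventually_ge_atTop (1 : ℝ)] with u hu
    exact h2 u hu)
  exact hne (norm_le_zero_iff.1 h4)

end

/-! ### The decomposition of the group -/

theorem mat_mul_J4_mul_transpose (g : GSp4) : mat g * J4 ℝ * (mat g)ᵀ = mu2 g • J4 ℝ := by
  have h0 := mu2_ne_zero g
  have h1 : (-(mu2 g)⁻¹ • (J4 ℝ * (mat g)ᵀ * J4 ℝ)) * mat g = 1 := by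
    rw [Matrix.smul_mul, Matrix.mul_assoc, Matrix.mul_assoc, ← Matrix.mul_assoc (mat g)ᵀ, mat_mem,
      Matrix.mul_smul, J4_mul_J4, smul_smul]
    simp [h0]
  have h2 := mul_eq_one_comm.mp h1
  have h3 : mat g * J4 ℝ * (mat g)ᵀ * J4 ℝ = -(mu2 g • (1 : M4)) := by
    rw [← h2, Matrix.mul_smul, smul_smul, mul_neg, mul_inv_cancel₀ h0]
    simp [Matrix.mul_assoc]
  calc mat g * J4 ℝ * (mat g)ᵀ = -(mat g * J4 ℝ * (mat g)ᵀ * J4 ℝ * J4 ℝ) := by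
        rw [Matrix.mul_assoc _ (J4 ℝ) (J4 ℝ), J4_mul_J4]; simp
    _ = _ := by rw [h3]; simp

theorem Jm_apply (M : M4) : Jm M = !![M 2 2 + I * M 2 0, M 2 3 + I * M 2 1;
    M 3 2 + I * M 3 0, M 3 3 + I * M 3 1] := by
  rw [Jm]
  simp only [(Q_entry M _).1, (Q_entry M _).2]

theorem rows_eq_of_Jm_eq {M N : M4} (h : Jm M = Jm N) (j : Fin 4) :
    M 2 j = N 2 j ∧ M 3 j = N 3 j := by
  rw [Jm_apply, Jm_apply] at h
  have e : ∀ i j, (!![(M 2 2 : ℂ) + I * M 2 0, M 2 3 + I * M 2 1;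
    M 3 2 + I * M 3 0, M 3 3 + I * M 3 1] : Matrix (Fin 2) (Fin 2) ℂ) i j =
    (!![(N 2 2 : ℂ) + I * N 2 0, N 2 3 + I * N 2 1;
    N 3 2 + I * N 3 0, N 3 3 + I * N 3 1] : Matrix (Fin 2) (Fin 2) ℂ) i j := fun i j => by rw [h]
  have e00 := e 0 0
  have e01 := e 0 1
  have e10 := e 1 0
  have e11 := e 1 1
  simp [Complex.ext_iff] at e00 e01 e10 e11
  fin_cases j
  · exact ⟨e00.2, e10.2⟩
  · exact ⟨e01.2, e11.2⟩
  · exact ⟨e00.1, e10.1⟩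
  · exact ⟨e01.1, e11.1⟩

/-- Elements with the same multiplier and the same automorphy factor at `i` agree up to the
unipotent radical. -/
theorem exists_unip {g h : GSp4} (hμ : mu2 g = mu2 h) (hJ : Jm (mat g) = Jm (mat h)) :
    ∃ (X : Matrix (Fin 2) (Fin 2) ℝ) (hX : X.IsSymm), g = unip X hX * h := by
  set p := g * h⁻¹ with hp
  have hg : g = p * h := by rw [hp]; simp
  have hp1 : mu2 p = 1 := by
    have := mu2_mul p h
    rw [← hg, hμ] at this
    have h0 := mu2_ne_zero h
    field_simp at this
    linarith
  -- The real and imaginary parts of `Ci + D` recover `D` and `C`, so `g` and `h` have the same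
  -- lower rows. The symplectic relations then leave only a symmetric upper right block in `p`.
  have hrow : ∀ j, mat p 2 j = (1 : M4) 2 j ∧ mat p 3 j = (1 : M4) 3 j := fun j => by
    have h1 : mat p = mat g * mat h⁻¹ := by rw [hp, mat_mul]
    rw [← mat_mul_inv h, h1, Matrix.mul_apply, Matrix.mul_apply, Matrix.mul_apply,
      Matrix.mul_apply]
    exact ⟨Finset.sum_congr rfl fun k _ => by rw [(rows_eq_of_Jm_eq hJ k).1],
      Finset.sum_congr rfl fun k _ => by rw [(rows_eq_of_Jm_eq hJ k).2]⟩
  have e : ∀ i j, (mat p * J4 ℝ * (mat p)ᵀ) i j = J4 ℝ i j := fun i j => by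
    rw [mat_mul_J4_mul_transpose, hp1, one_smul]
  have p20 := (hrow 0).1
  have p21 := (hrow 1).1
  have p22 := (hrow 2).1
  have p23 := (hrow 3).1
  have p30 := (hrow 0).2
  have p31 := (hrow 1).2
  have p32 := (hrow 2).2
  have p33 := (hrow 3).2
  have e01 := e 0 1
  have e02 := e 0 2
  have e03 := e 0 3
  have e12 := e 1 2
  have e13 := e 1 3
  simp at p20 p21 p22 p23 p30 p31 p32 p33
  simp [Matrix.mul_apply, Fin.sum_univ_four, J4, p20, p21, p22, p23, p30, p31, p32, p33]
    at e01 e02 e03 e12 e13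
  simp [e02, e03, e12, e13] at e01
  have hX : (!![mat p 0 2, mat p 0 3; mat p 1 2, mat p 1 3] :
      Matrix (Fin 2) (Fin 2) ℝ).IsSymm := by
    ext i j
    fin_cases i <;> fin_cases j <;> simp <;> linarith
  refine ⟨_, hX, ?_⟩
  conv_lhs => rw [hg]
  congr 1
  apply ext_mat
  rw [unip, mat_mkGSp]
  ext i j
  fin_cases i <;> fin_cases j <;> 
    simp [blk, p20, p21, p22, p23, p30, p31, p32, p33, e02, e03, e12, e13]

/-- Principal axes of the symmetric matrix with diagonal `a, b` and off-diagonal entry `d`: the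
angle is half the argument of `(a - b)/2 + id`. It will be applied to the Gram matrix of the lower
rows. -/
theorem exists_rot_orthogonal (a b d : ℝ) : ∃ δ : ℝ,
    -Real.cos δ * Real.sin δ * a + Real.cos δ * Real.sin δ * b +
      (Real.cos δ ^ 2 - Real.sin δ ^ 2) * d = 0 := by
  set z : ℂ := ⟨(a - b) / 2, d⟩ with hz
  refine ⟨Complex.arg z / 2, ?_⟩
  have h1 : ‖z‖ * Real.cos (Complex.arg z) = (a - b) / 2 := Complex.norm_mul_cos_arg z
  have h2 : ‖z‖ * Real.sin (Complex.arg z) = d := Complex.norm_mul_sin_arg z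
  have h3 : Complex.arg z = 2 * (Complex.arg z / 2) := by ring
  rw [h3, Real.cos_two_mul] at h1
  rw [h3, Real.sin_two_mul] at h2
  have h4 := Real.sin_sq_add_cos_sq (Complex.arg z / 2)
  generalize Real.cos (Complex.arg z / 2) = c at *
  generalize Real.sin (Complex.arg z / 2) = t at *
  linear_combination (-2 * c * t) * (-h1) * 1 - (c ^ 2 - t ^ 2) * h2 +
    (-2 * ‖z‖ * c * t) * h4

theorem eq_zero_of_sum_sq {a b c d : ℝ} (h : a ^ 2 + b ^ 2 + c ^ 2 + d ^ 2 = 0) :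
    a = 0 ∧ b = 0 ∧ c = 0 ∧ d = 0 := by
  have ha := sq_nonneg a
  have hb := sq_nonneg b
  have hc := sq_nonneg c
  have hd := sq_nonneg d
  have z : ∀ x : ℝ, x ^ 2 = 0 → x = 0 := fun x => (pow_eq_zero_iff two_ne_zero).1
  exact ⟨z a (by linarith), z b (by linarith), z c (by linarith), z d (by linarith)⟩

/-- A unitary `2 × 2` matrix is known from its second column and its determinant `d`, because its
inverse is its adjoint. -/
theorem exists_det_of_unitary {u₀₀ u₀₁ u₁₀ u₁₁ : ℂ} (n0 : u₀₀ * conj u₀₀ + u₀₁ * conj u₀₁ = 1)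
    (n1 : u₁₀ * conj u₁₀ + u₁₁ * conj u₁₁ = 1) (n01 : u₀₀ * conj u₁₀ + u₀₁ * conj u₁₁ = 0) :
    ∃ d : ℂ, ‖d‖ = 1 ∧ d * conj u₁₁ = u₀₀ ∧ -(d * conj u₀₁) = u₁₀ ∧
      normSq u₀₁ + normSq u₁₁ = 1 := by
  have n10 : conj u₀₀ * u₁₀ + conj u₀₁ * u₁₁ = 0 := by
    have := congrArg conj n01
    simpa using this
  set d := u₀₀ * u₁₁ - u₀₁ * u₁₀ with hd
  have hd1 : d * conj d = 1 := by
    rw [hd]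
    simp only [map_sub, map_mul]
    linear_combination n0 * (u₁₀ * conj u₁₀ + u₁₁ * conj u₁₁) + n1 -
      n01 * (conj u₀₀ * u₁₀ + conj u₀₁ * u₁₁)
  have hd00 : d * conj u₁₁ = u₀₀ := by
    rw [hd]; linear_combination u₀₀ * n1 - u₁₀ * n01
  have hd10 : -(d * conj u₀₁) = u₁₀ := by
    rw [hd]; linear_combination u₁₀ * n0 - u₀₀ * n10
  have hdn : ‖d‖ = 1 := by
    rw [Complex.mul_conj, Complex.normSq_eq_norm_sq] at hd1
    have : ‖d‖ ^ 2 = 1 := by exact_mod_cast hd1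
    exact (pow_eq_one_iff_of_nonneg (norm_nonneg d) two_ne_zero).1 this
  have hu2 : normSq u₀₁ + normSq u₁₁ = 1 := by
    have h1 : normSq u₀₀ = normSq u₁₁ := by
      rw [← hd00, Complex.normSq_mul, Complex.normSq_conj, Complex.normSq_eq_norm_sq d, hdn]
      ring
    have h2 : normSq u₀₀ + normSq u₀₁ = 1 := by
      rw [Complex.mul_conj, Complex.mul_conj] at n0
      exact_mod_cast n0
    linarith
  exact ⟨d, hdn, hd00, hd10, hu2⟩

/-- A rotation in `T` makes the lower rows orthogonal in `ℝ⁴`; the symplectic relation says that the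
imaginary part of the hermitian product of the rows of `Ci + D` also vanishes. So `Ci + D` is
positive diagonal times unitary, which `sec` and `kz φ 0` reproduce with the same multiplier.
`exists_unip` gives the rest. -/
theorem exists_decomposition (g : GSp4) : ∃ (δ : ℝ) (X : Matrix (Fin 2) (Fin 2) ℝ) (hX : X.IsSymm)
    (ε : ℝˣ) (a b : ℝ) (x y : ℂ) (φ : ℝ), (ε = 1 ∨ ε = -1) ∧ normSq x + normSq y ≠ 0 ∧
    levi (rot δ) * g = unip X hX * (sec ε a b x y * kz φ 0) := by
  obtain ⟨δ, hδ⟩ := exists_rot_orthogonal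
    (mat g 2 0 ^ 2 + mat g 2 1 ^ 2 + mat g 2 2 ^ 2 + mat g 2 3 ^ 2)
    (mat g 3 0 ^ 2 + mat g 3 1 ^ 2 + mat g 3 2 ^ 2 + mat g 3 3 ^ 2)
    (mat g 2 0 * mat g 3 0 + mat g 2 1 * mat g 3 1 + mat g 2 2 * mat g 3 2 + mat g 2 3 * mat g 3 3)
  set g₁ := levi (rot δ) * g with hg₁
  have hr : ∀ j, mat g₁ 2 j = Real.cos δ * mat g 2 j + Real.sin δ * mat g 3 j ∧
      mat g₁ 3 j = -Real.sin δ * mat g 2 j + Real.cos δ * mat g 3 j := fun j => by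
    rw [hg₁, mat_mul, mat_levi_rot]
    constructor <;> simp [blk, Matrix.mul_apply, Fin.sum_univ_four]
  have horth : mat g₁ 2 0 * mat g₁ 3 0 + mat g₁ 2 1 * mat g₁ 3 1 + mat g₁ 2 2 * mat g₁ 3 2 +
      mat g₁ 2 3 * mat g₁ 3 3 = 0 := by
    simp only [fun j => (hr j).1, fun j => (hr j).2]
    linear_combination hδ
  have e : ∀ i j, (mat g₁ * J4 ℝ * (mat g₁)ᵀ) i j = (mu2 g₁ • J4 ℝ) i j := fun i j => by
    rw [mat_mul_J4_mul_transpose]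
  have hμ0 := mu2_ne_zero g₁
  have e02 := e 0 2
  have e13 := e 1 3
  have e23 := e 2 3
  simp [Matrix.mul_apply, Fin.sum_univ_four, J4] at e02 e13 e23
  generalize hM : mat g₁ = M at *
  set P := M 2 0 ^ 2 + M 2 1 ^ 2 + M 2 2 ^ 2 + M 2 3 ^ 2 with hP
  set R := M 3 0 ^ 2 + M 3 1 ^ 2 + M 3 2 ^ 2 + M 3 3 ^ 2 with hR
  have hP0 : 0 < P := by
    refine lt_of_le_of_ne (by positivity) fun h => hμ0 ?_
    obtain ⟨h0, h1, h2, h3⟩ := eq_zero_of_sum_sq h.symm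
    simp [h0, h1, h2, h3] at e02
    exact e02.symm
  have hR0 : 0 < R := by
    refine lt_of_le_of_ne (by positivity) fun h => hμ0 ?_
    obtain ⟨h0, h1, h2, h3⟩ := eq_zero_of_sum_sq h.symm
    simp [h0, h1, h2, h3] at e13
    exact e13.symm
  -- the normalized automorphy factor is unitary
  set p := Real.sqrt P with hp
  set r := Real.sqrt R with hrr
  have hp0 : 0 < p := Real.sqrt_pos.2 hP0
  have hr0 : 0 < r := Real.sqrt_pos.2 hR0
  have hpp : p * p = P := Real.mul_self_sqrt hP0.le
  have hrr' : r * r = R := Real.mul_self_sqrt hR0.le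
  have hpc : (p : ℂ) ≠ 0 := by exact_mod_cast hp0.ne'
  have hrc : (r : ℂ) ≠ 0 := by exact_mod_cast hr0.ne'
  set u₀₀ : ℂ := (M 2 2 + I * M 2 0) / p with hu00
  set u₀₁ : ℂ := (M 2 3 + I * M 2 1) / p with hu01
  set u₁₀ : ℂ := (M 3 2 + I * M 3 0) / r with hu10
  set u₁₁ : ℂ := (M 3 3 + I * M 3 1) / r with hu11
  have n0 : u₀₀ * conj u₀₀ + u₀₁ * conj u₀₁ = 1 := by
    have : (p : ℂ) * p = P := by exact_mod_cast hpp
    rw [hu00, hu01]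
    simp only [map_div₀, Complex.conj_ofReal, map_add, map_mul, Complex.conj_I]
    field_simp
    rw [sq, this, hP]
    push_cast
    linear_combination (-(M 2 0 : ℂ) ^ 2 - (M 2 1 : ℂ) ^ 2) * Complex.I_sq
  have n1 : u₁₀ * conj u₁₀ + u₁₁ * conj u₁₁ = 1 := by
    have : (r : ℂ) * r = R := by exact_mod_cast hrr'
    rw [hu10, hu11]
    simp only [map_div₀, Complex.conj_ofReal, map_add, map_mul, Complex.conj_I]
    field_simp
    rw [sq, this, hR]
    push_cast
    linear_combination (-(M 3 0 : ℂ) ^ 2 - (M 3 1 : ℂ) ^ 2) * Complex.I_sq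
  have n01 : u₀₀ * conj u₁₀ + u₀₁ * conj u₁₁ = 0 := by
    rw [hu00, hu10, hu01, hu11]
    simp only [map_div₀, Complex.conj_ofReal, map_add, map_mul, Complex.conj_I]
    field_simp
    have h1 : (M 2 0 : ℂ) * M 3 0 + M 2 1 * M 3 1 + M 2 2 * M 3 2 + M 2 3 * M 3 3 = 0 := by
      exact_mod_cast horth
    have h2 : (M 2 0 : ℂ) * M 3 2 + M 2 1 * M 3 3 - M 2 2 * M 3 0 - M 2 3 * M 3 1 = 0 := by
      have : M 2 0 * M 3 2 + M 2 1 * M 3 3 - M 2 2 * M 3 0 - M 2 3 * M 3 1 = 0 := by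
        linear_combination e23
      exact_mod_cast this
    linear_combination h1 + I * h2 - ((M 2 0 : ℂ) * M 3 0 + M 2 1 * M 3 1) * Complex.I_sq
  obtain ⟨d, hdn, hd00, hd10, hu2⟩ := exists_det_of_unitary n0 n1 n01
  set W := |mu2 g₁| with hW
  have hW0 : 0 < W := abs_pos.2 hμ0
  set w := Real.sqrt W with hw
  have hw0 : 0 < w := Real.sqrt_pos.2 hW0
  have hww : w * w = W := Real.mul_self_sqrt hW0.le
  have hxy : normSq (w * u₀₁) + normSq (w * u₁₁) = W := by
    rw [Complex.normSq_mul, Complex.normSq_mul, Complex.normSq_ofReal, ← mul_add, hu2, hww, mul_one]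
  obtain ⟨ε, hε, hεμ⟩ : ∃ ε : ℝˣ, (ε = 1 ∨ ε = -1) ∧ mu2 g₁ = ε * W := by
    rcases lt_or_gt_of_ne hμ0 with h | h
    · exact ⟨-1, Or.inr rfl, by rw [hW, abs_of_neg h]; simp⟩
    · exact ⟨1, Or.inl rfl, by rw [hW, abs_of_pos h]; simp⟩
  have hne : normSq (w * u₀₁) + normSq (w * u₁₁) ≠ 0 := by rw [hxy]; exact hW0.ne'
  set φ := -Complex.arg d with hφ
  have hdφ : d = (Real.cos φ : ℂ) - (Real.sin φ : ℂ) * I := by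
    have := Complex.norm_mul_exp_arg_mul_I d
    rw [hdn, Complex.ofReal_one, one_mul, Complex.exp_mul_I] at this
    rw [← this, hφ, Real.cos_neg, Real.sin_neg]
    push_cast
    ring
  have hwc : (w : ℂ) ≠ 0 := by exact_mod_cast hw0.ne'
  -- The pair `(x, y)` is scaled by `w = √|μ|` to match the multiplier; `e^{-a} = p/w` and `e^{-b} =
  -- r/w` then restore the row lengths, and `kz φ 0` supplies the determinant `d = e^{-iφ}`.
  have hJ : Jm (mat g₁) = Jm (mat (sec ε (Real.log (w / p)) (Real.log (w / r)) (w * u₀₁) (w * u₁₁) *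
      kz φ 0)) := by
    have hk : Jm (mat (sec ε (Real.log (w / p)) (Real.log (w / r)) (w * u₀₁) (w * u₁₁) *
      kz φ 0)) = Jm (secMat ε (Real.log (w / p)) (Real.log (w / r)) (w * u₀₁) (w * u₁₁)) *
        !![d, 0; 0, 1] := by
      rw [mat_mul, mat_sec hne, hdφ, Jm_apply, Jm_apply]
      generalize secMat ε (Real.log (w / p)) (Real.log (w / r)) (w * u₀₁) (w * u₁₁) = A
      ext i j
      fin_cases i <;> fin_cases j <;>
        simp [kz, Matrix.mul_apply, Fin.sum_univ_four, Fin.sum_univ_two] <;> ring_nf <;>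
        simp [Complex.I_sq]
    rw [hk, Jm_secMat, hM, Jm_apply, Real.exp_neg, Real.exp_neg, Real.exp_log (by positivity),
      Real.exp_log (by positivity)]
    have a00 : (M 2 2 + I * M 2 0 : ℂ) = p * (d * conj u₁₁) := by rw [hd00, hu00]; field_simp
    have a01 : (M 2 3 + I * M 2 1 : ℂ) = p * u₀₁ := by rw [hu01]; field_simp
    have a10 : (M 3 2 + I * M 3 0 : ℂ) = r * -(d * conj u₀₁) := by rw [hd10, hu10]; field_simp
    have a11 : (M 3 3 + I * M 3 1 : ℂ) = r * u₁₁ := by rw [hu11]; field_simp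
    rw [a00, a01, a10, a11]
    ext i j
    fin_cases i <;> fin_cases j <;> simp [Matrix.mul_apply, Fin.sum_univ_two] <;> field_simp
  have hμeq : mu2 g₁ = mu2 (sec ε (Real.log (w / p)) (Real.log (w / r)) (w * u₀₁) (w * u₁₁) *
      kz φ 0) := by
    rw [hεμ, mu2_mul (sec _ _ _ _ _) (kz φ 0), mu2_sec hne, hxy, kz, mu2_mkGSp, mul_one]
  obtain ⟨X, hX, hg⟩ := exists_unip hμeq hJ
  exact ⟨δ, X, hX, ε, _, _, _, _, φ, hε, hne, hg⟩

/-- A Bessel function is determined by its value at the identity. -/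
theorem InBesselSpace.eq_zero {s : ℂ} {m l l' : ℤ} {B : GSp4 → ℂ} (hB : InBesselSpace s m l l' B)
    (h1 : B 1 = 0) : B = 0 := by
  have hsec : ∀ (ε : ℝˣ) (a b : ℝ) (x y : ℂ), (ε = 1 ∨ ε = -1) → normSq x + normSq y ≠ 0 →
      B (sec ε a b x y) = 0 := fun ε a b x y hε h => by
    have h0 : B (sec ε 0 0 0 1) = 0 := by
      rcases hε with rfl | rfl
      · rw [one_eq_sec, h1]
      · exact hB.neg_eq_zero
    have ea : ∀ c : ℝ, ((Real.exp c : ℝ) : ℂ) ≠ 0 := fun c => by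
      exact_mod_cast (Real.exp_pos c).ne'
    have hn : normSq (x / Real.exp a) + normSq (y / Real.exp b) ≠ 0 := by
      have hx := Complex.normSq_nonneg x
      have hy := Complex.normSq_nonneg y
      intro hz
      have e1 := Complex.normSq_nonneg (x / Real.exp a)
      have e2 := Complex.normSq_nonneg (y / Real.exp b)
      have e3 : normSq (x / Real.exp a) = 0 := by linarith
      have e4 : normSq (y / Real.exp b) = 0 := by linarith
      have e5 := Complex.normSq_eq_zero.1 e3
      have e6 := Complex.normSq_eq_zero.1 e4
      rw [div_eq_zero_iff, or_iff_left (ea _)] at e5 e6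
      simp [e5, e6] at h
    have := hB.apply_sec ε a b hn
    rw [mul_div_cancel₀ _ (ea a), mul_div_cancel₀ _ (ea b), hB.sec_eq_zero h0 hn, mul_zero] at this
    exact this
  funext g
  obtain ⟨δ, X, hX, ε, a, b, x, y, φ, hε, hne, hg⟩ := exists_decomposition g
  have e1 := hB.apply_levi _ (rot_mem δ) g
  rw [hg, hB.apply_unip, hB.apply_mul_kz, hsec ε a b x y hε hne, mul_zero, mul_zero, Lam_rot] at e1
  exact (mul_eq_zero.1 e1.symm).resolve_left (Complex.exp_ne_zero _)

/-! ### The explicit Bessel function -/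

/-- Complex `4 × 2` matrices. -/
abbrev M42 : Type := Matrix (Fin 4) (Fin 2) ℂ

/-- The determinant of the lower block. -/
def detJ (W : M42) : ℂ := W 2 0 * W 3 1 - W 2 1 * W 3 0

/-- The trace of the upper block times the adjugate of the lower block. -/
def trN (W : M42) : ℂ := W 0 0 * W 3 1 - W 0 1 * W 3 0 - W 1 0 * W 2 1 + W 1 1 * W 2 0

/-- The sum of the squared absolute values of the entries of the lower block. -/
def sumJ (W : M42) : ℝ := normSq (W 2 0) + normSq (W 2 1) + normSq (W 3 0) + normSq (W 3 1)

/-- The lowest weight vector `(J₁₁ + i J₀₁)^p (J₁₁ - i J₀₁)^q`, where `J` is the lower block. -/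
def lowest (p q : ℕ) (W : M42) : ℂ := (W 3 1 + I * W 2 1) ^ p * (W 3 1 - I * W 2 1) ^ q

/-- The holomorphic part of the explicit Bessel functions. -/
def hol (L : ℕ) (f : M42 → ℂ) (W : M42) : ℂ :=
  (detJ W)⁻¹ ^ L * f W * Complex.exp (2 * Real.pi * I * (trN W / detJ W))

/-- The explicit Bessel functions, supported on the identity component. -/
def explicit (κ : ℂ) (L : ℕ) (f : M42 → ℂ) (g : GSp4) : ℂ :=
  if 0 < mu2 g then (mu2 g : ℂ) ^ κ * hol L f (Q (mat g)) else 0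

/-- This is the trace of `Im τ = μ (J J*)⁻¹`, multiplied by `|det J|²`. It shows that `J` is
invertible and that `e^{2πi tr τ}` decays for `μ > 0`. -/
theorem im_trN (g : GSp4) :
    (trN (Q (mat g)) * conj (detJ (Q (mat g)))).im = mu2 g * sumJ (Q (mat g)) := by
  have e : ∀ i j, (mat g * J4 ℝ * (mat g)ᵀ) i j = (mu2 g • J4 ℝ) i j := fun i j => by
    rw [mat_mul_J4_mul_transpose]
  have e02 := e 0 2
  have e13 := e 1 3
  have e03 := e 0 3
  have e12 := e 1 2
  have e23 := e 2 3
  simp [Matrix.mul_apply, Fin.sum_univ_four, J4] at e02 e13 e03 e12 e23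
  generalize mat g = M at *
  generalize mu2 g = μ at *
  have hQ : ∀ i, Q M i 0 = ⟨M i 2, M i 0⟩ ∧ Q M i 1 = ⟨M i 3, M i 1⟩ := fun i => by
    rw [(Q_entry M i).1, (Q_entry M i).2]
    constructor <;> apply Complex.ext <;> simp
  set W := Q M with hW
  -- the products of the rows of `W` with the conjugates of the rows of its lower block
  have key : trN W * conj (detJ W) =
      (W 0 0 * conj (W 2 0) + W 0 1 * conj (W 2 1)) *
        (W 3 0 * conj (W 3 0) + W 3 1 * conj (W 3 1)) -
      (W 0 0 * conj (W 3 0) + W 0 1 * conj (W 3 1)) *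
        (W 3 0 * conj (W 2 0) + W 3 1 * conj (W 2 1)) -
      (W 1 0 * conj (W 2 0) + W 1 1 * conj (W 2 1)) *
        (W 2 0 * conj (W 3 0) + W 2 1 * conj (W 3 1)) +
      (W 1 0 * conj (W 3 0) + W 1 1 * conj (W 3 1)) *
        (W 2 0 * conj (W 2 0) + W 2 1 * conj (W 2 1)) := by
    simp only [trN, detJ, map_sub, map_mul]
    ring
  have him : ∀ i j, (W i 0 * conj (W j 0) + W i 1 * conj (W j 1)).im =
      M i 0 * M j 2 + M i 1 * M j 3 - M i 2 * M j 0 - M i 3 * M j 1 := fun i j => by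
    rw [(hQ i).1, (hQ i).2, (hQ j).1, (hQ j).2]
    simp
    ring
  have h02 := him 0 2
  have h03 := him 0 3
  have h12 := him 1 2
  have h13 := him 1 3
  have h22 := him 2 2
  have h33 := him 3 3
  have h23 := him 2 3
  have h32 := him 3 2
  have hre : ∀ i, (W i 0 * conj (W i 0) + W i 1 * conj (W i 1)).re =
      normSq (W i 0) + normSq (W i 1) := fun i => by
    simp [Complex.mul_conj]
  rw [show M 0 0 * M 2 2 + M 0 1 * M 2 3 - M 0 2 * M 2 0 - M 0 3 * M 2 1 = μ by
    linear_combination e02] at h02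
  rw [show M 0 0 * M 3 2 + M 0 1 * M 3 3 - M 0 2 * M 3 0 - M 0 3 * M 3 1 = 0 by
    linear_combination e03] at h03
  rw [show M 1 0 * M 2 2 + M 1 1 * M 2 3 - M 1 2 * M 2 0 - M 1 3 * M 2 1 = 0 by
    linear_combination e12] at h12
  rw [show M 1 0 * M 3 2 + M 1 1 * M 3 3 - M 1 2 * M 3 0 - M 1 3 * M 3 1 = μ by
    linear_combination e13] at h13
  rw [show M 2 0 * M 3 2 + M 2 1 * M 3 3 - M 2 2 * M 3 0 - M 2 3 * M 3 1 = 0 by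
    linear_combination e23] at h23
  rw [show M 3 0 * M 2 2 + M 3 1 * M 2 3 - M 3 2 * M 2 0 - M 3 3 * M 2 1 = 0 by
    linear_combination -e23] at h32
  rw [show M 2 0 * M 2 2 + M 2 1 * M 2 3 - M 2 2 * M 2 0 - M 2 3 * M 2 1 = 0 by ring] at h22
  rw [show M 3 0 * M 3 2 + M 3 1 * M 3 3 - M 3 2 * M 3 0 - M 3 3 * M 3 1 = 0 by ring] at h33
  have hre2 := hre 2
  have hre3 := hre 3
  rw [key, Complex.add_im, Complex.sub_im, Complex.sub_im, Complex.mul_im, Complex.mul_im,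
    Complex.mul_im, Complex.mul_im, h02, h03, h12, h13, h22, h33, h23, h32, hre2, hre3, sumJ]
  ring

theorem sumJ_pos (g : GSp4) : 0 < sumJ (Q (mat g)) := by
  have hn : ∀ i j, 0 ≤ normSq (Q (mat g) i j) := fun i j => Complex.normSq_nonneg _
  refine lt_of_le_of_ne (by unfold sumJ; linarith [hn 2 0, hn 2 1, hn 3 0, hn 3 1]) fun h => ?_
  have h20 : Q (mat g) 2 0 = 0 := Complex.normSq_eq_zero.1 (by
    unfold sumJ at h; linarith [hn 2 0, hn 2 1, hn 3 0, hn 3 1])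
  have h21 : Q (mat g) 2 1 = 0 := Complex.normSq_eq_zero.1 (by
    unfold sumJ at h; linarith [hn 2 0, hn 2 1, hn 3 0, hn 3 1])
  rw [(Q_entry _ _).1] at h20
  rw [(Q_entry _ _).2] at h21
  simp [Complex.ext_iff] at h20 h21
  have e02 := congrFun (congrFun (mat_mul_J4_mul_transpose g) 0) 2
  simp [Matrix.mul_apply, Fin.sum_univ_four, J4, h20, h21] at e02
  exact mu2_ne_zero g e02.symm

theorem detJ_ne_zero (g : GSp4) : detJ (Q (mat g)) ≠ 0 := fun h => by
  have := im_trN g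
  rw [h] at this
  simp at this
  rcases this with h | h
  · exact mu2_ne_zero g h
  · exact (sumJ_pos g).ne' h

theorem norm_detJ_le (W : M42) : ‖detJ W‖ ≤ sumJ W / 2 := by
  simp only [detJ, sumJ, Complex.normSq_eq_norm_sq]
  calc _ ≤ ‖W 2 0 * W 3 1‖ + ‖W 2 1 * W 3 0‖ := norm_sub_le _ _
    _ = ‖W 2 0‖ * ‖W 3 1‖ + ‖W 2 1‖ * ‖W 3 0‖ := by rw [norm_mul, norm_mul]
    _ ≤ _ := by nlinarith [sq_nonneg (‖W 2 0‖ - ‖W 3 1‖), sq_nonneg (‖W 2 1‖ - ‖W 3 0‖)]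

/-! #### Smoothness -/

/-- The order is left free: `n = ∞` serves smoothness on the group, `n = ω` analyticity on `K¹`. -/
theorem contDiff_Q (n : WithTop ℕ∞) (i : Fin 4) (j : Fin 2) :
    ContDiff ℝ n (fun M : M4 => Q M i j) := by
  have h : ∀ k, ContDiff ℝ n (fun M : M4 => ((M i k : ℝ) : ℂ)) := fun k =>
    Complex.ofRealCLM.contDiff.comp (entry i k).contDiff
  fin_cases j
  · simp only [Fin.zero_eta, fun M => (Q_entry M i).1]
    exact (h 2).add (contDiff_const.mul (h 0))
  · simp only [Fin.mk_one, fun M => (Q_entry M i).2]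
    exact (h 3).add (contDiff_const.mul (h 1))

theorem contDiff_detJ (n : WithTop ℕ∞) : ContDiff ℝ n (fun M : M4 => detJ (Q M)) :=
  ((contDiff_Q n 2 0).mul (contDiff_Q n 3 1)).sub ((contDiff_Q n 2 1).mul (contDiff_Q n 3 0))

theorem contDiff_trN (n : WithTop ℕ∞) : ContDiff ℝ n (fun M : M4 => trN (Q M)) :=
  ((((contDiff_Q n 0 0).mul (contDiff_Q n 3 1)).sub
    ((contDiff_Q n 0 1).mul (contDiff_Q n 3 0))).sub
    ((contDiff_Q n 1 0).mul (contDiff_Q n 2 1))).add ((contDiff_Q n 1 1).mul (contDiff_Q n 2 0))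

theorem contDiff_lowest (n : WithTop ℕ∞) (p q : ℕ) :
    ContDiff ℝ n (fun M : M4 => lowest p q (Q M)) :=
  (((contDiff_Q n 3 1).add (contDiff_const.mul (contDiff_Q n 2 1))).pow p).mul
    (((contDiff_Q n 3 1).sub (contDiff_const.mul (contDiff_Q n 2 1))).pow q)

theorem contDiff_mu (n : WithTop ℕ∞) :
    ContDiff ℝ n (fun M : M4 => (Mᵀ * J4 ℝ * M) 0 2) := by
  have h : (fun M : M4 => (Mᵀ * J4 ℝ * M) 0 2) = fun M : M4 =>
      M 0 0 * M 2 2 + M 1 0 * M 3 2 - M 2 0 * M 0 2 - M 3 0 * M 1 2 := by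
    funext M
    simp [J4, Matrix.mul_apply, Fin.sum_univ_four]
    ring
  have e : ∀ i j, ContDiff ℝ n (fun M : M4 => M i j) := fun i j => (entry i j).contDiff
  rw [h]
  exact ((((e 0 0).mul (e 2 2)).add ((e 1 0).mul (e 3 2))).sub ((e 2 0).mul (e 0 2))).sub
    ((e 3 0).mul (e 1 2))

/-- The sign of the multiplier is locally constant, so the cut-off does no harm. Where it is
positive, the complex power is the exponential of a real logarithm. -/
theorem isSmooth_explicit (κ : ℂ) (L p q : ℕ) : IsSmooth (explicit κ L (lowest p q)) := by
  intro g
  rcases lt_or_gt_of_ne (mu2_ne_zero g) with h | h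
  · refine ⟨{M | (Mᵀ * J4 ℝ * M) 0 2 < 0}, 0, isOpen_lt (contDiff_mu 0).continuous
      continuous_const, h, contDiffOn_const, fun y hy => ?_⟩
    have hy' : mu2 y < 0 := hy
    simp [explicit, hy'.le.not_gt]
  · refine ⟨{M | 0 < (Mᵀ * J4 ℝ * M) 0 2} ∩ {M | detJ (Q M) ≠ 0},
      fun M => Complex.exp ((Real.log ((Mᵀ * J4 ℝ * M) 0 2) : ℝ) * κ) * hol L (lowest p q) (Q M),
      (isOpen_lt continuous_const (contDiff_mu 0).continuous).inter
        (isOpen_ne_fun (contDiff_detJ 0).continuous continuous_const), ⟨h, detJ_ne_zero g⟩, ?_, ?_⟩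
    · refine ContDiffOn.mul ?_ (ContDiffOn.mul (ContDiffOn.mul (ContDiffOn.pow (ContDiffOn.inv
        (contDiff_detJ _).contDiffOn fun M hM => hM.2) L) (contDiff_lowest _ p q).contDiffOn) ?_)
      · exact ContDiffOn.cexp (ContDiffOn.mul (Complex.ofRealCLM.contDiff.comp_contDiffOn
          (ContDiffOn.log (contDiff_mu _).contDiffOn fun M hM => hM.1.ne')) contDiffOn_const)
      · simp only [div_eq_mul_inv]
        exact ContDiffOn.cexp (contDiffOn_const.mul ((contDiff_trN _).contDiffOn.mul
          (ContDiffOn.inv (contDiff_detJ _).contDiffOn fun M hM => hM.2)))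
    · intro y hy
      have hy1 : 0 < mu2 y := hy.1
      rw [explicit, if_pos hy1, Complex.cpow_def_of_ne_zero (by exact_mod_cast hy1.ne'),
        ← Complex.ofReal_log hy1.le]
      rfl

/-! #### Equivariance -/

/-- Let `t` correspond to `z ∈ ℂˣ`. It multiplies `μ` and `det J` by `|z|²`, the two linear forms
`J₁₁ ± iJ₀₁` by `z` and its conjugate, and preserves `tr τ`; a unipotent adds `tr X` to `tr τ`. The
condition `hκ` makes the total power of `|z|` equal to that of `Λ`. -/
theorem explicit_equivariant {κ s : ℂ} {L p q : ℕ} (hκ : 2 * κ = 2 * L - p - q + s)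
    {t : GL (Fin 2) ℝ} (ht : t ∈ T) (X : Matrix (Fin 2) (Fin 2) ℝ) (hX : X.IsSymm) (g : GSp4) :
    explicit κ L (lowest p q) (levi t * unip X hX * g) =
      Lam s (p - q) t * theta X * explicit κ L (lowest p q) g := by
  have hd0 := Matrix.GeneralLinearGroup.det_ne_zero t
  have ht' : (t : Matrix (Fin 2) (Fin 2) ℝ)ᵀ * S * (t : Matrix (Fin 2) (Fin 2) ℝ) =
    (t : Matrix (Fin 2) (Fin 2) ℝ).det • S := ht
  have ht2 : (t : Matrix (Fin 2) (Fin 2) ℝ).det • ((t : Matrix (Fin 2) (Fin 2) ℝ)⁻¹)ᵀ = t := by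
    have h1 : ((t : Matrix (Fin 2) (Fin 2) ℝ)⁻¹) =
        (t : Matrix (Fin 2) (Fin 2) ℝ).det⁻¹ • (t : Matrix (Fin 2) (Fin 2) ℝ)ᵀ := by
      apply Matrix.inv_eq_left_inv
      rw [S, Matrix.mul_one] at ht'
      rw [Matrix.smul_mul, ht', smul_smul, inv_mul_cancel₀ hd0, one_smul]
    rw [h1, Matrix.transpose_smul, Matrix.transpose_transpose, smul_smul, mul_inv_cancel₀ hd0,
      one_smul]
  have hL : mat (levi t) = blk t 0 0 t := by
    rw [levi, mat_mkGSp, ht2]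
  have hμL : mu2 (levi t) = (t : Matrix (Fin 2) (Fin 2) ℝ).det := by rw [levi, mu2_mkGSp]
  have hμX : mu2 (unip X hX) = 1 := by rw [unip, mu2_mkGSp]
  have hent : (t : Matrix (Fin 2) (Fin 2) ℝ) 1 1 = (t : Matrix (Fin 2) (Fin 2) ℝ) 0 0 ∧
      (t : Matrix (Fin 2) (Fin 2) ℝ) 1 0 = -(t : Matrix (Fin 2) (Fin 2) ℝ) 0 1 := by
    have h2 := ht2
    rw [Matrix.inv_def, Ring.inverse_eq_inv', Matrix.transpose_smul, smul_smul,
      mul_inv_cancel₀ hd0, one_smul, Matrix.adjugate_fin_two] at h2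
    have a := congrFun (congrFun h2 0) 0
    have b := congrFun (congrFun h2 1) 0
    simp at a b
    exact ⟨a, b.symm⟩
  set x := (t : Matrix (Fin 2) (Fin 2) ℝ) 0 0 with hx
  set y := (t : Matrix (Fin 2) (Fin 2) ℝ) 0 1 with hy
  have hdet : (t : Matrix (Fin 2) (Fin 2) ℝ).det = x ^ 2 + y ^ 2 := by
    rw [Matrix.det_fin_two, hent.1, hent.2]; ring
  have hτ : toC t = x + y * I := rfl
  set τ : ℂ := toC t with hτdef
  have hnorm : ‖τ‖ ^ 2 = x ^ 2 + y ^ 2 := by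
    rw [← Complex.normSq_eq_norm_sq, hτ, Complex.normSq_add_mul_I]
  have hdpos : 0 < x ^ 2 + y ^ 2 := lt_of_le_of_ne (by positivity) (by rw [← hdet]; exact hd0.symm)
  have hτ0 : 0 < ‖τ‖ := by
    refine lt_of_le_of_ne (norm_nonneg _) fun h => ?_
    rw [← h] at hnorm
    simp at hnorm
    linarith
  have h01 : X 1 0 = X 0 1 := hX.apply 0 1
  set g' := levi t * unip X hX * g with hg'
  have hμ : mu2 g' = ‖τ‖ ^ 2 * mu2 g := by
    rw [hg', mu2_mul, mu2_mul, hμL, hμX, hdet, hnorm, mul_one]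
  have hrow : ∀ j, Q (mat g') 2 j = x * Q (mat g) 2 j + y * Q (mat g) 3 j ∧
      Q (mat g') 3 j = -y * Q (mat g) 2 j + x * Q (mat g) 3 j ∧
      Q (mat g') 0 j = x * (Q (mat g) 0 j + X 0 0 * Q (mat g) 2 j + X 0 1 * Q (mat g) 3 j) +
        y * (Q (mat g) 1 j + X 0 1 * Q (mat g) 2 j + X 1 1 * Q (mat g) 3 j) ∧
      Q (mat g') 1 j = -y * (Q (mat g) 0 j + X 0 0 * Q (mat g) 2 j + X 0 1 * Q (mat g) 3 j) +
        x * (Q (mat g) 1 j + X 0 1 * Q (mat g) 2 j + X 1 1 * Q (mat g) 3 j) := fun j => by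
    have hQ : Q (mat g') = cx (blk t 0 0 t) * (cx (blk 1 X 0 1) * Q (mat g)) := by
      rw [hg', Q, mat_mul, mat_mul, hL, unip, mat_mkGSp, cx_mul, cx_mul, Q]
      simp only [Matrix.mul_assoc]
    rw [hQ]
    generalize Q (mat g) = W
    refine ⟨?_, ?_, ?_, ?_⟩ <;>
      simp [blk, Matrix.mul_apply, Fin.sum_univ_four, h01, hent.1, hent.2, ← hx, ← hy]
  have hdJ : detJ (Q (mat g')) = (‖τ‖ ^ 2 : ℝ) * detJ (Q (mat g)) := by
    rw [hnorm]
    simp only [detJ, fun j => (hrow j).1, fun j => (hrow j).2.1]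
    push_cast
    ring
  have htr : trN (Q (mat g')) =
      (‖τ‖ ^ 2 : ℝ) * (trN (Q (mat g)) + X.trace * detJ (Q (mat g))) := by
    rw [hnorm]
    simp only [trN, detJ, fun j => (hrow j).1, fun j => (hrow j).2.1, fun j => (hrow j).2.2.1,
      fun j => (hrow j).2.2.2, Matrix.trace_fin_two]
    push_cast
    ring
  have hlow : lowest p q (Q (mat g')) = τ ^ p * conj τ ^ q * lowest p q (Q (mat g)) := by
    have hc : conj τ = x - y * I := by rw [hτ]; simp [sub_eq_add_neg]
    have hp : Q (mat g') 3 1 + I * Q (mat g') 2 1 =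
        τ * (Q (mat g) 3 1 + I * Q (mat g) 2 1) := by
      rw [(hrow 1).1, (hrow 1).2.1, hτ]
      linear_combination (-y * Q (mat g) 2 1) * Complex.I_sq
    have hq : Q (mat g') 3 1 - I * Q (mat g') 2 1 =
        conj τ * (Q (mat g) 3 1 - I * Q (mat g) 2 1) := by
      rw [(hrow 1).1, (hrow 1).2.1, hc]
      linear_combination (-y * Q (mat g) 2 1) * Complex.I_sq
    rw [lowest, hp, hq, mul_pow, mul_pow, lowest]
    ring
  have hτc : (‖τ‖ : ℂ) ≠ 0 := by exact_mod_cast hτ0.ne'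
  have hnn : τ * conj τ = (‖τ‖ : ℂ) ^ 2 := by
    rw [Complex.mul_conj, Complex.normSq_eq_norm_sq]; push_cast; rfl
  unfold explicit
  by_cases hg : 0 < mu2 g
  · have hg'' : 0 < mu2 g' := by rw [hμ]; positivity
    rw [if_pos hg, if_pos hg'', hμ, Complex.ofReal_mul,
      Complex.mul_cpow_ofReal_nonneg (by positivity) hg.le]
    simp only [hol]
    rw [hdJ, htr, hlow]
    have hD := detJ_ne_zero g
    have hE : ((‖τ‖ ^ 2 : ℝ) : ℂ) * (trN (Q (mat g)) + X.trace * detJ (Q (mat g))) /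
        (((‖τ‖ ^ 2 : ℝ) : ℂ) * detJ (Q (mat g))) =
        X.trace + trN (Q (mat g)) / detJ (Q (mat g)) := by
      push_cast
      field_simp
      ring
    rw [hE, mul_add, Complex.exp_add]
    have hth : theta X = Complex.exp (2 * Real.pi * I * X.trace) := by
      rw [theta]
      simp [S]
    rw [hth]
    have hLam : ((‖τ‖ ^ 2 : ℝ) : ℂ) ^ κ * ((((‖τ‖ ^ 2 : ℝ) : ℂ))⁻¹ ^ L * (τ ^ p * conj τ ^ q)) =
        Lam s (p - q) t := by
      have hτn : τ ≠ 0 := norm_pos_iff.1 hτ0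
      have hcτ : conj τ = (‖τ‖ : ℂ) ^ 2 / τ := by
        rw [← hnn]; field_simp
      have e1 : ((‖τ‖ ^ 2 : ℝ) : ℂ) ^ κ =
          (‖τ‖ : ℂ) ^ s * (‖τ‖ : ℂ) ^ (2 * L) / ((‖τ‖ : ℂ) ^ (p + q)) := by
        have e2 : ((‖τ‖ ^ 2 : ℝ) : ℂ) ^ κ = (‖τ‖ : ℂ) ^ (2 * κ) := by
          rw [two_mul, Complex.cpow_add _ _ hτc, ← Complex.mul_cpow_ofReal_nonneg hτ0.le hτ0.le]
          push_cast
          rw [sq]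
        rw [e2, hκ, show (2 * L - p - q + s : ℂ) = s + ((2 * L : ℕ) : ℂ) - ((p + q : ℕ) : ℂ) by
          push_cast; ring, Complex.cpow_sub _ _ hτc, Complex.cpow_add _ _ hτc,
          Complex.cpow_natCast, Complex.cpow_natCast]
      rw [e1, hcτ, Lam, ← hτdef, zpow_sub₀ (div_ne_zero hτn hτc), zpow_natCast, zpow_natCast]
      push_cast
      simp only [div_pow, inv_pow, pow_add, pow_mul]
      field_simp
      ring
    rw [← hLam, mul_inv, mul_pow]
    ring
  · have hg'' : ¬ 0 < mu2 g' := by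
      rw [hμ]
      have : 0 < ‖τ‖ ^ 2 := by positivity
      nlinarith
    rw [if_neg hg, if_neg hg'', mul_zero]

/-! #### The action of the Lie algebra -/

/-- The linear map `Q`, as a continuous linear map. -/
def QL : M4 →L[ℝ] M42 :=
  LinearMap.toContinuousLinearMap
    { toFun := Q
      map_add' := fun A B => by
        rw [Q, Q, Q, ← Matrix.add_mul]; congr 1; ext i j; simp
      map_smul' := fun c A => by
        rw [Q, Q, RingHom.id_apply, ← Matrix.smul_mul]; congr 1; ext i j; simp }

/-- The entry of a `4 × 2` matrix as a continuous linear map. -/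
def entry42 (i : Fin 4) (j : Fin 2) : M42 →L[ℂ] ℂ :=
  LinearMap.toContinuousLinearMap
    { toFun := fun M => M i j, map_add' := fun _ _ => rfl, map_smul' := fun _ _ => rfl }

theorem differentiableAt_hol (L p q : ℕ) {W : M42} (h : detJ W ≠ 0) :
    DifferentiableAt ℂ (hol L (lowest p q)) W := by
  have e : ∀ i j, DifferentiableAt ℂ (fun W : M42 => W i j) W := fun i j =>
    (entry42 i j).differentiableAt
  have hd : DifferentiableAt ℂ detJ W := ((e 2 0).mul (e 3 1)).sub ((e 2 1).mul (e 3 0))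
  have ht : DifferentiableAt ℂ trN W :=
    ((((e 0 0).mul (e 3 1)).sub ((e 0 1).mul (e 3 0))).sub ((e 1 0).mul (e 2 1))).add
      ((e 1 1).mul (e 2 0))
  have hl : DifferentiableAt ℂ (lowest p q) W :=
    (((e 3 1).add ((e 2 1).const_mul I)).pow p).mul (((e 3 1).sub ((e 2 1).const_mul I)).pow q)
  have hq : DifferentiableAt ℂ (fun W => trN W / detJ W) W := by
    simp only [div_eq_mul_inv]
    exact ht.mul (hd.inv h)
  exact (((hd.inv h).pow L).mul hl).mul (hq.const_mul _).cexp

/-- The multiplier is constant along one-parameter subgroups of `Sp(4,ℝ)`, and the rest is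
holomorphic in `Q`. Since the differential is complex-linear, a complex `X` acts simply through `X *
V`. -/
theorem lieAct_explicit (κ : ℂ) {L : ℕ} {f : M42 → ℂ} {g : GSp4} {D : M42 →L[ℂ] ℂ}
    (hD : HasFDerivAt (hol L f) D (Q (mat g))) (X : sp4 ℂ) :
    lieAct X (explicit κ L f) g =
      (if 0 < mu2 g then (mu2 g : ℂ) ^ κ else 0) * D (cx (mat g) * ((X : M4C) * V)) := by
  have hμ : ∀ Y : sp4 ℝ, mu2 (g * expSp Y) = mu2 g := fun Y => by
    rw [mu2_mul, expSp, mu2_mkGSp, mul_one]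
  have key : ∀ Y : sp4 ℝ, lieDeriv Y (explicit κ L f) g =
      (if 0 < mu2 g then (mu2 g : ℂ) ^ κ else 0) * D (Q (mat g * (Y : M4))) := fun Y => by
    have h1 : HasDerivAt (fun t : ℝ => Q (mat (g * expSp (t • Y)))) (Q (mat g * (Y : M4))) 0 :=
      QL.hasFDerivAt.comp_hasDerivAt 0 (hasDerivAt_mul_expSp g Y)
    have h0 : g = g * expSp ((0 : ℝ) • Y) := by
      ext; simp [expSp, mkGSp]
    have hD' := hD.restrictScalars ℝ
    rw [h0] at hD'
    have h2 := (HasFDerivAt.comp_hasDerivAt (0 : ℝ) hD' h1).const_mul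
      (if 0 < mu2 g then (mu2 g : ℂ) ^ κ else 0)
    refine Eq.trans (congrArg (fun F : ℝ → ℂ => deriv F 0) (funext fun t => ?_)) h2.deriv
    simp only [explicit, hμ, Function.comp_apply]
    split_ifs <;> simp
  have h1 : cx (mat g) * ((X : M4C) * V) = Q (mat g * (rePart X : M4)) +
      I • Q (mat g * (imPart X : M4)) := by
    have hX : (X : M4C) = cx (rePart X : M4) + I • cx (imPart X : M4) := by
      ext i j
      simp only [rePart, imPart, Matrix.add_apply, Matrix.smul_apply, Matrix.map_apply,
        smul_eq_mul, Complex.ofRealHom_eq_coe]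
      rw [mul_comm, Complex.re_add_im]
    conv_lhs => rw [hX]
    simp only [Q, cx_mul, Matrix.add_mul, Matrix.mul_add, Matrix.smul_mul, Matrix.mul_smul,
      Matrix.mul_assoc]
  rw [lieAct, key, key, h1, map_add, map_smul, smul_eq_mul]
  ring

/-- `lowest` involves only the second column of `J`, which a lower triangular matrix multiplies by
`d`; `tr τ` is unchanged. Both weights and the vanishing under `N₊` are special cases. -/
theorem hol_mul_lower (L p q : ℕ) (W : M42) {a c d : ℂ} (ha : a ≠ 0) (hd : d ≠ 0) :
    hol L (lowest p q) (W * !![a, 0; c, d]) =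
      (a * d)⁻¹ ^ L * d ^ (p + q) * hol L (lowest p q) W := by
  have h0 : ∀ i, (W * !![a, 0; c, d]) i 0 = W i 0 * a + W i 1 * c := fun i => by
    simp [Matrix.mul_apply, Fin.sum_univ_two]
  have h1 : ∀ i, (W * !![a, 0; c, d]) i 1 = W i 1 * d := fun i => by
    simp [Matrix.mul_apply, Fin.sum_univ_two]
  have e1 : detJ (W * !![a, 0; c, d]) = (a * d) * detJ W := by
    simp only [detJ, h0, h1]; ring
  have e2 : trN (W * !![a, 0; c, d]) = (a * d) * trN W := by
    simp only [trN, h0, h1]; ring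
  have e3 : lowest p q (W * !![a, 0; c, d]) = d ^ (p + q) * lowest p q W := by
    have ep : W 3 1 * d + I * (W 2 1 * d) = d * (W 3 1 + I * W 2 1) := by ring
    have eq : W 3 1 * d - I * (W 2 1 * d) = d * (W 3 1 - I * W 2 1) := by ring
    simp only [lowest, h1, ep, eq, mul_pow, pow_add]
    ring
  rw [hol, e1, e2, e3, mul_div_mul_left _ _ (mul_ne_zero ha hd), hol, mul_inv _ (detJ W), mul_pow]
  ring

theorem hasDerivAt_weight (L n : ℕ) :
    HasDerivAt (fun s : ℂ => (1 - s)⁻¹ ^ L * (1 - s) ^ n) (L - n) 0 := by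
  have h1 : HasDerivAt (fun s : ℂ => 1 - s) (-1) 0 := by
    simpa using (hasDerivAt_id (0 : ℂ)).const_sub 1
  have h2 := ((h1.fun_inv (by simp)).fun_pow L).fun_mul (h1.fun_pow n)
  simpa [sub_eq_add_neg] using h2

/-- `Z`, `Z'` and `N₊` act on `V` through lower triangular matrices `A`, so `hol_mul_lower` applies
to the curve `1 + sA`. The elements of `𝔭⁻` annihilate `V`. -/
theorem explicit_lie (κ : ℂ) (L p q : ℕ) :
    lieAct Z (explicit κ L (lowest p q)) = (L : ℂ) • explicit κ L (lowest p q) ∧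
    lieAct Z' (explicit κ L (lowest p q)) = (L - p - q : ℂ) • explicit κ L (lowest p q) ∧
    lieAct Nplus (explicit κ L (lowest p q)) = 0 ∧
    lieAct Xminus (explicit κ L (lowest p q)) = 0 ∧
    lieAct P1minus (explicit κ L (lowest p q)) = 0 ∧
    lieAct P0minus (explicit κ L (lowest p q)) = 0 := by
  have hD : ∀ g : GSp4, HasFDerivAt (hol L (lowest p q))
      (fderiv ℂ (hol L (lowest p q)) (Q (mat g))) (Q (mat g)) := fun g =>
    (differentiableAt_hol L p q (detJ_ne_zero g)).hasFDerivAt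
  have hcurve : ∀ (g : GSp4) (A : Matrix (Fin 2) (Fin 2) ℂ) (F : ℂ → ℂ) (F' : ℂ),
      HasDerivAt F F' 0 → (∀ᶠ s in nhds (0 : ℂ), hol L (lowest p q) (Q (mat g) * (1 + s • A)) =
        F s * hol L (lowest p q) (Q (mat g))) →
      fderiv ℂ (hol L (lowest p q)) (Q (mat g)) (Q (mat g) * A) =
        F' * hol L (lowest p q) (Q (mat g)) := fun g A F F' hF hs => by
    have h1 : HasDerivAt (fun s : ℂ => Q (mat g) * (1 + s • A)) (Q (mat g) * A) 0 := by
      have := ((hasDerivAt_id (0 : ℂ)).smul_const (Q (mat g) * A)).const_add (Q (mat g))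
      simp only [one_smul, id] at this
      refine this.congr_of_eventuallyEq (Filter.Eventually.of_forall fun s => ?_)
      simp [Matrix.mul_add]
    have h2 := hD g
    have e0 : Q (mat g) * (1 + (0 : ℂ) • A) = Q (mat g) := by simp
    have h3 : HasFDerivAt (hol L (lowest p q)) (fderiv ℂ (hol L (lowest p q)) (Q (mat g)))
      (Q (mat g) * (1 + (0 : ℂ) • A)) := by rw [e0]; exact h2
    have h4 := (HasFDerivAt.comp_hasDerivAt (0 : ℂ) h3 h1)
    exact h4.unique ((hF.mul_const _).congr_of_eventuallyEq hs)
  have hne : ∀ᶠ s in nhds (0 : ℂ), 1 - s ≠ 0 := by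
    have : ContinuousAt (fun s : ℂ => 1 - s) 0 := by fun_prop
    exact this.eventually_ne (by simp)
  have hsmul : ∀ (c : ℂ) (X : sp4 ℂ), (∀ g : GSp4, fderiv ℂ (hol L (lowest p q)) (Q (mat g))
      (cx (mat g) * ((X : M4C) * V)) = c * hol L (lowest p q) (Q (mat g))) →
      lieAct X (explicit κ L (lowest p q)) = c • explicit κ L (lowest p q) := fun c X h => by
    funext g
    rw [lieAct_explicit κ (hD g), h, Pi.smul_apply, explicit, smul_eq_mul]
    split_ifs <;> ring
  have hzero : ∀ X : sp4 ℂ, (X : M4C) * V = 0 → lieAct X (explicit κ L (lowest p q)) = 0 :=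
    fun X h => by
      rw [hsmul 0 X fun g => by rw [h]; simp, zero_smul]
  refine ⟨hsmul _ _ fun g => ?_, hsmul _ _ fun g => ?_, ?_, hzero _ ?_, hzero _ ?_, hzero _ ?_⟩
  · have hV : (Z : M4C) * V = V * (!![-1, 0; 0, 0] : Matrix (Fin 2) (Fin 2) ℂ) := by
      ext i j
      fin_cases i <;> fin_cases j <;>
        simp [Z, V, Matrix.mul_apply, Fin.sum_univ_four, Fin.sum_univ_two]
    rw [hV, ← Matrix.mul_assoc]
    refine (hcurve g _ _ _ (hasDerivAt_weight L 0) ?_).trans (by simp)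
    filter_upwards [hne] with s hs
    have : (1 + s • !![-1, 0; 0, 0] : Matrix (Fin 2) (Fin 2) ℂ) = !![1 - s, 0; 0, 1] := by
      ext i j
      fin_cases i <;> fin_cases j <;> simp [sub_eq_add_neg]
    rw [this, hol_mul_lower _ _ _ _ hs one_ne_zero]
    simp
  · have hV : (Z' : M4C) * V = V * (!![0, 0; 0, -1] : Matrix (Fin 2) (Fin 2) ℂ) := by
      ext i j
      fin_cases i <;> fin_cases j <;>
        simp [Z', V, Matrix.mul_apply, Fin.sum_univ_four, Fin.sum_univ_two]
    rw [hV, ← Matrix.mul_assoc]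
    refine (hcurve g _ _ _ (hasDerivAt_weight L (p + q)) ?_).trans (by push_cast; ring)
    filter_upwards [hne] with s hs
    have : (1 + s • !![0, 0; 0, -1] : Matrix (Fin 2) (Fin 2) ℂ) = !![1, 0; 0, 1 - s] := by
      ext i j
      fin_cases i <;> fin_cases j <;> simp [sub_eq_add_neg]
    rw [this, hol_mul_lower _ _ _ _ one_ne_zero hs, one_mul]
  · have hV : (Nplus : M4C) * V = V * (!![0, 0; -1, 0] : Matrix (Fin 2) (Fin 2) ℂ) := by
      ext i j
      fin_cases i <;> fin_cases j <;>
        simp [Nplus, V, Matrix.mul_apply, Fin.sum_univ_four, Fin.sum_univ_two] <;> ring_nf <;>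
        simp [Complex.I_sq] <;> ring
    rw [hsmul 0 Nplus fun g => ?_, zero_smul]
    rw [hV, ← Matrix.mul_assoc]
    refine hcurve g _ (fun _ => 1) _ (hasDerivAt_const _ _) (Filter.Eventually.of_forall fun s => ?_)
    have : (1 + s • !![0, 0; -1, 0] : Matrix (Fin 2) (Fin 2) ℂ) = !![1, 0; -s, 1] := by
      ext i j
      fin_cases i <;> fin_cases j <;> simp
    rw [this, hol_mul_lower _ _ _ _ one_ne_zero one_ne_zero]
    simp
  · ext i j
    fin_cases i <;> fin_cases j <;> simp [Xminus, V, Matrix.mul_apply, Fin.sum_univ_four, mul_assoc]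
  · ext i j
    fin_cases i <;> fin_cases j <;> simp [P1minus, V, Matrix.mul_apply, Fin.sum_univ_four, mul_assoc]
  · ext i j
    fin_cases i <;> fin_cases j <;> simp [P0minus, V, Matrix.mul_apply, Fin.sum_univ_four, mul_assoc]

/-! #### Growth -/

theorem sq_mat_le (g : GSp4) : (mu2 g ^ 2)⁻¹ + ∑ i, ∑ j, (mat g i j) ^ 2 = gnorm g ^ 2 := by
  rw [gnorm, Real.sq_sqrt (by positivity)]

theorem normSq_Q_le (g : GSp4) (i : Fin 4) (j : Fin 2) :
    normSq (Q (mat g) i j) ≤ gnorm g ^ 2 := by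
  rw [← sq_mat_le]
  have h0 : 0 ≤ (mu2 g ^ 2)⁻¹ := by positivity
  have h1 : ∑ j, (mat g i j) ^ 2 ≤ ∑ i, ∑ j, (mat g i j) ^ 2 :=
    Finset.single_le_sum (f := fun i => ∑ j, (mat g i j) ^ 2)
      (fun i _ => Finset.sum_nonneg fun j _ => sq_nonneg _) (Finset.mem_univ i)
  rw [Fin.sum_univ_four] at h1
  have s0 := sq_nonneg (mat g i 0)
  have s1 := sq_nonneg (mat g i 1)
  have s2 := sq_nonneg (mat g i 2)
  have s3 := sq_nonneg (mat g i 3)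
  fin_cases j
  · simp only [Fin.zero_eta, (Q_entry _ _).1]
    rw [mul_comm, Complex.normSq_add_mul_I]
    linarith
  · simp only [Fin.mk_one, (Q_entry _ _).2]
    rw [mul_comm, Complex.normSq_add_mul_I]
    linarith

theorem mu2_le (g : GSp4) : mu2 g ≤ gnorm g ^ 2 := by
  rw [← sq_mat_le]
  have h3 : mu2 g = mat g 0 0 * mat g 2 2 + mat g 1 0 * mat g 3 2
      - mat g 2 0 * mat g 0 2 - mat g 3 0 * mat g 1 2 := by
    simp [mu2, J4, Matrix.mul_apply, Fin.sum_univ_four]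
    ring
  have h0 : 0 ≤ (mu2 g ^ 2)⁻¹ := by positivity
  have h4 : 2 * mu2 g ≤ ∑ i, ∑ j, (mat g i j) ^ 2 := by
    simp only [Fin.sum_univ_four]
    rw [h3]
    linarith [sq_nonneg (mat g 0 0 - mat g 2 2), sq_nonneg (mat g 1 0 - mat g 3 2),
      sq_nonneg (mat g 2 0 + mat g 0 2), sq_nonneg (mat g 3 0 + mat g 1 2),
      sq_nonneg (mat g 0 1), sq_nonneg (mat g 0 3), sq_nonneg (mat g 1 1),
      sq_nonneg (mat g 1 3), sq_nonneg (mat g 2 1), sq_nonneg (mat g 2 3),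
      sq_nonneg (mat g 3 1), sq_nonneg (mat g 3 3)]
  have h5 : 0 ≤ ∑ i, ∑ j, (mat g i j) ^ 2 := by positivity
  linarith

theorem mu2_inv_le (g : GSp4) : (mu2 g)⁻¹ ≤ gnorm g := by
  rw [gnorm]
  apply Real.le_sqrt_of_sq_le
  have h5 : 0 ≤ ∑ i, ∑ j, (mat g i j) ^ 2 := by positivity
  rw [inv_pow]
  linarith

theorem mu2_rpow_le (g : GSp4) (h : 0 < mu2 g) (r : ℝ) :
    mu2 g ^ r ≤ gnorm g ^ (2 * |r|) := by
  have h1 := one_le_gnorm g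
  rcases le_total 0 r with hr | hr
  · rw [abs_of_nonneg hr, Real.rpow_mul (by linarith), Real.rpow_two]
    exact Real.rpow_le_rpow h.le (mu2_le g) hr
  · rw [abs_of_nonpos hr]
    calc mu2 g ^ r = (mu2 g)⁻¹ ^ (-r) := by rw [Real.inv_rpow h.le, Real.rpow_neg h.le, inv_inv]
      _ ≤ gnorm g ^ (-r) := Real.rpow_le_rpow (by positivity) (mu2_inv_le g) (by linarith)
      _ ≤ _ := Real.rpow_le_rpow_of_exponent_le h1 (by linarith)

theorem norm_lowest_le (p q : ℕ) (g : GSp4) :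
    ‖lowest p q (Q (mat g))‖ ≤ (2 * gnorm g) ^ (p + q) := by
  have h1 := one_le_gnorm g
  have hQ : ∀ i, ‖Q (mat g) i 1‖ ≤ gnorm g := fun i => by
    have := normSq_Q_le g i 1
    rw [Complex.normSq_eq_norm_sq] at this
    exact le_of_sq_le_sq this (by linarith)
  have hp : ‖Q (mat g) 3 1 + I * Q (mat g) 2 1‖ ≤ 2 * gnorm g := by
    refine (norm_add_le _ _).trans ?_
    rw [norm_mul, Complex.norm_I, one_mul]
    linarith [hQ 2, hQ 3]
  have hq : ‖Q (mat g) 3 1 - I * Q (mat g) 2 1‖ ≤ 2 * gnorm g := by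
    refine (norm_sub_le _ _).trans ?_
    rw [norm_mul, Complex.norm_I, one_mul]
    linarith [hQ 2, hQ 3]
  rw [lowest, norm_mul, norm_pow, norm_pow, pow_add]
  gcongr

/-- The power `det(J)^{-L}` alone is unbounded as `det J` tends to `0`. From `im_trN` and
`norm_detJ_le`, `Im tr τ ≥ 2x` with `x = μ/|det J|`, so the product is at most `x^L e^{-x} μ^{-L}`,
and `x^L ≤ L! e^x`. -/
theorem norm_hol_factor_le (L : ℕ) (g : GSp4) (h : 0 < mu2 g) :
    ‖(detJ (Q (mat g)))⁻¹ ^ L *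
      Complex.exp (2 * Real.pi * I * (trN (Q (mat g)) / detJ (Q (mat g))))‖ ≤
      L.factorial * (mu2 g)⁻¹ ^ L := by
  have hd := detJ_ne_zero g
  have him := im_trN g
  have hle := norm_detJ_le (Q (mat g))
  set d := detJ (Q (mat g)) with hdd
  set t := trN (Q (mat g)) with ht
  have hd0 : 0 < ‖d‖ := norm_pos_iff.2 hd
  set x := mu2 g / ‖d‖ with hx
  have hx0 : 0 < x := by positivity
  have him2 : (t / d).im = mu2 g * sumJ (Q (mat g)) / ‖d‖ ^ 2 := by
    rw [← him, div_eq_mul_inv, Complex.inv_def, Complex.normSq_eq_norm_sq, ← mul_assoc,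
      Complex.im_mul_ofReal, div_eq_mul_inv]
  have hxle : x ≤ 2 * Real.pi * (t / d).im := by
    have h1 : 2 * x ≤ (t / d).im := by
      rw [him2, hx, ← mul_div_assoc, div_le_div_iff₀ hd0 (by positivity)]
      have : mu2 g * (2 * ‖d‖) * ‖d‖ ≤ mu2 g * sumJ (Q (mat g)) * ‖d‖ := by
        gcongr
        linarith
      linarith
    have hpi := Real.pi_gt_three
    nlinarith
  have hre : (2 * Real.pi * I * (t / d)).re = -(2 * Real.pi * (t / d).im) := by
    simp
  rw [norm_mul, norm_pow, norm_inv, Complex.norm_exp, hre]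
  calc ‖d‖⁻¹ ^ L * Real.exp (-(2 * Real.pi * (t / d).im))
      ≤ ‖d‖⁻¹ ^ L * Real.exp (-x) := by gcongr
    _ = (x ^ L * Real.exp (-x)) * (mu2 g)⁻¹ ^ L := by
        rw [hx, div_pow, inv_pow, inv_pow]; field_simp
    _ ≤ L.factorial * (mu2 g)⁻¹ ^ L := by
        gcongr
        have := Real.pow_div_factorial_le_exp x hx0.le L
        rw [Real.exp_neg, ← div_eq_mul_inv, div_le_iff₀ (Real.exp_pos x)]
        rw [div_le_iff₀ (by positivity)] at this
        linarith

theorem slowlyIncreasing_explicit (κ : ℂ) (L p q : ℕ) :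
    SlowlyIncreasing (explicit κ L (lowest p q)) := by
  -- The final `1` only keeps the exponent positive.
  refine ⟨L.factorial * 2 ^ (p + q), 2 * |κ.re| + L + (p + q : ℕ) + 1, by positivity,
    by positivity, fun g => ?_⟩
  have h1 := one_le_gnorm g
  have hg0 : 0 < gnorm g := by linarith
  by_cases h : 0 < mu2 g
  · rw [explicit, if_pos h, hol, norm_mul, Complex.norm_cpow_eq_rpow_re_of_pos h,
      mul_right_comm, norm_mul]
    calc mu2 g ^ κ.re * (_ * ‖lowest p q (Q (mat g))‖)
        ≤ gnorm g ^ (2 * |κ.re|) * ((L.factorial * gnorm g ^ L) * (2 * gnorm g) ^ (p + q)) := by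
          gcongr
          · exact mu2_rpow_le g h _
          · refine (norm_hol_factor_le L g h).trans ?_
            gcongr
            exact mu2_inv_le g
          · exact norm_lowest_le p q g
      _ = L.factorial * 2 ^ (p + q) * gnorm g ^ (2 * |κ.re| + L + (p + q : ℕ)) := by
          rw [Real.rpow_add hg0, Real.rpow_add hg0, Real.rpow_natCast, Real.rpow_natCast, mul_pow]
          ring
      _ ≤ _ := mul_le_mul_of_nonneg_left
          (Real.rpow_le_rpow_of_exponent_le h1 (by linarith)) (by positivity)
  · rw [explicit, if_neg h, norm_zero]
    positivity

/-! #### `K`-finiteness -/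

/-- The monomials spanning the space of right translates of `lowest p q` under `U(2)`. -/
def mono (p q i j : ℕ) (W : M42) : ℂ :=
  (W 3 0 + I * W 2 0) ^ i * (W 3 1 + I * W 2 1) ^ (p - i) *
    ((W 3 0 - I * W 2 0) ^ j * (W 3 1 - I * W 2 1) ^ (q - j))

theorem hol_mul (L : ℕ) (f : M42 → ℂ) (W : M42) {M : Matrix (Fin 2) (Fin 2) ℂ} (hM : M.det ≠ 0) :
    hol L f (W * M) = M.det⁻¹ ^ L * ((detJ W)⁻¹ ^ L * f (W * M) *
      Complex.exp (2 * Real.pi * I * (trN W / detJ W))) := by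
  have h : ∀ i j, (W * M) i j = W i 0 * M 0 j + W i 1 * M 1 j := fun i j => by
    simp [Matrix.mul_apply, Fin.sum_univ_two]
  have e1 : detJ (W * M) = M.det * detJ W := by
    simp only [detJ, h, Matrix.det_fin_two]; ring
  have e2 : trN (W * M) = M.det * trN W := by
    simp only [trN, h, Matrix.det_fin_two]; ring
  rw [hol, e1, e2, mul_div_mul_left _ _ hM, mul_inv, mul_pow]
  ring

theorem lowest_mul (p q : ℕ) (W : M42) (M : Matrix (Fin 2) (Fin 2) ℂ) :
    lowest p q (W * M) = ∑ i ∈ Finset.range (p + 1), ∑ j ∈ Finset.range (q + 1),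
      (M 0 1 ^ i * M 1 1 ^ (p - i) * p.choose i * (M 0 1 ^ j * M 1 1 ^ (q - j) * q.choose j)) *
        mono p q i j W := by
  have h : ∀ i, (W * M) i 1 = W i 0 * M 0 1 + W i 1 * M 1 1 := fun i => by
    simp [Matrix.mul_apply, Fin.sum_univ_two]
  have hp : (W * M) 3 1 + I * (W * M) 2 1 =
      (W 3 0 + I * W 2 0) * M 0 1 + (W 3 1 + I * W 2 1) * M 1 1 := by rw [h, h]; ring
  have hq : (W * M) 3 1 - I * (W * M) 2 1 =
      (W 3 0 - I * W 2 0) * M 0 1 + (W 3 1 - I * W 2 1) * M 1 1 := by rw [h, h]; ring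
  rw [lowest, hp, hq, add_pow, add_pow, Finset.sum_mul_sum]
  refine Finset.sum_congr rfl fun i _ => Finset.sum_congr rfl fun j _ => ?_
  simp only [mono, mul_pow]
  ring

/-- An orthogonal symplectic matrix commutes with the symplectic form, hence preserves its
eigenspace spanned by the columns of `V`. -/
theorem cx_mul_V_of_mem {k : GSp4} (hk : k ∈ K) (h1 : mu2 k = 1) :
    cx (mat k) * V = V * Jm (mat k) := by
  have hO : (mat k)ᵀ * mat k = 1 := hk
  have hS := mat_mem k
  rw [h1, one_smul] at hS
  have hc : J4 ℝ * mat k = mat k * J4 ℝ := by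
    have h2 := mul_eq_one_comm.mp hO
    calc J4 ℝ * mat k = (mat k * (mat k)ᵀ) * J4 ℝ * mat k := by rw [h2, Matrix.one_mul]
      _ = mat k * ((mat k)ᵀ * J4 ℝ * mat k) := by simp only [Matrix.mul_assoc]
      _ = _ := by rw [hS]
  have e : ∀ i j, (J4 ℝ * mat k) i j = (mat k * J4 ℝ) i j := fun i j => by rw [hc]
  have e00 := e 0 0
  have e01 := e 0 1
  have e10 := e 1 0
  have e11 := e 1 1
  have e02 := e 0 2
  have e03 := e 0 3
  have e12 := e 1 2
  have e13 := e 1 3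
  simp [Matrix.mul_apply, Fin.sum_univ_four, J4] at e00 e01 e10 e11 e02 e03 e12 e13
  rw [Jm_apply]
  ext i j
  fin_cases i <;> fin_cases j <;>
    simp [V, Matrix.mul_apply, Fin.sum_univ_four, Fin.sum_univ_two, e00, e01, e10, e11, e02, e03,
      e12, e13] <;> ring_nf <;> simp [Complex.I_sq]

theorem Q_mul_of_mem (g : GSp4) {k : GSp4} (hk : k ∈ K) (h1 : mu2 k = 1) :
    Q (mat (g * k)) = Q (mat g) * Jm (mat k) := by
  rw [Q, mat_mul, cx_mul, Matrix.mul_assoc, cx_mul_V_of_mem hk h1, ← Matrix.mul_assoc, Q]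

theorem det_Jm (M : M4) : (Jm M).det = detJ (Q M) := by
  rw [Matrix.det_fin_two, Jm, detJ]; simp

theorem explicit_mul_of_mem (κ : ℂ) (L p q : ℕ) {k : GSp4} (hk : k ∈ K) (h1 : mu2 k = 1)
    (g : GSp4) : explicit κ L (lowest p q) (g * k) =
      ∑ i ∈ Finset.range (p + 1), ∑ j ∈ Finset.range (q + 1),
        (detJ (Q (mat k)))⁻¹ ^ L * (Jm (mat k) 0 1 ^ i * Jm (mat k) 1 1 ^ (p - i) * p.choose i *
          (Jm (mat k) 0 1 ^ j * Jm (mat k) 1 1 ^ (q - j) * q.choose j)) *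
          explicit κ L (mono p q i j) g := by
  have hμ : mu2 (g * k) = mu2 g := by rw [mu2_mul, h1, mul_one]
  unfold explicit
  rw [hμ]
  split_ifs with h
  · rw [Q_mul_of_mem g hk h1, hol_mul _ _ _ (by rw [det_Jm]; exact detJ_ne_zero k), det_Jm,
      lowest_mul]
    simp only [hol, Finset.mul_sum, Finset.sum_mul]
    refine Finset.sum_congr rfl fun i _ => Finset.sum_congr rfl fun j _ => ?_
    ring
  · simp

/-- The element `diag(1, 1, -1, -1)` of `K`. -/
def refl : GSp4 :=
  mkGSp !![1, 0, 0, 0; 0, 1, 0, 0; 0, 0, -1, 0; 0, 0, 0, -1] (-1) (by simp) (by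
    ext i j
    fin_cases i <;> fin_cases j <;> simp [J4, Matrix.mul_apply, Fin.sum_univ_four])

theorem refl_mem : refl ∈ K := by
  change (mat refl)ᵀ * mat refl = 1
  rw [refl, mat_mkGSp]
  ext i j
  fin_cases i <;> fin_cases j <;> simp [Matrix.mul_apply, Fin.sum_univ_four]

theorem mu2_of_mem {k : GSp4} (hk : k ∈ K) : mu2 k = 1 ∨ mu2 k = -1 := by
  have hO : (mat k)ᵀ * mat k = 1 := hk
  have h2 := mul_eq_one_comm.mp hO
  have h : (mu2 k * mu2 k) • (-1 : M4) = -1 := by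
    calc (mu2 k * mu2 k) • (-1 : M4) = (mu2 k • J4 ℝ) * (mu2 k • J4 ℝ) := by
          rw [Matrix.smul_mul, Matrix.mul_smul, smul_smul, J4_mul_J4]
      _ = (mat k)ᵀ * J4 ℝ * (mat k * (mat k)ᵀ) * J4 ℝ * mat k := by
          rw [← mat_mem]; simp only [Matrix.mul_assoc]
      _ = _ := by
          rw [h2, Matrix.mul_one, Matrix.mul_assoc (mat k)ᵀ, J4_mul_J4]; simp [hO]
  have := congrFun (congrFun h 0) 0
  simp at this
  exact mul_self_eq_one_iff.1 this

/-- Elements of `K` with multiplier `1` multiply `J` by a unitary matrix, so the translates stay in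
the span of the functions built from `mono`. The other coset of `K` is represented by `refl`, which
at most doubles the spanning set. -/
theorem kFinite_explicit (κ : ℂ) (L p q : ℕ) : KFinite (explicit κ L (lowest p q)) := by
  let F : (Fin (p + 1) × Fin (q + 1)) ⊕ (Fin (p + 1) × Fin (q + 1)) → GSp4 → ℂ :=
    Sum.elim (fun i => explicit κ L (mono p q i.1 i.2))
      (fun i g => explicit κ L (mono p q i.1 i.2) (g * refl))
  have : FiniteDimensional ℂ (Submodule.span ℂ (Set.range F)) :=
    FiniteDimensional.span_of_finite ℂ (Set.finite_range F)
  unfold KFinite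
  refine Submodule.finiteDimensional_of_le (S₂ := Submodule.span ℂ (Set.range F)) ?_
  rw [Submodule.span_le]
  rintro _ ⟨⟨k, hk⟩, rfl⟩
  rcases mu2_of_mem hk with h1 | h1
  · simp only [fun g => explicit_mul_of_mem κ L p q hk h1 g, Finset.sum_range]
    have e : (fun g => ∑ i : Fin (p + 1), ∑ j : Fin (q + 1),
        (detJ (Q (mat k)))⁻¹ ^ L * (Jm (mat k) 0 1 ^ (i : ℕ) * Jm (mat k) 1 1 ^ (p - i) *
          p.choose i * (Jm (mat k) 0 1 ^ (j : ℕ) * Jm (mat k) 1 1 ^ (q - j) * q.choose j)) *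
          explicit κ L (mono p q i j) g) = ∑ i : Fin (p + 1), ∑ j : Fin (q + 1),
        ((detJ (Q (mat k)))⁻¹ ^ L * (Jm (mat k) 0 1 ^ (i : ℕ) * Jm (mat k) 1 1 ^ (p - i) *
          p.choose i * (Jm (mat k) 0 1 ^ (j : ℕ) * Jm (mat k) 1 1 ^ (q - j) * q.choose j))) •
          F (Sum.inl (i, j)) := by
      funext g
      simp [F, Finset.sum_apply]
    rw [e]
    exact Submodule.sum_mem _ fun i _ => Submodule.sum_mem _ fun j _ =>
      Submodule.smul_mem _ _ (Submodule.subset_span ⟨_, rfl⟩)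
  · set k₁ := refl⁻¹ * k with hk₁
    have hkk : k = refl * k₁ := by rw [hk₁]; simp
    have hk₁' : k₁ ∈ K := K.mul_mem (K.inv_mem refl_mem) hk
    have hμ₁ : mu2 k₁ = 1 := by
      have h2 := mu2_mul refl k₁
      rw [← hkk, h1, refl, mu2_mkGSp] at h2
      linarith
    have h := fun g => explicit_mul_of_mem κ L p q hk₁' hμ₁ (g * refl)
    have hgk : ∀ g, g * refl * k₁ = g * k := fun g => by rw [mul_assoc, ← hkk]
    simp only [hgk] at h
    simp only [h, Finset.sum_range]
    have e : (fun g => ∑ i : Fin (p + 1), ∑ j : Fin (q + 1),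
        (detJ (Q (mat k₁)))⁻¹ ^ L * (Jm (mat k₁) 0 1 ^ (i : ℕ) * Jm (mat k₁) 1 1 ^ (p - i) *
          p.choose i * (Jm (mat k₁) 0 1 ^ (j : ℕ) * Jm (mat k₁) 1 1 ^ (q - j) * q.choose j)) *
          explicit κ L (mono p q i j) (g * refl)) = ∑ i : Fin (p + 1), ∑ j : Fin (q + 1),
        ((detJ (Q (mat k₁)))⁻¹ ^ L * (Jm (mat k₁) 0 1 ^ (i : ℕ) * Jm (mat k₁) 1 1 ^ (p - i) *
          p.choose i * (Jm (mat k₁) 0 1 ^ (j : ℕ) * Jm (mat k₁) 1 1 ^ (q - j) * q.choose j))) •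
          F (Sum.inr (i, j)) := by
      funext g
      simp [F, Finset.sum_apply]
    rw [e]
    exact Submodule.sum_mem _ fun i _ => Submodule.sum_mem _ fun j _ =>
      Submodule.smul_mem _ _ (Submodule.subset_span ⟨_, rfl⟩)

/-! ### The structure of the space of Bessel functions -/

/-- The exponent of the multiplier is dictated by `explicit_equivariant`; in terms of the weights it
is `(l + l' + s)/2`. -/
theorem explicit_mem (s : ℂ) (L p q : ℕ) :
    InBesselSpace s (p - q) L (L - p - q)
      (explicit ((2 * L - p - q + s) / 2) L (lowest p q)) := by
  obtain ⟨h1, h2, h3, h4, h5, h6⟩ := explicit_lie ((2 * L - p - q + s) / 2) L p q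
  exact
  { smooth := isSmooth_explicit _ _ _ _
    kfinite := kFinite_explicit _ _ _ _
    equivariant := fun t ht X hX g => explicit_equivariant (by ring) ht X hX g
    growth := slowlyIncreasing_explicit _ _ _ _
    weight := by simpa using h1
    weight' := by simpa using h2
    Nplus_eq := h3
    Xminus_eq := h4
    P1minus_eq := h5
    P0minus_eq := h6 }

theorem explicit_one_ne_zero (κ : ℂ) (L p q : ℕ) : explicit κ L (lowest p q) 1 ≠ 0 := by
  have h1 : mu2 1 = 1 := by simp [mu2, mat, J4]
  have hQ : ∀ i, Q (mat 1) i 0 = (1 : M4) i 2 + I * (1 : M4) i 0 ∧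
      Q (mat 1) i 1 = (1 : M4) i 3 + I * (1 : M4) i 1 := fun i => Q_entry _ i
  have hl : lowest p q (Q (mat 1)) = 1 := by
    simp [lowest, (hQ _).2]
  rw [explicit, h1, if_pos one_pos, hol, hl]
  have := detJ_ne_zero 1
  simp [this]

/-- The solution is `p = (l - l' + m)/2`, `q = (l - l' - m)/2`: parity makes these integers and `|m|
≤ l - l'` makes them non-negative. Positivity of the weights allows `l` to be a natural number. -/
theorem exists_params {l l' m : ℤ} (hl' : 0 < l') (hll' : l' ≤ l) (he : Even (l + l' + m))
    (hm : |m| ≤ l - l') : ∃ L p q : ℕ, l = L ∧ l' = L - p - q ∧ m = p - q := by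
  obtain ⟨r, hr⟩ := he
  rw [abs_le] at hm
  exact ⟨l.toNat, (r - l').toNat, (l - r).toNat, by omega, by omega, by omega⟩

section
variable {s : ℂ} {m l l' : ℤ} {B : GSp4 → ℂ}

theorem InBesselSpace.eq_zero_or (hB : InBesselSpace s m l l' B) (hll' : l' ≤ l) :
    B = 0 ∨ Even (l + l' + m) ∧ |m| ≤ l - l' := by
  by_cases h : B 1 = 0
  · exact Or.inl (hB.eq_zero h)
  · exact Or.inr (hB.parity hll' (ε := 1) (by simp) (by rwa [one_eq_sec]))

/-- The difference lies in the space and vanishes at the identity, hence everywhere. -/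
theorem InBesselSpace.eq_smul {E : GSp4 → ℂ} (hB : InBesselSpace s m l l' B)
    (hE : InBesselSpace s m l l' E) (h : E 1 ≠ 0) : B = (B 1 / E 1) • E := by
  have hd : B - (B 1 / E 1) • E ∈ besselSpace s m l l' :=
    (besselSpace s m l l').sub_mem hB ((besselSpace s m l l').smul_mem _ hE)
  have := InBesselSpace.eq_zero hd (by simp [h])
  exact sub_eq_zero.1 this

end

theorem rank_besselSpace {l l' : ℤ} (hl' : 0 < l') (hll' : l' ≤ l) (s : ℂ) {m : ℤ}
    (he : Even (l + l' + m)) :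
    Module.rank ℂ (besselSpace s m l l') = if |m| ≤ l - l' then 1 else 0 := by
  split_ifs with hm
  · obtain ⟨L, p, q, rfl, rfl, rfl⟩ := exists_params hl' hll' he hm
    have hE := explicit_mem s L p q
    have h1 := explicit_one_ne_zero ((2 * L - p - q + s) / 2) L p q
    refine rank_eq_one (⟨_, hE⟩ : besselSpace s (p - q) L (L - p - q)) (fun h => h1 ?_)
      fun B => ⟨_, Subtype.ext (InBesselSpace.eq_smul B.2 hE h1).symm⟩
    rw [Subtype.mk_eq_mk.1 h]
    rfl
  · have : besselSpace s m l l' = ⊥ := by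
      rw [Submodule.eq_bot_iff]
      exact fun B hB => (InBesselSpace.eq_zero_or hB hll').resolve_right fun h => hm h.2
    rw [this, rank_bot]

/-! ### Explicit values -/

theorem mu2_of_mem_K1 {k : GSp4} (hk : k ∈ K1) : mu2 k = 1 := by
  have h : (mat k)ᵀ * J4 ℝ * mat k = J4 ℝ := hk.2
  rw [mu2, h]
  simp [J4]

/-- At the diagonal element `J = diag(ζ⁻¹, ζ)` has determinant one and `τ = iλ diag(ζ², ζ⁻²)`, which
gives the exponential. Right multiplication by `k` leaves `τ` alone and multiplies `J` by the
automorphy factor of `k`. -/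
theorem explicit_diagElt_mul (κ : ℂ) (L p q : ℕ) (lam zeta : ℝˣ) {k : GSp4} (hk : k ∈ K1) :
    explicit κ L (lowest p q) (diagElt lam zeta * k) =
      if 0 < (lam : ℝ) then
        ((detJ (Q (mat k)))⁻¹ ^ L *
          ((zeta * Jm (mat k) 1 1 + I * ((zeta : ℂ)⁻¹ * Jm (mat k) 0 1)) ^ p *
            (zeta * Jm (mat k) 1 1 - I * ((zeta : ℂ)⁻¹ * Jm (mat k) 0 1)) ^ q)) *
          ((lam : ℂ) ^ κ *
            (Real.exp (-2 * Real.pi * lam * ((zeta : ℝ) ^ 2 + ((zeta : ℝ) ^ 2)⁻¹)) : ℂ))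
      else 0 := by
  have hk1 := mu2_of_mem_K1 hk
  have hz : (zeta : ℂ) ≠ 0 := by exact_mod_cast zeta.ne_zero
  have hμ : mu2 (diagElt lam zeta * k) = lam := by
    rw [mu2_mul, hk1, mul_one, diagElt, mu2_mkGSp]
  have hQ : Q (mat (diagElt lam zeta)) = !![I * (lam * zeta), 0; 0, I * (lam * (zeta : ℂ)⁻¹);
      (zeta : ℂ)⁻¹, 0; 0, (zeta : ℂ)] := by
    ext i j
    fin_cases j
    · rw [Fin.zero_eta, (Q_entry _ _).1]
      fin_cases i <;> simp [diagElt]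
    · rw [Fin.mk_one, (Q_entry _ _).2]
      fin_cases i <;> simp [diagElt]
  unfold explicit
  rw [hμ]
  split_ifs with h
  · rw [Q_mul_of_mem _ hk.1 hk1, hol_mul _ _ _ (by rw [det_Jm]; exact detJ_ne_zero k), det_Jm, hQ]
    have hd : detJ !![I * (lam * zeta), 0; 0, I * (lam * (zeta : ℂ)⁻¹);
        (zeta : ℂ)⁻¹, 0; 0, (zeta : ℂ)] = 1 := by
      simp [detJ, hz]
    have ht : trN !![I * (lam * zeta), 0; 0, I * (lam * (zeta : ℂ)⁻¹);
        (zeta : ℂ)⁻¹, 0; 0, (zeta : ℂ)] = I * (lam * (zeta ^ 2 + ((zeta : ℂ) ^ 2)⁻¹)) := by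
      simp [trN]
      ring
    have hl : lowest p q (!![I * (lam * zeta), 0; 0, I * (lam * (zeta : ℂ)⁻¹);
        (zeta : ℂ)⁻¹, 0; 0, (zeta : ℂ)] * Jm (mat k)) =
        (zeta * Jm (mat k) 1 1 + I * ((zeta : ℂ)⁻¹ * Jm (mat k) 0 1)) ^ p *
          (zeta * Jm (mat k) 1 1 - I * ((zeta : ℂ)⁻¹ * Jm (mat k) 0 1)) ^ q := by
      simp [lowest, Matrix.mul_apply, Fin.sum_univ_two]
    rw [hd, ht, hl, Complex.ofReal_exp]
    have he : 2 * Real.pi * I * (I * (lam * (zeta ^ 2 + ((zeta : ℂ) ^ 2)⁻¹)) / 1) =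
        ((-2 * Real.pi * lam * ((zeta : ℝ) ^ 2 + ((zeta : ℝ) ^ 2)⁻¹) : ℝ) : ℂ) := by
      push_cast
      linear_combination (2 * Real.pi * (lam * (zeta ^ 2 + ((zeta : ℂ) ^ 2)⁻¹))) * Complex.I_sq
    rw [he]
    simp
    ring
  · rfl

theorem r1_mul_r2_mem (φ₁ φ₂ : ℝ) : r1 φ₁ * r2 φ₂ ∈ K1 := by
  have h1 : ∀ φ, r1 φ ∈ K1 := fun φ => by
    have h := Real.sin_sq_add_cos_sq φ
    refine ⟨?_, ?_⟩
    · change (mat (r1 φ))ᵀ * mat (r1 φ) = 1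
      rw [r1, mat_mkGSp]
      ext i j
      fin_cases i <;> fin_cases j <;> simp [Matrix.mul_apply, Fin.sum_univ_four] <;> linarith
    · change (mat (r1 φ))ᵀ * J4 ℝ * mat (r1 φ) = J4 ℝ
      rw [mat_mem, r1, mu2_mkGSp, one_smul]
  have h2 : ∀ φ, r2 φ ∈ K1 := fun φ => by
    have h := Real.sin_sq_add_cos_sq φ
    refine ⟨?_, ?_⟩
    · change (mat (r2 φ))ᵀ * mat (r2 φ) = 1
      rw [r2, mat_mkGSp]
      ext i j
      fin_cases i <;> fin_cases j <;> simp [Matrix.mul_apply, Fin.sum_univ_four] <;> linarith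
    · change (mat (r2 φ))ᵀ * J4 ℝ * mat (r2 φ) = J4 ℝ
      rw [mat_mem, r2, mu2_mkGSp, one_smul]
  exact K1.mul_mem (h1 φ₁) (h2 φ₂)

/-- The origin of `u` and `v`: the second column is `(-iv, u)`, so `ζ J₁₁ ± i ζ⁻¹ J₀₁` becomes `ζu ±
ζ⁻¹v`. -/
theorem Jm_r1_mul_r2 (φ₁ φ₂ : ℝ) : Jm (mat (r1 φ₁ * r2 φ₂)) =
    !![conj (uFun φ₁ φ₂), -I * vFun φ₁ φ₂; -I * conj (vFun φ₁ φ₂), uFun φ₁ φ₂] := by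
  rw [mat_mul, Jm_apply, r1, r2, mat_mkGSp, mat_mkGSp]
  ext i j
  fin_cases i <;> fin_cases j <;>
    simp [Matrix.mul_apply, Fin.sum_univ_four, uFun, vFun, Complex.conj_ofReal,
      -Complex.ofReal_cos, -Complex.ofReal_sin] <;> ring_nf <;> simp [Complex.I_sq]

theorem detJ_r1_mul_r2 (φ₁ φ₂ : ℝ) : detJ (Q (mat (r1 φ₁ * r2 φ₂))) = 1 := by
  have h₁ : (Real.sin φ₁ : ℂ) ^ 2 + Real.cos φ₁ ^ 2 = 1 := by
    exact_mod_cast Real.sin_sq_add_cos_sq φ₁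
  have h₂ : (Real.sin φ₂ : ℂ) ^ 2 + Real.cos φ₂ ^ 2 = 1 := by
    exact_mod_cast Real.sin_sq_add_cos_sq φ₂
  rw [← det_Jm, Jm_r1_mul_r2, Matrix.det_fin_two_of]
  have e : conj (uFun φ₁ φ₂) * uFun φ₁ φ₂ - -I * vFun φ₁ φ₂ * (-I * conj (vFun φ₁ φ₂)) =
      uFun φ₁ φ₂ * conj (uFun φ₁ φ₂) + vFun φ₁ φ₂ * conj (vFun φ₁ φ₂) := by
    linear_combination (-vFun φ₁ φ₂ * conj (vFun φ₁ φ₂)) * Complex.I_sq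
  rw [e]
  simp only [uFun, vFun, map_add, map_mul, Complex.conj_ofReal, Complex.conj_I]
  generalize (Real.sin φ₁ : ℂ) = a at *
  generalize (Real.cos φ₁ : ℂ) = b at *
  generalize (Real.sin φ₂ : ℂ) = c at *
  generalize (Real.cos φ₂ : ℂ) = d at *
  linear_combination (-(a * c) ^ 2 - (a * d) ^ 2) * Complex.I_sq + (c ^ 2 + d ^ 2) * h₁ + h₂

/-- The double angle formulas express `2u²` and `2v²` as `(cos 2φ₁ + i sin 2φ₁ sin 2φ₂) ± cos 2φ₂`,
so that `w = 2(ζ²u² - ζ⁻²v²)`. -/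
theorem wFun_eq {zeta : ℝ} (hz : zeta ≠ 0) (φ₁ φ₂ : ℝ) : wFun zeta φ₁ φ₂ =
    2 * ((zeta * uFun φ₁ φ₂ + (zeta : ℂ)⁻¹ * vFun φ₁ φ₂) *
      (zeta * uFun φ₁ φ₂ - (zeta : ℂ)⁻¹ * vFun φ₁ φ₂)) := by
  have h₁ : (Real.sin φ₁ : ℂ) ^ 2 + Real.cos φ₁ ^ 2 = 1 := by
    exact_mod_cast Real.sin_sq_add_cos_sq φ₁
  have h₂ : (Real.sin φ₂ : ℂ) ^ 2 + Real.cos φ₂ ^ 2 = 1 := by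
    exact_mod_cast Real.sin_sq_add_cos_sq φ₂
  have hc : (zeta : ℂ) ≠ 0 := by exact_mod_cast hz
  rw [wFun, uFun, vFun, Real.cos_two_mul, Real.cos_two_mul, Real.sin_two_mul, Real.sin_two_mul]
  push_cast only [Complex.ofReal_sub, Complex.ofReal_add, Complex.ofReal_inv, Complex.ofReal_pow,
    Complex.ofReal_mul, Complex.ofReal_one, Complex.ofReal_ofNat]
  generalize (Real.sin φ₁ : ℂ) = a at *
  generalize (Real.cos φ₁ : ℂ) = b at *
  generalize (Real.sin φ₂ : ℂ) = c at *
  generalize (Real.cos φ₂ : ℂ) = d at *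
  have hu : 2 * (b * d + I * a * c) ^ 2 =
      (2 * b ^ 2 - 1 + I * (2 * a * b) * (2 * c * d)) + (2 * d ^ 2 - 1) := by
    linear_combination (2 * (a * c) ^ 2) * Complex.I_sq - 2 * c ^ 2 * h₁ + (2 * b ^ 2 - 2) * h₂
  have hv : 2 * (b * c + I * a * d) ^ 2 =
      (2 * b ^ 2 - 1 + I * (2 * a * b) * (2 * c * d)) - (2 * d ^ 2 - 1) := by
    linear_combination (2 * (a * d) ^ 2) * Complex.I_sq - 2 * d ^ 2 * h₁ + (2 * b ^ 2) * h₂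
  have hi : (zeta : ℂ) * (zeta : ℂ)⁻¹ = 1 := mul_inv_cancel₀ hc
  rw [← inv_pow]
  linear_combination (-(zeta : ℂ) ^ 2) * hu + ((zeta : ℂ)⁻¹ ^ 2) * hv

/-- The exponent of `w` is `q` for `m ≥ 0` and `p` for `m < 0`. After factoring `w`, both branches
become one monomial in the two linear forms, with the same power `2^q` thanks to the `2^{-m}` in the
second. -/
theorem c1_eq (L p q : ℕ) {zeta : ℝ} (hz : zeta ≠ 0) (φ₁ φ₂ : ℝ) :
    c1 L (L - p - q) (p - q) zeta φ₁ φ₂ =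
      2 ^ q * ((zeta * uFun φ₁ φ₂ + (zeta : ℂ)⁻¹ * vFun φ₁ φ₂) ^ p *
        (zeta * uFun φ₁ φ₂ - (zeta : ℂ)⁻¹ * vFun φ₁ φ₂) ^ q) := by
  rw [c1, wFun_eq hz]
  generalize (zeta * uFun φ₁ φ₂ + (zeta : ℂ)⁻¹ * vFun φ₁ φ₂) = ξ
  generalize (zeta * uFun φ₁ φ₂ - (zeta : ℂ)⁻¹ * vFun φ₁ φ₂) = η
  split_ifs with h
  · obtain ⟨r, rfl⟩ : ∃ r, p = q + r := Nat.exists_eq_add_of_le (by omega)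
    rw [show ((q + r : ℕ) - q : ℤ) = (r : ℕ) by push_cast; ring,
      show (L - (L - (q + r : ℕ) - q) - (r : ℕ) : ℤ) / 2 = (q : ℕ) by push_cast; omega,
      zpow_natCast, zpow_natCast, mul_pow, mul_pow, pow_add]
    ring
  · obtain ⟨r, rfl⟩ : ∃ r, q = p + r := Nat.exists_eq_add_of_le (by omega)
    rw [show (-(p - (p + r : ℕ)) : ℤ) = (r : ℕ) by push_cast; ring,
      show (L - (L - p - (p + r : ℕ)) + (p - (p + r : ℕ)) : ℤ) / 2 = (p : ℕ) by push_cast; omega,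
      zpow_natCast, zpow_natCast, zpow_natCast, mul_pow, mul_pow, pow_add, pow_add]
    ring

theorem explicit_hElt (s : ℂ) (L p q : ℕ) (lam zeta : ℝˣ) (φ₁ φ₂ : ℝ) :
    explicit ((2 * L - p - q + s) / 2) L (lowest p q) (hElt lam zeta φ₁ φ₂) =
      if 0 < (lam : ℝ) then
        (2 ^ q)⁻¹ * (c1 L (L - p - q) (p - q) zeta φ₁ φ₂ * radial s L (L - p - q) lam zeta)
      else 0 := by
  have hκ : ((((L : ℤ) : ℂ) + ((L - p - q : ℤ) : ℂ) + s) / 2) = (2 * L - p - q + s) / 2 := by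
    push_cast
    ring
  rw [hElt, mul_assoc, explicit_diagElt_mul _ _ _ _ _ _ (r1_mul_r2_mem φ₁ φ₂), detJ_r1_mul_r2,
    Jm_r1_mul_r2, c1_eq _ _ _ zeta.ne_zero, radial, hκ]
  split_ifs with h
  · have e : I * ((zeta : ℂ)⁻¹ * (-I * vFun φ₁ φ₂)) = (zeta : ℂ)⁻¹ * vFun φ₁ φ₂ := by
      linear_combination (-(zeta : ℂ)⁻¹ * vFun φ₁ φ₂) * Complex.I_sq
    have h2 : (2 : ℂ) ^ q ≠ 0 := pow_ne_zero _ two_ne_zero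
    simp only [Matrix.of_apply, Matrix.cons_val', Matrix.cons_val_zero, Matrix.cons_val_one,
      Matrix.cons_val_fin_one, e]
    field_simp
    simp
  · rfl

/-! ### The expansion in powers of `ζ` -/

/-- The coefficient of `ζ^j` in the restriction of the explicit Bessel function to `K¹`. -/
def coef (L p q : ℕ) (j : ℤ) (M : M4) : ℂ :=
  (detJ (Q M))⁻¹ ^ L * ∑ a ∈ Finset.range (p + 1), ∑ b ∈ Finset.range (q + 1),
    -- The binomial terms with indices `a` and `b` contain `a + b` factors `ζ` and `p + q - a - b`
    -- factors `ζ⁻¹`. All exponents thus have the parity of `p + q`.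
    if 2 * ((a : ℤ) + b) - (p + q) = j then
      (Q M 3 1 ^ (a + b) * ((I * Q M 2 1) ^ (p - a) * (-I * Q M 2 1) ^ (q - b))) *
        (p.choose a * q.choose b)
    else 0

theorem isAnalytic_coef (c : ℂ) (L p q : ℕ) (j : ℤ) :
    IsAnalyticK1 (fun k => c * coef L p q j (mat (k : GSp4))) := by
  intro k
  refine ⟨{M | detJ (Q M) ≠ 0}, fun M => c * coef L p q j M,
    isOpen_ne_fun (contDiff_detJ 0).continuous continuous_const, detJ_ne_zero _, ?_, fun _ _ => rfl⟩
  refine contDiffOn_const.mul (ContDiffOn.mul (ContDiffOn.pow (ContDiffOn.inv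
    (contDiff_detJ _).contDiffOn fun M hM => hM) L) (ContDiff.contDiffOn ?_))
  refine ContDiff.sum fun a _ => ContDiff.sum fun b _ => ?_
  split_ifs
  · exact (((contDiff_Q _ 3 1).pow _).mul (((contDiff_const.mul (contDiff_Q _ 2 1)).pow _).mul
      ((contDiff_const.mul (contDiff_Q _ 2 1)).pow _))).mul contDiff_const
  · exact contDiff_const

theorem coef_eq_zero (L p q : ℕ) {j : ℤ} (hj : ¬ j ≡ p + q [ZMOD 2]) (M : M4) :
    coef L p q j M = 0 := by
  rw [coef]
  refine mul_eq_zero_of_right _ (Finset.sum_eq_zero fun a _ => Finset.sum_eq_zero fun b _ =>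
    if_neg fun h => hj ?_)
  rw [← h, Int.ModEq]
  omega

theorem sum_coef (L p q : ℕ) (M : M4) {z : ℂ} (hz : z ≠ 0) :
    ∑ j ∈ Finset.Icc (-(p + q : ℤ)) (p + q), coef L p q j M * z ^ j =
      (detJ (Q M))⁻¹ ^ L * ((z * Q M 3 1 + I * (z⁻¹ * Q M 2 1)) ^ p *
        (z * Q M 3 1 - I * (z⁻¹ * Q M 2 1)) ^ q) := by
  have hq : z * Q M 3 1 - I * (z⁻¹ * Q M 2 1) = z * Q M 3 1 + -I * (z⁻¹ * Q M 2 1) := by ring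
  rw [hq, add_pow, add_pow, Finset.sum_mul_sum]
  simp only [coef, Finset.mul_sum, Finset.sum_mul]
  rw [Finset.sum_comm]
  refine Finset.sum_congr rfl fun a ha => ?_
  rw [Finset.sum_comm]
  refine Finset.sum_congr rfl fun b hb => ?_
  rw [Finset.mem_range] at ha hb
  simp only [mul_ite, mul_zero, ite_mul, zero_mul]
  rw [Finset.sum_ite_eq, if_pos (Finset.mem_Icc.2 ⟨by omega, by omega⟩)]
  have e : z ^ (2 * ((a : ℤ) + b) - (p + q)) = z ^ (a + b) * (z⁻¹ ^ (p - a) * z⁻¹ ^ (q - b)) := by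
    rw [← pow_add, inv_pow, ← zpow_natCast, ← zpow_natCast, ← _root_.zpow_neg, ← zpow_add₀ hz]
    congr 1
    push_cast
    omega
  rw [e]
  simp only [mul_pow, pow_add]
  ring

theorem explicit_hElt_mul (s : ℂ) (L p q : ℕ) (lam zeta : ℝˣ) (k : K1) (h : 0 < (lam : ℝ)) :
    explicit ((2 * L - p - q + s) / 2) L (lowest p q) (hElt lam zeta 0 0 * (k : GSp4)) =
      (∑ j ∈ Finset.Icc (-(p + q : ℤ)) (p + q), coef L p q j (mat (k : GSp4)) * (zeta : ℂ) ^ j) *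
        radial s L (L - p - q) lam zeta := by
  have h0 : hElt lam zeta 0 0 = diagElt lam zeta := by
    have h1 : r1 0 = 1 := ext_mat (by
      rw [r1, mat_mkGSp]; ext i j; fin_cases i <;> fin_cases j <;> simp [mat])
    have h2 : r2 0 = 1 := ext_mat (by
      rw [r2, mat_mkGSp]; ext i j; fin_cases i <;> fin_cases j <;> simp [mat])
    rw [hElt, h1, h2, mul_one, mul_one]
  have hκ : ((((L : ℤ) : ℂ) + ((L - p - q : ℤ) : ℂ) + s) / 2) = (2 * L - p - q + s) / 2 := by
    push_cast
    ring
  rw [h0, explicit_diagElt_mul _ _ _ _ _ _ k.2, if_pos h,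
    sum_coef _ _ _ _ (by exact_mod_cast zeta.ne_zero), radial, hκ]
  rfl

end Bessel

end

/-! ### The theorem, by comparison with the explicit function. -/

theorem mainTheorem2 (l l' : ℤ) (hl' : 0 < l') (hll' : l' ≤ l) (s : ℂ) (m : ℤ) :
    (Odd (l + l' + m) → Bessel.besselSpace s m l l' = ⊥) ∧
    (Even (l + l' + m) →
      Module.rank ℂ (Bessel.besselSpace s m l l') = if |m| ≤ l - l' then 1 else 0) ∧
    (Even (l + l' + m) → |m| ≤ l - l' →
      ∀ B₀ ∈ Bessel.besselSpace s m l l', B₀ ≠ 0 →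
        (∃ c : ℂ, c ≠ 0 ∧ ∀ (lam zeta : ℝˣ) (φ₁ φ₂ : ℝ), 0 < (zeta : ℝ) →
          B₀ (Bessel.hElt lam zeta φ₁ φ₂) =
            if 0 < (lam : ℝ) then
              c * (Bessel.c1 l l' m zeta φ₁ φ₂ * Bessel.radial s l l' lam zeta)
            else 0) ∧
        (∃ A : ℤ → Bessel.K1 → ℂ,
          (∀ j, Bessel.IsAnalyticK1 (A j)) ∧
          (∀ j, ¬ j ≡ l - l' [ZMOD 2] → A j = 0) ∧
          ∀ (lam zeta : ℝˣ) (k : Bessel.K1), 0 < (lam : ℝ) → 0 < (zeta : ℝ) →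
            B₀ (Bessel.hElt lam zeta 0 0 * (k : Bessel.GSp4)) =
              (∑ j ∈ Finset.Icc (-(l - l')) (l - l'), A j k * (zeta : ℂ) ^ j) *
                Bessel.radial s l l' lam zeta)) := by
  refine ⟨fun ho => ?_, fun he => Bessel.rank_besselSpace hl' hll' s he,
    fun he hm B₀ hB h0 => ?_⟩
  · rw [Submodule.eq_bot_iff]
    exact fun B hB => (Bessel.InBesselSpace.eq_zero_or hB hll').resolve_right fun h =>
      Int.not_even_iff_odd.2 ho h.1
  · obtain ⟨L, p, q, rfl, rfl, rfl⟩ := Bessel.exists_params hl' hll' he hm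
    have hE := Bessel.explicit_mem s L p q
    have h1 := Bessel.explicit_one_ne_zero ((2 * L - p - q + s) / 2) L p q
    have hBE := Bessel.InBesselSpace.eq_smul hB hE h1
    set c := B₀ 1 / Bessel.explicit ((2 * L - p - q + s) / 2) L (Bessel.lowest p q) 1
    have hc : c ≠ 0 := fun hc => h0 (by rw [hBE, hc, zero_smul])
    -- The constant absorbs the factor `2^q` by which `c1` differs from the monomial in the explicit
    -- function; the coefficients `A j` need no such correction.
    refine ⟨⟨c * (2 ^ q)⁻¹, mul_ne_zero hc (inv_ne_zero (pow_ne_zero _ two_ne_zero)),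
      fun lam zeta φ₁ φ₂ _ => ?_⟩,
      fun j k => c * Bessel.coef L p q j (Bessel.mat (k : Bessel.GSp4)),
      fun j => Bessel.isAnalytic_coef c L p q j, fun j hj => ?_, fun lam zeta k hlam _ => ?_⟩
    · rw [hBE, Pi.smul_apply, Bessel.explicit_hElt, smul_eq_mul]
      split_ifs
      · rw [mul_assoc]
      · rw [mul_zero]
    · funext k
      change c * Bessel.coef L p q j (Bessel.mat (k : Bessel.GSp4)) = 0
      rw [Bessel.coef_eq_zero L p q (by rwa [show (p + q : ℤ) = L - (L - p - q) by ring]), mul_zero]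
    · rw [hBE, Pi.smul_apply, Bessel.explicit_hElt_mul s L p q lam zeta k hlam, smul_eq_mul,
        show (L - (L - p - q) : ℤ) = p + q by ring, ← mul_assoc, Finset.mul_sum]
      simp only [mul_assoc]
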